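/- For a set $S\subset L^2(\mathbb R)$ (complex-valued functions) let $V(S)$ be the closed linear span in $L^2(\mathbb R)$ of $\{f(\cdot-n): f\in S,\ n\in\mathbb Z\}$. For a finite family $F=\{f_k\}_{k=1}^K\subset L^2(\mathbb R)$ write $V(F)$ for the space so generated, and let $\mathcal T(F)=\{f_k(\cdot-n): 1\le k\le K,\ n\in\mathbb Z\}$. Let $J$ be the minimal cardinality of a set $S\subset L^2(\mathbb R)$ with $V(S)=V(F)$. The space $V(F)$ has *non-trivial extra invariance* if there is $\gamma\in\mathbb R\setminus\mathbb Z$ with $J\gamma\notin\mathbb Z$ such that $h(\cdot-\gamma)\in V(F)$ for every $h\in V(F)$. A system $\{g_n\}$ in a Hilbert space $H$ is *exact* if its closed linear span is $H$ and no $g_n$ lies in the closed linear span of the remaining elements; it is a *$(C_q)$-system* if there is $C>0$ such that every $f\in H$ can be approximated arbitrarily well by finite linear combinations $\sum a_n g_n$ with $\|(a_n)\|_{\ell^q}\le C\|f\|_H$; it is an *exact $(C_q)$-system* if it is both. **Theorem.** Let $2\le q\le\infty$ and let $q'$ be the conjugate exponent, $1/q+1/q'=1$. (a) Let $F=\{f_k\}_{k=1}^K\subset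 L^2(\mathbb R)$. If $V(F)$ has non-trivial extra invariance and $\mathcal T(F)$ is an exact $(C_q)$-system for $V(F)$, then there is $k\in\{1,\dots,K\}$ such that $$\int_{\mathbb R}|x|^t|f_k(x)|^2\,dx=\infty\qquad\text{for every } t\ge 2/q'.$$ (b) The condition $t\ge 2/q'$ is sharp: for every $0\le t<2/q'$ there is $f\in L^2(\mathbb R)$ such that, with $F=\{f\}$, $V(F)$ has non-trivial extra invariance, $\mathcal T(F)$ is an exact $(C_q)$-system for $V(F)$, and $\int_{\mathbb R}|x|^t|f(x)|^2\,dx<\infty$. -/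

import Mathlib

open MeasureTheory
open scoped ENNReal

noncomputable section

/-! ### Exact `(C_q)`-systems in a Hilbert space -/

section Systems

variable {ι H : Type*} [NormedAddCommGroup H] [InnerProductSpace ℂ H]

/-- The `ℓ^q` norm of a finitely supported sequence (the norm of Mathlib's space `lp`;
for `q = ∞` it is the supremum norm). -/
def lqNorm (q : ℝ≥0∞) (a : ι →₀ ℂ) : ℝ :=
  ‖(⟨fun i => a i, (memℓp_zero a.hasFiniteSupport).of_exponent_ge zero_le⟩ :
    lp (fun _ : ι => ℂ) q)‖

/-- `g` is a `(C_q)`-system in `H`: there is `C > 0` such that every `f ∈ H` can be approximated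
arbitrarily well by finite linear combinations `∑ aₙ gₙ` with `‖a‖_{ℓ^q} ≤ C ‖f‖`. -/
def IsCqSystem (q : ℝ≥0∞) (g : ι → H) : Prop :=
  ∃ C : ℝ, 0 < C ∧ ∀ f : H, ∀ ε : ℝ, 0 < ε → ∃ a : ι →₀ ℂ,
    lqNorm q a ≤ C * ‖f‖ ∧ ‖f - Finsupp.linearCombination ℂ g a‖ < ε

/-- `g` is complete in `H`: its closed linear span is all of `H`. -/
def IsCompleteSystem (g : ι → H) : Prop :=
  (Submodule.span ℂ (Set.range g)).topologicalClosure = ⊤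

/-- `g` is minimal: each element lies outside the closed linear span of the remaining ones. -/
def IsMinimalSystem (g : ι → H) : Prop :=
  ∀ i : ι, g i ∉ (Submodule.span ℂ (g '' {i}ᶜ)).topologicalClosure

/-- An exact system: complete and minimal. -/
def IsExactSystem (g : ι → H) : Prop :=
  IsCompleteSystem g ∧ IsMinimalSystem g

/-- An exact `(C_q)`-system in `H`. -/
def IsExactCqSystem (q : ℝ≥0∞) (g : ι → H) : Prop :=
  IsExactSystem g ∧ IsCqSystem q g

end Systems

/-! ### Shift-invariant spaces in `L²(ℝ)` -/

/-- The space `L²(ℝ)` of complex-valued functions. -/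
abbrev L2R : Type := Lp ℂ 2 (volume : Measure ℝ)

/-- The translate `x ↦ f (x - a)`. -/
def l2Translate (a : ℝ) (f : L2R) : L2R :=
  Lp.compMeasurePreserving (fun x : ℝ => x - a) (measurePreserving_sub_right volume a) f

/-- The shift-invariant space `V(S)` generated by a set `S ⊆ L²(ℝ)`: the closed linear span of
all integer translates of the elements of `S`. -/
def shiftInvariantSpace (S : Set L2R) : Submodule ℂ L2R :=
  (Submodule.span ℂ {h : L2R | ∃ f ∈ S, ∃ n : ℤ, h = l2Translate (n : ℝ) f}).topologicalClosure

/-- The system `𝒯(F) = {f_k(x - n) : n ∈ ℤ, k = 1, …, K}`, as a system in the Hilbert space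
`V(F)`. -/
def integerTranslates {K : ℕ} (F : Fin K → L2R) :
    Fin K × ℤ → shiftInvariantSpace (Set.range F) := fun p =>
  ⟨l2Translate (p.2 : ℝ) (F p.1), Submodule.le_topologicalClosure _
    (Submodule.subset_span ⟨F p.1, Set.mem_range_self p.1, p.2, rfl⟩)⟩

/-- The minimal cardinality `J` of a set `S ⊆ L²(ℝ)` with `V(S) = V`. Only used for spaces `V`
that have a finite generating set, for which the set of numbers below is non-empty. -/
def minGenerators (V : Submodule ℂ L2R) : ℕ :=
  sInf {n : ℕ | ∃ S : Finset L2R, S.card = n ∧ shiftInvariantSpace (S : Set L2R) = V}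

/-- `V` has non-trivial extra invariance: for some `γ ∈ ℝ \ ℤ`, `V` is invariant under translation
by `γ` and `J γ ∉ ℤ`, where `J` is the minimal number of generators of `V`. -/
def HasNontrivialExtraInvariance (V : Submodule ℂ L2R) : Prop :=
  ∃ γ : ℝ, γ ∉ Set.range ((↑) : ℤ → ℝ) ∧ (∀ h ∈ V, l2Translate γ h ∈ V) ∧
    (minGenerators V : ℝ) * γ ∉ Set.range ((↑) : ℤ → ℝ)

/-- The moment `∫ |x|^t |f(x)|² dx ∈ [0, ∞]`. -/
def moment (t : ℝ) (f : L2R) : ℝ≥0∞ :=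
  ∫⁻ x : ℝ, ENNReal.ofReal (|x| ^ t * ‖f x‖ ^ 2)

end

/-!
For (a), exactness yields dual functions `h_k ∈ V(F)` whose integer translates are biorthogonal to
those of `F`. Hence for almost every `ξ` the fibers `(f̂_k(ξ + m))_m`, `1 ≤ k ≤ K`, are linearly
independent, and `J = K`. The translations preserving `V(F)` form a closed subgroup of `ℝ` which
contains `ℤ` and some `γ` with `Kγ ∉ ℤ`, so it contains `1/N` for some `N` not dividing `K`.
Invariance under translation by `1/N` means that the span of the fibers at `ξ` is stable under
restriction to `Nℤ`. Let `D(ξ)` be the rank of this restriction; the ranks at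
`ξ, ξ + 1, …, ξ + N - 1` add up to `K`. Since the integer-valued function `D` has the
non-integral mean `K/N`, it oscillates on some interval of each length `δ`, so the fibers cannot
vary too little there.
Quantitatively `c δ ≤ Ω W`, where `Ω` is the `L²`-modulus of continuity of the `f̂_k` at `δ` and `W`
bounds the `L²`-norm of the `ĥ_k` on the integer translates of any interval of length `δ`. By
duality, the `(C_q)` property gives `W = O(δ^(1/q))`, whereas finite moments of order `2/q'` would
give `Ω = o(δ^(1/q'))`. At `q = ∞` the latter is only `Ω = O(δ)`, but there `W = o(1)` by the
absolute continuity of the integral.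

For (b), let `f̂ = d^α`, where `d` is the distance to the boundary of `(0, 1)` and `f̂ = 0` outside.
Then `V(f)` consists of band-limited functions and is invariant under all translations. On the
dyadic piece `d ≈ 2^(-i)` the quotient `Ĥ / f̂` has Fourier coefficients whose `ℓ^q`-norm is
`O(2^(-i (1/2 - 1/q - α)) ‖H‖)`, so the `(C_q)` property holds for `0 ≤ α < 1/2 - 1/q`. The moments
of `f` of order `t < 2α + 1` are finite, and `2α + 1` can be made as close to `2 - 2/q = 2/q'` as
desired. The moments of order `t < 1` are covered by `α = 0`, which also works for `q = 2`.
-/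

open Real Filter Topology FourierTransform ComplexConjugate

/-! ### The character `t ↦ exp (2πit)` -/

lemma fourierChar_intCast (n : ℤ) : (𝐞 (n : ℝ) : ℂ) = 1 := by
  rw [Real.fourierChar_apply, Complex.exp_eq_one_iff]
  exact ⟨n, by push_cast; ring⟩

lemma fourierChar_add (s t : ℝ) : (𝐞 (s + t) : ℂ) = 𝐞 s * 𝐞 t := by
  rw [AddChar.map_add_eq_mul, Circle.coe_mul]

lemma fourierChar_natCast_mul (n : ℕ) (t : ℝ) : (𝐞 (n * t) : ℂ) = (𝐞 t : ℂ) ^ n := by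
  rw [← nsmul_eq_mul, AddChar.map_nsmul_eq_pow, Circle.coe_pow]

lemma norm_fourierChar_sub_one (t : ℝ) : ‖(𝐞 t : ℂ) - 1‖ = 2 * |sin (π * t)| := by
  rw [Real.fourierChar_apply, mul_comm, Complex.norm_exp_I_mul_ofReal_sub_one, norm_mul,
    Real.norm_ofNat, Real.norm_eq_abs]
  ring_nf

lemma norm_fourierChar_sub_one_le (t : ℝ) : ‖(𝐞 t : ℂ) - 1‖ ≤ 2 * π * |t| := by
  have h : |sin (π * t)| ≤ π * |t| := by
    simpa only [abs_mul, abs_of_pos pi_pos] using abs_sin_le_abs (x := π * t)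
  rw [norm_fourierChar_sub_one]
  linarith

lemma norm_fourierChar_sub_one_le_two (t : ℝ) : ‖(𝐞 t : ℂ) - 1‖ ≤ 2 := by
  rw [norm_fourierChar_sub_one]
  linarith [abs_sin_le_one (π * t)]

/-! ### Translations of `L²(ℝ)` -/

/-- Translation by `a` as a linear isometry of `L²(ℝ)`. -/
noncomputable def l2TranslateIso (a : ℝ) : L2R →ₗᵢ[ℂ] L2R :=
  Lp.compMeasurePreservingₗᵢ ℂ (fun x : ℝ => x - a) (measurePreserving_sub_right volume a)

lemma l2TranslateIso_apply (a : ℝ) (f : L2R) : l2TranslateIso a f = l2Translate a f := rfl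

lemma coeFn_l2Translate (a : ℝ) (f : L2R) : l2Translate a f =ᵐ[volume] fun x => f (x - a) :=
  Lp.coeFn_compMeasurePreserving f (measurePreserving_sub_right volume a)

lemma ae_comp_add {p : ℝ → Prop} (h : ∀ᵐ x, p x) (a : ℝ) : ∀ᵐ x, p (x + a) :=
  (measurePreserving_add_right volume a).quasiMeasurePreserving.ae h

lemma ae_comp_sub {p : ℝ → Prop} (h : ∀ᵐ x, p x) (a : ℝ) : ∀ᵐ x, p (x - a) :=
  (measurePreserving_sub_right volume a).quasiMeasurePreserving.ae h

lemma ae_forall_comp_add_int {p : ℝ → Prop} (h : ∀ᵐ x, p x) : ∀ᵐ x : ℝ, ∀ n : ℤ, p (x + n) :=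
  ae_all_iff.2 fun n => ae_comp_add h n

lemma l2Translate_l2Translate (a b : ℝ) (f : L2R) :
    l2Translate a (l2Translate b f) = l2Translate (a + b) f := by
  ext1
  filter_upwards [coeFn_l2Translate a (l2Translate b f), coeFn_l2Translate (a + b) f,
    ae_comp_sub (coeFn_l2Translate b f) a] with x h1 h2 h3
  rw [h1, h2, h3, sub_sub]

lemma l2Translate_comm (a b : ℝ) (f : L2R) :
    l2Translate a (l2Translate b f) = l2Translate b (l2Translate a f) := by
  rw [l2Translate_l2Translate, l2Translate_l2Translate, add_comm]

lemma l2Translate_zero (f : L2R) : l2Translate 0 f = f := by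
  ext1
  filter_upwards [coeFn_l2Translate 0 f] with x h
  rw [h, sub_zero]

lemma continuous_l2Translate_left (f : L2R) : Continuous fun a => l2Translate a f := by
  have hg : Continuous fun a : ℝ => (⟨fun x : ℝ => x - a, by fun_prop⟩ : C(ℝ, ℝ)) := by
    refine ContinuousMap.continuous_of_continuous_uncurry _ ?_
    simp only [Function.uncurry_def, ContinuousMap.coe_mk]
    fun_prop
  refine continuous_iff_continuousAt.2 fun a => ?_
  exact (tendsto_const_nhds (x := f)).compMeasurePreservingLp (hg.tendsto a)
    (fun a => measurePreserving_sub_right volume a) (measurePreserving_sub_right volume a) (by simp)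

/-! ### The Fourier transform on `L²(ℝ)` -/

/-- The Fourier transform `f ↦ ∫ f(x) e^{-2πixξ} dx` on `L²(ℝ)`. -/
noncomputable def fourierL2 : L2R ≃ₗᵢ[ℂ] L2R := Lp.fourierTransformₗᵢ ℝ ℂ

lemma fourierL2_toLp (f : SchwartzMap ℝ ℂ) : fourierL2 (f.toLp 2) = (𝓕 f).toLp 2 :=
  SchwartzMap.toLp_fourier_eq f

lemma fourierL2_symm_toLp (f : SchwartzMap ℝ ℂ) : fourierL2.symm (f.toLp 2) = (𝓕⁻ f).toLp 2 :=
  SchwartzMap.toLp_fourierInv_eq f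

lemma exists_seq_schwartz_tendsto (f : L2R) :
    ∃ u : ℕ → SchwartzMap ℝ ℂ,
      Tendsto (fun n => (u n).toLp 2 (volume : Measure ℝ)) atTop (𝓝 f) := by
  have h : DenseRange fun u : SchwartzMap ℝ ℂ => u.toLp 2 (volume : Measure ℝ) :=
    SchwartzMap.denseRange_toLpCLM (by simp)
  obtain ⟨x, hx, hxt⟩ := mem_closure_iff_seq_limit.1 (h f)
  choose u hu using hx
  exact ⟨u, by simpa only [hu] using hxt⟩

/-- Translation by `a` on Schwartz functions. -/
noncomputable def schwartzTranslate (a : ℝ) : SchwartzMap ℝ ℂ →L[ℂ] SchwartzMap ℝ ℂ :=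
  SchwartzMap.compCLMOfAntilipschitz (K := 1) ℂ (g := fun x : ℝ => x - a)
    (Function.HasTemperateGrowth.id'.sub (.const a))
    (AntilipschitzWith.of_le_mul_dist fun x y => by simp)

lemma schwartzTranslate_apply (a : ℝ) (f : SchwartzMap ℝ ℂ) (x : ℝ) :
    schwartzTranslate a f x = f (x - a) := rfl

lemma l2Translate_toLp (a : ℝ) (f : SchwartzMap ℝ ℂ) :
    l2Translate a (f.toLp 2) = (schwartzTranslate a f).toLp 2 := by
  ext1
  filter_upwards [coeFn_l2Translate a (f.toLp 2), ae_comp_sub (f.coeFn_toLp 2 volume) a,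
    (schwartzTranslate a f).coeFn_toLp 2 volume] with x h1 h2 h3
  rw [h1, h2, h3, schwartzTranslate_apply]

lemma exists_subseq_ae_tendsto {u : ℕ → L2R} {v : L2R} (h : Tendsto u atTop (𝓝 v)) :
    ∃ φ : ℕ → ℕ, StrictMono φ ∧
      ∀ᵐ x, Tendsto (fun i => (u (φ i) : ℝ → ℂ) x) atTop (𝓝 ((v : ℝ → ℂ) x)) :=
  (tendstoInMeasure_of_tendsto_Lp h).exists_seq_tendsto_ae

lemma ae_eq_mul_of_tendsto {u w : ℕ → L2R} {v z : L2R} (hu : Tendsto u atTop (𝓝 v))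
    (hw : Tendsto w atTop (𝓝 z)) (e : ℝ → ℂ) (h : ∀ n, w n =ᵐ[volume] fun x => e x * u n x) :
    z =ᵐ[volume] fun x => e x * v x := by
  obtain ⟨φ, hφ, h1⟩ := exists_subseq_ae_tendsto hu
  obtain ⟨ψ, hψ, h2⟩ := exists_subseq_ae_tendsto (hw.comp hφ.tendsto_atTop)
  filter_upwards [h1, h2, ae_all_iff.2 h] with x h1 h2 h3
  refine tendsto_nhds_unique h2 ?_
  simp only [Function.comp_apply, h3]
  exact (h1.comp hψ.tendsto_atTop).const_mul _

lemma map_l2Translate_of_schwartz (T : L2R ≃ₗᵢ[ℂ] L2R) (a : ℝ) (e : ℝ → ℂ)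
    (h : ∀ u : SchwartzMap ℝ ℂ,
      T ((schwartzTranslate a u).toLp 2) =ᵐ[volume] fun ξ => e ξ * T (u.toLp 2) ξ) (f : L2R) :
    T (l2Translate a f) =ᵐ[volume] fun ξ => e ξ * T f ξ := by
  obtain ⟨u, hu⟩ := exists_seq_schwartz_tendsto f
  refine ae_eq_mul_of_tendsto ((T.continuous.tendsto _).comp hu)
    ((T.continuous.tendsto _).comp (((l2TranslateIso a).continuous.tendsto _).comp hu)) e
    fun n => ?_
  simpa only [Function.comp_apply, l2TranslateIso_apply, l2Translate_toLp] using h (u n)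

lemma fourier_comp_sub (a : ℝ) (f : ℝ → ℂ) (ξ : ℝ) :
    𝓕 (fun x => f (x - a)) ξ = 𝐞 (-(a * ξ)) * 𝓕 f ξ := by
  have h := congrFun (VectorFourier.fourierIntegral_comp_add_right 𝐞 volume (innerₗ ℝ) f (-a)) ξ
  simp only [Function.comp_def, ← sub_eq_add_neg, innerₗ_apply_apply, RCLike.inner_apply,
    conj_trivial, mul_comm ξ, neg_mul, Circle.smul_def, smul_eq_mul] at h
  exact h

lemma fourierInv_comp_sub (a : ℝ) (f : ℝ → ℂ) (ξ : ℝ) :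
    𝓕⁻ (fun x => f (x - a)) ξ = 𝐞 (a * ξ) * 𝓕⁻ f ξ := by
  rw [Real.fourierInv_eq_fourier_neg, fourier_comp_sub, Real.fourierInv_eq_fourier_neg, mul_neg,
    neg_neg]

lemma fourierL2_l2Translate (a : ℝ) (f : L2R) :
    fourierL2 (l2Translate a f) =ᵐ[volume] fun ξ => 𝐞 (-(a * ξ)) * fourierL2 f ξ := by
  refine map_l2Translate_of_schwartz fourierL2 a _ (fun u => ?_) f
  rw [fourierL2_toLp, fourierL2_toLp]
  filter_upwards [(𝓕 u).coeFn_toLp 2 volume,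
    (𝓕 (schwartzTranslate a u)).coeFn_toLp 2 volume] with ξ h1 h2
  rw [h1, h2, SchwartzMap.fourier_coe, SchwartzMap.fourier_coe]
  exact fourier_comp_sub a u ξ

lemma fourierL2_symm_l2Translate (a : ℝ) (f : L2R) :
    fourierL2.symm (l2Translate a f) =ᵐ[volume] fun ξ => 𝐞 (a * ξ) * fourierL2.symm f ξ := by
  refine map_l2Translate_of_schwartz fourierL2.symm a _ (fun u => ?_) f
  rw [fourierL2_symm_toLp, fourierL2_symm_toLp]
  filter_upwards [(𝓕⁻ u).coeFn_toLp 2 volume,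
    (𝓕⁻ (schwartzTranslate a u)).coeFn_toLp 2 volume] with ξ h1 h2
  rw [h1, h2, SchwartzMap.fourierInv_coe, SchwartzMap.fourierInv_coe]
  exact fourierInv_comp_sub a u ξ

lemma enorm_sq_eq_lintegral {X : Type*} [MeasurableSpace X] {μ : Measure X} (f : Lp ℂ 2 μ) :
    ‖f‖ₑ ^ 2 = ∫⁻ x, ‖f x‖ₑ ^ 2 ∂μ := by
  rw [Lp.enorm_def, eLpNorm_eq_lintegral_rpow_enorm_toReal (by simp) (by simp),
    ← ENNReal.rpow_natCast, ← ENNReal.rpow_mul]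
  simp

lemma enorm_sq_l2Translate_fourierL2_sub (h : ℝ) (f : L2R) :
    ‖l2Translate h (fourierL2 f) - fourierL2 f‖ₑ ^ 2
      = ∫⁻ x, ‖(𝐞 (h * x) : ℂ) - 1‖ₑ ^ 2 * ‖f x‖ₑ ^ 2 := by
  have e : ‖l2Translate h (fourierL2 f) - fourierL2 f‖ₑ
      = ‖fourierL2.symm (l2Translate h (fourierL2 f)) - f‖ₑ := by
    rw [← fourierL2.symm.enorm_map, map_sub, LinearIsometryEquiv.symm_apply_apply]
  rw [e, enorm_sq_eq_lintegral]
  refine lintegral_congr_ae ?_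
  filter_upwards [fourierL2_symm_l2Translate h (fourierL2 f),
    Lp.coeFn_sub (fourierL2.symm (l2Translate h (fourierL2 f))) f] with x h1 h2
  rw [h2, Pi.sub_apply, h1, LinearIsometryEquiv.symm_apply_apply, ← sub_one_mul, enorm_mul, mul_pow]

/-! ### Duality for `(C_q)`-systems -/

lemma one_div_toReal_of_holderConjugate {q q' : ℝ≥0∞} (h : ENNReal.HolderConjugate q q') :
    1 / q'.toReal = 1 - 1 / q.toReal := by
  have hsum := congrArg ENNReal.toReal (ENNReal.HolderConjugate.inv_add_inv_eq_one q q')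
  rw [ENNReal.toReal_add (ENNReal.inv_ne_top.2 (ENNReal.HolderConjugate.ne_zero q q'))
    (ENNReal.inv_ne_top.2 (ENNReal.HolderConjugate.ne_zero q' q)), ENNReal.toReal_inv,
    ENNReal.toReal_inv, ENNReal.toReal_one] at hsum
  rw [one_div, one_div]
  linarith

section Systems

variable {ι H : Type*}

lemma lqNorm_nonneg (q : ℝ≥0∞) (a : ι →₀ ℂ) : 0 ≤ lqNorm q a :=
  lp.norm_nonneg' _

lemma norm_le_lqNorm {q : ℝ≥0∞} (hq : q ≠ 0) (a : ι →₀ ℂ) (i : ι) : ‖a i‖ ≤ lqNorm q a :=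
  lp.norm_apply_le_norm hq
    (⟨fun i => a i, (memℓp_zero a.hasFiniteSupport).of_exponent_ge zero_le⟩ :
      lp (fun _ : ι => ℂ) q) i

lemma sum_rpow_le_lqNorm {q : ℝ≥0∞} (hq : 0 < q.toReal) (a : ι →₀ ℂ) (s : Finset ι) :
    ∑ i ∈ s, ‖a i‖ ^ q.toReal ≤ lqNorm q a ^ q.toReal :=
  lp.sum_rpow_le_norm_rpow hq
    (⟨fun i => a i, (memℓp_zero a.hasFiniteSupport).of_exponent_ge zero_le⟩ :
      lp (fun _ : ι => ℂ) q) s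

lemma sum_norm_le_card_rpow_mul_lqNorm {q q' : ℝ≥0∞} (h : ENNReal.HolderConjugate q q')
    (a : ι →₀ ℂ) (s : Finset ι) :
    ∑ i ∈ s, ‖a i‖ ≤ (s.card : ℝ) ^ (1 / q'.toReal) * lqNorm q a := by
  have h1q : 1 ≤ q := ENNReal.HolderConjugate.one_le q q'
  rcases eq_or_ne q ∞ with rfl | hqt
  · obtain rfl : q' = 1 := by simpa using ENNReal.HolderConjugate.inv_add_inv_eq_one ∞ q'
    simpa using Finset.sum_le_card_nsmul s _ _ fun i _ => norm_le_lqNorm ENNReal.top_ne_zero a i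
  have h1 : 1 ≤ q.toReal := by simpa using ENNReal.toReal_mono hqt h1q
  have h0 : 0 < q.toReal := one_pos.trans_le h1
  have hpow : (∑ i ∈ s, ‖a i‖) ^ q.toReal
      ≤ ((s.card : ℝ) ^ (1 / q'.toReal) * lqNorm q a) ^ q.toReal := calc
    _ ≤ (s.card : ℝ) ^ (q.toReal - 1) * ∑ i ∈ s, ‖a i‖ ^ q.toReal := by
      simpa using Real.rpow_sum_le_const_mul_sum_rpow s (fun i => ‖a i‖) h1
    _ ≤ (s.card : ℝ) ^ (q.toReal - 1) * lqNorm q a ^ q.toReal := by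
      gcongr
      exact sum_rpow_le_lqNorm h0 a s
    _ = _ := by
      rw [Real.mul_rpow (by positivity) (lqNorm_nonneg q a), ← Real.rpow_mul (by positivity),
        one_div_toReal_of_holderConjugate h, sub_mul, one_mul, one_div_mul_cancel h0.ne']
  exact (Real.rpow_le_rpow_iff (by positivity)
    (mul_nonneg (by positivity) (lqNorm_nonneg q a)) h0).1 hpow

variable [NormedAddCommGroup H] [InnerProductSpace ℂ H]

/-- The `(C_q)` property with a prescribed constant `C`. -/
def IsCqSystemWith (q : ℝ≥0∞) (C : ℝ) (g : ι → H) : Prop :=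
  ∀ f : H, ∀ ε : ℝ, 0 < ε → ∃ a : ι →₀ ℂ,
    lqNorm q a ≤ C * ‖f‖ ∧ ‖f - Finsupp.linearCombination ℂ g a‖ < ε

lemma norm_inner_linearCombination_le {q q' : ℝ≥0∞} (hqq' : ENNReal.HolderConjugate q q')
    {g : ι → H} {h : H} {s : Finset ι} {b : ℝ} (hb : 0 ≤ b)
    (hs : ∀ i ∉ s, inner ℂ (g i) h = 0) (hsb : ∀ i ∈ s, ‖inner ℂ (g i) h‖ ≤ b) (a : ι →₀ ℂ) :
    ‖inner ℂ (Finsupp.linearCombination ℂ g a) h‖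
      ≤ (s.card : ℝ) ^ (1 / q'.toReal) * lqNorm q a * b := by
  classical
  have e : inner ℂ (Finsupp.linearCombination ℂ g a) h = ∑ i ∈ s, conj (a i) * inner ℂ (g i) h := by
    rw [Finsupp.linearCombination_apply, Finsupp.sum, sum_inner]
    simp only [inner_smul_left]
    refine (Finset.sum_subset (Finset.subset_union_left (s₂ := s)) fun i _ hi => ?_).trans
      (Finset.sum_subset (Finset.subset_union_right (s₁ := a.support)) fun i _ hi => ?_).symm
    · rw [Finsupp.notMem_support_iff.1 hi, map_zero, zero_mul]
    · rw [hs i hi, mul_zero]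
  calc ‖inner ℂ (Finsupp.linearCombination ℂ g a) h‖
      ≤ ∑ i ∈ s, ‖a i‖ * b := by
        rw [e]
        refine (norm_sum_le _ _).trans (Finset.sum_le_sum fun i hi => ?_)
        rw [norm_mul, RCLike.norm_conj]
        gcongr
        exact hsb i hi
    _ = (∑ i ∈ s, ‖a i‖) * b := (Finset.sum_mul _ _ _).symm
    _ ≤ _ := by
        gcongr
        exact sum_norm_le_card_rpow_mul_lqNorm hqq' a s

/-- Testing the approximations of `h` against `h` itself. -/
lemma IsCqSystemWith.norm_le {q q' : ℝ≥0∞} (hqq' : ENNReal.HolderConjugate q q') {g : ι → H}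
    {C : ℝ} (hC : 0 ≤ C) (hg : IsCqSystemWith q C g) {h : H} {s : Finset ι} {b : ℝ} (hb : 0 ≤ b)
    (hs : ∀ i ∉ s, inner ℂ (g i) h = 0) (hsb : ∀ i ∈ s, ‖inner ℂ (g i) h‖ ≤ b) :
    ‖h‖ ≤ C * (s.card : ℝ) ^ (1 / q'.toReal) * b := by
  rcases eq_or_ne h 0 with rfl | h0
  · rw [norm_zero]
    positivity
  refine le_of_forall_pos_le_add fun ε hε => le_of_mul_le_mul_right ?_ (norm_pos_iff.2 h0)
  obtain ⟨a, ha, hae⟩ := hg h ε hε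
  calc ‖h‖ * ‖h‖ = ‖inner ℂ h h‖ := by rw [inner_self_eq_norm_sq_to_K, ← sq]; simp
    _ = ‖inner ℂ (Finsupp.linearCombination ℂ g a) h
          + inner ℂ (h - Finsupp.linearCombination ℂ g a) h‖ := by
        rw [← inner_add_left, add_sub_cancel]
    _ ≤ (s.card : ℝ) ^ (1 / q'.toReal) * (C * ‖h‖) * b + ε * ‖h‖ := by
        refine (norm_add_le _ _).trans (add_le_add ?_ ((norm_inner_le_norm _ _).trans (by gcongr)))
        exact (norm_inner_linearCombination_le hqq' hb hs hsb a).trans (by gcongr)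
    _ = (C * (s.card : ℝ) ^ (1 / q'.toReal) * b + ε) * ‖h‖ := by ring

lemma IsMinimalSystem.exists_dual [CompleteSpace H] [DecidableEq ι] {g : ι → H}
    (hg : IsMinimalSystem g) (i : ι) : ∃ h : H, ∀ j, inner ℂ (g j) h = if j = i then 1 else 0 := by
  set W := (Submodule.span ℂ (g '' {i}ᶜ)).topologicalClosure
  have : CompleteSpace W := (Submodule.isClosed_topologicalClosure _).completeSpace_coe
  set u := g i - W.starProjection (g i)
  have hu0 : u ≠ 0 := fun h0 => hg i <| by
    rw [sub_eq_zero.1 h0]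
    exact Submodule.starProjection_apply_mem _ _
  have huW : ∀ w ∈ W, inner ℂ w u = 0 := fun w hw =>
    (W.mem_orthogonal u).1 (Submodule.sub_starProjection_mem_orthogonal (K := W) (g i)) w hw
  have hgu : inner ℂ (g i) u = inner ℂ u u := by
    conv_lhs => rw [← sub_add_cancel (g i) (W.starProjection (g i)), inner_add_left,
      huW _ (Submodule.starProjection_apply_mem _ _), add_zero]
  refine ⟨(inner ℂ u u)⁻¹ • u, fun j => ?_⟩
  rw [inner_smul_right]
  split_ifs with hj
  · rw [hj, hgu, inv_mul_cancel₀ (inner_self_ne_zero.2 hu0)]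
  · rw [huW _ (Submodule.le_topologicalClosure _ (Submodule.subset_span ⟨j, hj, rfl⟩)), mul_zero]

end Systems

/-! ### Fourier coefficients determine an integrable function -/

lemma tendsto_thickenedIndicator_smul {X E : Type*} [PseudoEMetricSpace X] [NormedAddCommGroup E]
    [NormedSpace ℝ E] {K : Set X} (hK : IsClosed K) (p : X → E) (x : X) {δ : ℕ → ℝ}
    (hδ : ∀ n, 0 < δ n) (hlim : Tendsto δ atTop (𝓝 0)) :
    Tendsto (fun n => thickenedIndicator (hδ n) K x • p x) atTop (𝓝 (K.indicator p x)) := by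
  have h := tendsto_pi_nhds.1 (thickenedIndicator_tendsto_indicator_closure hδ hlim K) x
  rw [hK.closure_eq] at h
  convert h.smul_const (p x) using 2
  by_cases hx : x ∈ K <;> simp [hx]

lemma ae_eq_zero_of_forall_integral_boundedContinuous_smul_eq_zero {X E : Type*}
    [PseudoEMetricSpace X] [MeasurableSpace X] [BorelSpace X] [NormedAddCommGroup E]
    [NormedSpace ℝ E] [CompleteSpace E] {μ : Measure X} {p : X → E} (hp : Integrable p μ)
    (h : ∀ g : BoundedContinuousFunction X NNReal, ∫ x, g x • p x ∂μ = 0) : p =ᵐ[μ] 0 := by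
  refine ae_eq_zero_of_forall_setIntegral_isClosed_eq_zero hp fun K hK => ?_
  rw [← integral_indicator hK.measurableSet]
  have hδ : ∀ n : ℕ, (0 : ℝ) < 1 / (n + 1) := fun n => by positivity
  refine tendsto_nhds_unique (l := atTop)
    (f := fun n => ∫ x, thickenedIndicator (hδ n) K x • p x ∂μ) ?_
    (by simpa only [h] using tendsto_const_nhds)
  refine tendsto_integral_of_dominated_convergence (fun x => ‖p x‖) (fun n => ?_) hp.norm
    (fun n => Eventually.of_forall fun x => ?_) (Eventually.of_forall fun x =>
      tendsto_thickenedIndicator_smul hK p x hδ tendsto_one_div_add_atTop_nhds_zero_nat)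
  · exact (thickenedIndicator (hδ n) K).continuous.aestronglyMeasurable.smul hp.1
  · rw [NNReal.smul_def, norm_smul, NNReal.norm_eq]
    exact mul_le_of_le_one_left (norm_nonneg _)
      (by simpa using thickenedIndicator_le_one (hδ n) K x)

lemma integrable_continuousMap_mul {X : Type*} [TopologicalSpace X] [CompactSpace X]
    [MeasurableSpace X] [OpensMeasurableSpace X] {μ : Measure X} {p : X → ℂ} (hp : Integrable p μ)
    (g : C(X, ℂ)) : Integrable (fun x => g x * p x) μ :=
  hp.bdd_mul (c := ‖g‖) g.continuous.aestronglyMeasurable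
    (Eventually.of_forall fun x => g.norm_coe_le_norm x)

lemma continuous_integral_continuousMap_mul {X : Type*} [TopologicalSpace X] [CompactSpace X]
    [MeasurableSpace X] [OpensMeasurableSpace X] {μ : Measure X} {p : X → ℂ}
    (hp : Integrable p μ) : Continuous fun g : C(X, ℂ) => ∫ x, g x * p x ∂μ := by
  refine (LipschitzWith.of_dist_le_mul (K := (∫ x, ‖p x‖ ∂μ).toNNReal)
    fun g k => ?_).continuous
  rw [dist_eq_norm, dist_eq_norm, ← integral_sub (integrable_continuousMap_mul hp g)
    (integrable_continuousMap_mul hp k), Real.coe_toNNReal _ (by positivity),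
    ← integral_mul_const]
  refine norm_integral_le_of_norm_le (hp.norm.mul_const _) (Eventually.of_forall fun x => ?_)
  rw [← sub_mul, norm_mul, mul_comm]
  gcongr
  exact (g - k).norm_coe_le_norm x

lemma integral_continuousMap_mul_eq_zero {T : ℝ} [Fact (0 < T)] {p : AddCircle T → ℂ}
    (hp : Integrable p) (h : ∀ n : ℤ, ∫ x, fourier n x * p x = 0) (g : C(AddCircle T, ℂ)) :
    ∫ x, g x * p x = 0 := by
  have hspan : ∀ k ∈ Submodule.span ℂ (Set.range (@fourier T)), ∫ x, k x * p x = 0 := by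
    refine fun k hk => Submodule.span_induction ?_ ?_ ?_ ?_ hk
    · rintro _ ⟨n, rfl⟩
      exact h n
    · simp
    · intro k l _ _ hk hl
      simp only [ContinuousMap.add_apply, add_mul]
      rw [integral_add (integrable_continuousMap_mul hp k) (integrable_continuousMap_mul hp l),
        hk, hl, add_zero]
    · intro c k _ hk
      simp only [ContinuousMap.smul_apply, smul_eq_mul, mul_assoc]
      rw [integral_const_mul, hk, mul_zero]
  have hclosed : IsClosed {k : C(AddCircle T, ℂ) | ∫ x, k x * p x = 0} :=
    isClosed_eq (continuous_integral_continuousMap_mul hp) continuous_const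
  have hg : g ∈ (Submodule.span ℂ (Set.range (@fourier T))).topologicalClosure :=
    (span_fourier_closure_eq_top (T := T)).symm ▸ Submodule.mem_top
  exact closure_minimal hspan hclosed hg

lemma ae_eq_zero_of_integral_fourier_mul_eq_zero {T : ℝ} [Fact (0 < T)] {p : AddCircle T → ℂ}
    (hp : Integrable p) (h : ∀ n : ℤ, ∫ x, fourier n x * p x = 0) : p =ᵐ[volume] 0 :=
  ae_eq_zero_of_forall_integral_boundedContinuous_smul_eq_zero hp fun g =>
    integral_continuousMap_mul_eq_zero hp h
      ⟨fun x => (g x : ℂ), Complex.continuous_ofReal.comp (NNReal.continuous_coe.comp g.continuous)⟩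

lemma fourier_coe_eq_fourierChar (n : ℤ) (x : ℝ) :
    fourier n (x : AddCircle (1 : ℝ)) = 𝐞 (n * x) := by
  rw [fourier_coe_apply, Real.fourierChar_apply]
  congr 1
  push_cast
  ring

lemma ae_eq_zero_of_setIntegral_fourierChar_mul_eq_zero {p : ℝ → ℂ}
    (hp : IntegrableOn p (Set.Ioc 0 1))
    (h : ∀ n : ℤ, ∫ x in Set.Ioc (0 : ℝ) 1, 𝐞 (n * x) * p x = 0) :
    ∀ᵐ x ∂volume.restrict (Set.Ioc (0 : ℝ) 1), p x = 0 := by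
  have hL : MemLp (AddCircle.liftIoc 1 0 p) 1 :=
    MemLp.memLp_liftIoc (by rwa [zero_add, memLp_one_iff_integrable])
  have h0 := ae_eq_zero_of_integral_fourier_mul_eq_zero (memLp_one_iff_integrable.1 hL) fun n => by
    rw [← AddCircle.integral_preimage 1 0, zero_add, ← h n]
    refine setIntegral_congr_fun measurableSet_Ioc fun x hx => ?_
    simp only [fourier_coe_eq_fourierChar]
    rw [AddCircle.liftIoc_coe_apply (by simpa using hx)]
  have h1 := (AddCircle.measurePreserving_mk 1 0).quasiMeasurePreserving.ae h0
  rw [zero_add] at h1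
  filter_upwards [h1, ae_restrict_mem measurableSet_Ioc] with x hx hx2
  rwa [AddCircle.liftIoc_coe_apply (by simpa using hx2)] at hx

/-! ### Periodization -/

lemma ae_of_ae_restrict_Ioc {p : ℝ → Prop} (hp : ∀ x, ∀ n : ℤ, p (x - n) → p x)
    (h : ∀ᵐ x ∂volume.restrict (Set.Ioc (0 : ℝ) 1), p x) : ∀ᵐ x, p x := by
  rw [ae_restrict_iff' measurableSet_Ioc] at h
  filter_upwards [ae_all_iff.2 fun n : ℤ => ae_comp_sub h n] with x hx
  refine hp x (⌈x⌉ - 1) (hx _ ⟨?_, ?_⟩)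
  · push_cast; linarith [Int.ceil_lt_add_one x]
  · push_cast; linarith [Int.le_ceil x]

lemma lintegral_eq_tsum_int (f : ℝ → ℝ≥0∞) :
    ∫⁻ x, f x = ∑' n : ℤ, ∫⁻ x in Set.Ioc (0 : ℝ) 1, f (x + n) := by
  rw [← setLIntegral_univ, ← iUnion_Ioc_intCast ℝ,
    lintegral_iUnion (fun _ => measurableSet_Ioc) (Set.pairwise_disjoint_Ioc_intCast ℝ)]
  refine tsum_congr fun n => ?_
  rw [← (measurePreserving_add_right volume (n : ℝ)).setLIntegral_comp_preimage_emb
    (measurableEmbedding_addRight _)]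
  congr 2
  simp

lemma integral_eq_tsum_int {E : Type*} [NormedAddCommGroup E] [NormedSpace ℝ E] {f : ℝ → E}
    (hf : Integrable f) : ∫ x, f x = ∑' n : ℤ, ∫ x in Set.Ioc (0 : ℝ) 1, f (x + n) := by
  rw [← setIntegral_univ, ← iUnion_Ioc_intCast ℝ, integral_iUnion (fun _ => measurableSet_Ioc)
    (Set.pairwise_disjoint_Ioc_intCast ℝ) hf.integrableOn]
  refine tsum_congr fun n => ?_
  rw [← (measurePreserving_add_right volume (n : ℝ)).setIntegral_preimage_emb
    (measurableEmbedding_addRight _)]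
  congr 2
  simp

lemma lintegral_tsum_enorm_comp_add_int_ne_top {E : Type*} [NormedAddCommGroup E] {f : ℝ → E}
    (hf : Integrable f) : ∫⁻ x in Set.Ioc (0 : ℝ) 1, ∑' n : ℤ, ‖f (x + n)‖ₑ ≠ ∞ := by
  rw [lintegral_tsum fun n : ℤ => ((hf.comp_add_right (n : ℝ)).1.enorm).restrict,
    ← lintegral_eq_tsum_int fun x => ‖f x‖ₑ]
  exact hf.2.ne

lemma summable_comp_add_int_of_sub {f : ℝ → ℝ} {x : ℝ} {m : ℤ}
    (h : Summable fun n : ℤ => f (x - m + n)) : Summable fun n : ℤ => f (x + n) := by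
  rw [← (Equiv.subRight m).summable_iff]
  refine h.congr fun n => ?_
  rw [Function.comp_apply, Equiv.subRight_apply, Int.cast_sub]
  ring_nf

lemma tsum_comp_sub_add_int (f : ℝ → ℂ) (x : ℝ) (m : ℤ) :
    ∑' n : ℤ, f (x - m + n) = ∑' n : ℤ, f (x + n) := by
  rw [← (Equiv.subRight m).tsum_eq fun n : ℤ => f (x + n)]
  refine tsum_congr fun n => ?_
  rw [Equiv.subRight_apply, Int.cast_sub]
  ring_nf

lemma ae_summable_norm_comp_add_int {E : Type*} [NormedAddCommGroup E] {f : ℝ → E}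
    (hf : Integrable f) : ∀ᵐ x : ℝ, Summable fun n : ℤ => ‖f (x + n)‖ := by
  refine ae_of_ae_restrict_Ioc
    (fun x m h => summable_comp_add_int_of_sub (f := fun y => ‖f y‖) h) ?_
  have hm : ∀ n : ℤ, AEMeasurable (fun x => ‖f (x + n)‖ₑ) (volume.restrict (Set.Ioc (0 : ℝ) 1)) :=
    fun n => ((hf.comp_add_right (n : ℝ)).1.enorm).restrict
  filter_upwards [ae_lt_top' (AEMeasurable.tsum hm)
    (lintegral_tsum_enorm_comp_add_int_ne_top hf)] with x hx
  exact tsum_enorm_ne_top_iff_summable_norm.1 hx.ne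

lemma aemeasurable_tsum_of_summable {X ι : Type*} [Countable ι] [MeasurableSpace X] {μ : Measure X}
    {F : ι → X → ℂ} (hF : ∀ n, AEMeasurable (F n) μ) (h : ∀ᵐ x ∂μ, Summable fun n => F n x) :
    AEMeasurable (fun x => ∑' n, F n x) μ := by
  refine aemeasurable_of_tendsto_metrizable_ae atTop
    (f := fun (s : Finset ι) x => ∑ n ∈ s, F n x)
    (fun s => Finset.aemeasurable_fun_sum _ fun n _ => hF n) ?_
  filter_upwards [h] with x hx using hx.hasSum

lemma integrableOn_tsum_comp_add_int {f : ℝ → ℂ} (hf : Integrable f) :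
    IntegrableOn (fun x => ∑' n : ℤ, f (x + n)) (Set.Ioc 0 1) := by
  have hm : AEMeasurable fun x => ∑' n : ℤ, f (x + n) :=
    aemeasurable_tsum_of_summable (F := fun (n : ℤ) x => f (x + n))
      (fun n => (hf.comp_add_right (n : ℝ)).1.aemeasurable)
      ((ae_summable_norm_comp_add_int hf).mono fun x hx => hx.of_norm)
  exact ⟨hm.restrict.aestronglyMeasurable,
    lt_of_le_of_lt (lintegral_mono fun x => enorm_tsum_le_tsum_enorm)
      (lintegral_tsum_enorm_comp_add_int_ne_top hf).lt_top⟩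

lemma integrable_fourierChar_mul {μ : Measure ℝ} {f : ℝ → ℂ} (hf : Integrable f μ) (a : ℝ) :
    Integrable (fun x => 𝐞 (a * x) * f x) μ :=
  hf.bdd_mul (c := 1) (by fun_prop) (Eventually.of_forall fun x => (Circle.norm_coe _).le)

lemma fourierChar_int_mul_add_int (n m : ℤ) (x : ℝ) : (𝐞 (n * (x + m)) : ℂ) = 𝐞 (n * x) := by
  rw [mul_add, fourierChar_add, ← Int.cast_mul, fourierChar_intCast, mul_one]

lemma setIntegral_fourierChar_mul_tsum {f : ℝ → ℂ} (hf : Integrable f) (n : ℤ) :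
    ∫ x in Set.Ioc (0 : ℝ) 1, 𝐞 (n * x) * ∑' m : ℤ, f (x + m) = ∫ x, 𝐞 (n * x) * f x := by
  have hn := integrable_fourierChar_mul hf n
  have hm : ∀ m : ℤ, AEStronglyMeasurable (fun x => 𝐞 (n * (x + m)) * f (x + m))
      (volume.restrict (Set.Ioc (0 : ℝ) 1)) := fun m => (hn.comp_add_right (m : ℝ)).1.restrict
  have hfin := lintegral_tsum_enorm_comp_add_int_ne_top hn
  rw [lintegral_tsum fun m => (hm m).enorm] at hfin
  rw [integral_eq_tsum_int hn, ← integral_tsum hm hfin]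
  simp only [fourierChar_int_mul_add_int, tsum_mul_left]

lemma setIntegral_fourierChar_int_mul (n : ℤ) :
    ∫ x in Set.Ioc (0 : ℝ) 1, (𝐞 (n * x) : ℂ) = if n = 0 then 1 else 0 := by
  split_ifs with hn
  · simp [hn]
  have hexp : ∀ x : ℝ, (𝐞 (n * x) : ℂ) = Complex.exp ((2 * π * n * Complex.I) * x) := fun x => by
    rw [Real.fourierChar_apply]
    congr 1
    push_cast
    ring
  have hn' : (2 * π * n * Complex.I : ℂ) ≠ 0 := by simp [pi_ne_zero, hn]
  simp only [← intervalIntegral.integral_of_le zero_le_one, hexp, integral_exp_mul_complex hn']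
  rw [← hexp, ← hexp, mul_one, fourierChar_intCast]
  simp

/-- The integrals are the Fourier coefficients of the periodization of `f`. -/
lemma ae_tsum_eq_const_of_integral_fourierChar_mul {f : ℝ → ℂ} (hf : Integrable f) (c : ℂ)
    (h : ∀ n : ℤ, ∫ x, 𝐞 (n * x) * f x = if n = 0 then c else 0) :
    ∀ᵐ x : ℝ, ∑' n : ℤ, f (x + n) = c := by
  refine ae_of_ae_restrict_Ioc (fun x m h => (tsum_comp_sub_add_int f x m).symm.trans h) ?_
  have hpi := integrableOn_tsum_comp_add_int hf
  have hc : Integrable (fun _ => c) (volume.restrict (Set.Ioc (0 : ℝ) 1)) := integrable_const c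
  have h0 := ae_eq_zero_of_setIntegral_fourierChar_mul_eq_zero (hpi.sub hc) fun n => by
    simp only [Pi.sub_apply, mul_sub]
    rw [integral_sub (integrable_fourierChar_mul hpi n) (integrable_fourierChar_mul hc n),
      setIntegral_fourierChar_mul_tsum hf, h n, integral_mul_const,
      setIntegral_fourierChar_int_mul n]
    split_ifs <;> simp
  filter_upwards [h0] with x hx
  exact sub_eq_zero.1 hx

/-! ### Biorthogonal families of sequences -/

lemma trace_eq_rank_of_isIdempotentElem {κ R : Type*} [Fintype κ] [Field R]
    {M : Matrix κ κ R} (hM : IsIdempotentElem M) : M.trace = M.rank := by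
  classical
  have hid : IsIdempotentElem (Matrix.toLin' M) := hM.map Matrix.toLinAlgEquiv'
  rw [← Matrix.trace_toLin'_eq, (LinearMap.IsIdempotentElem.isProj_range _ hid).trace, Matrix.rank,
    Matrix.toLin'_apply']

lemma exists_mulVec_eq_self_of_rank_lt {κ R : Type*} [Fintype κ] [Field R]
    {M M' : Matrix κ κ R} (hM : IsIdempotentElem M) (hr : M'.rank < M.rank) :
    ∃ c, c ≠ 0 ∧ M.mulVec c = c ∧ M'.mulVec c = 0 := by
  by_contra! hcon
  have hdis : Disjoint (LinearMap.range M.mulVecLin) (LinearMap.ker M'.mulVecLin) := by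
    rw [Submodule.disjoint_def]
    rintro _ ⟨w, rfl⟩ hw
    by_contra h0
    exact hcon _ h0 (by rw [Matrix.mulVecLin_apply, Matrix.mulVec_mulVec, hM.eq]) hw
  have h1 := Submodule.finrank_add_finrank_le_of_disjoint hdis
  have h2 := LinearMap.finrank_range_add_finrank_ker M'.mulVecLin
  rw [Matrix.rank, Matrix.rank] at hr
  omega

section IsBiorthogonal

variable {κ ι : Type*} [DecidableEq κ]

/-- The families `u` and `v` of sequences are biorthogonal for the absolutely convergent pairing
`∑ₘ u(m) conj(v(m))`. -/
def IsBiorthogonal (u v : κ → ι → ℂ) : Prop :=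
  ∀ j k, (Summable fun m => ‖u j m * conj (v k m)‖) ∧
    ∑' m, u j m * conj (v k m) = if j = k then 1 else 0

/-- The matrix of the restriction of sequences to `A`, compressed to the span of `u` by means of
the dual family `v`. -/
noncomputable def compression (A : Set ι) (u v : κ → ι → ℂ) : Matrix κ κ ℂ :=
  Matrix.of fun k j => ∑' m, A.indicator (u j) m * conj (v k m)

variable [Fintype κ] {A : Set ι} {u v u' v' : κ → ι → ℂ}

lemma IsBiorthogonal.tsum_linearCombination (h : IsBiorthogonal u v) (c : κ → ℂ) (k : κ) :
    ∑' m, Fintype.linearCombination ℂ u c m * conj (v k m) = c k := by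
  simp only [Fintype.linearCombination_apply, Finset.sum_apply, Pi.smul_apply, smul_eq_mul,
    Finset.sum_mul, mul_assoc]
  rw [Summable.tsum_finsetSum fun j _ => ((h j k).1.of_norm).mul_left (c j)]
  simp only [tsum_mul_left, (h _ k).2, mul_ite, mul_one, mul_zero, Finset.sum_ite_eq',
    Finset.mem_univ, if_true]

lemma IsBiorthogonal.linearCombination_injective (h : IsBiorthogonal u v) :
    Function.Injective (Fintype.linearCombination ℂ u) := fun c d hcd => by
  ext k
  rw [← h.tsum_linearCombination c k, hcd, h.tsum_linearCombination d k]

lemma IsBiorthogonal.enorm_le_tsum (h : IsBiorthogonal u v) (c : κ → ℂ) (k : κ) :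
    ‖c k‖ₑ ≤ ∑' m, ‖Fintype.linearCombination ℂ u c m‖ₑ * ‖v k m‖ₑ := by
  rw [← h.tsum_linearCombination c k]
  refine enorm_tsum_le_tsum_enorm.trans_eq (tsum_congr fun m => ?_)
  rw [enorm_mul, RCLike.enorm_conj]

lemma IsBiorthogonal.linearCombination_compression (h : IsBiorthogonal u v)
    (hA : ∀ j, A.indicator (u j) ∈ Submodule.span ℂ (Set.range u)) (c : κ → ℂ) :
    Fintype.linearCombination ℂ u ((compression A u v).mulVec c) =
      A.indicator (Fintype.linearCombination ℂ u c) := by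
  have hcol : ∀ j, Fintype.linearCombination ℂ u (fun i => compression A u v i j)
      = A.indicator (u j) := fun j => by
    obtain ⟨d, hd⟩ := (Submodule.mem_span_range_iff_exists_fun ℂ).1 (hA j)
    rw [← Fintype.linearCombination_apply] at hd
    rw [← hd]
    congr 1
    ext i
    rw [compression, Matrix.of_apply, ← hd, h.tsum_linearCombination]
  have hmul : (compression A u v).mulVec c = ∑ j, c j • fun i => compression A u v i j := by
    ext i
    simp [Matrix.mulVec, dotProduct, mul_comm]
  rw [hmul, map_sum, Fintype.linearCombination_apply]
  simp only [map_smul, hcol]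
  ext m
  by_cases hm : m ∈ A <;> simp [hm]

lemma IsBiorthogonal.isIdempotentElem_compression (h : IsBiorthogonal u v)
    (hA : ∀ j, A.indicator (u j) ∈ Submodule.span ℂ (Set.range u)) :
    IsIdempotentElem (compression A u v) := by
  refine Matrix.ext_of_mulVec_single fun j => h.linearCombination_injective ?_
  rw [← Matrix.mulVec_mulVec]
  simp only [h.linearCombination_compression hA, Set.indicator_indicator, Set.inter_self]

/-- A vector `c` fixed by the first compression and killed by the second gives a combination of `u`
supported in `A` whose counterpart for `u'` vanishes on `A`; the dual family `v` recovers the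
largest coefficient of `c` from the difference. -/
lemma IsBiorthogonal.one_le_sum_of_rank_lt (h : IsBiorthogonal u v)
    (hA : ∀ j, A.indicator (u j) ∈ Submodule.span ℂ (Set.range u)) (h' : IsBiorthogonal u' v')
    (hA' : ∀ j, A.indicator (u' j) ∈ Submodule.span ℂ (Set.range u'))
    (hr : (compression A u' v').rank < (compression A u v).rank) :
    1 ≤ ∑ j, ∑ k, ∑' m, ‖u j m - u' j m‖ₑ * ‖v k m‖ₑ := by
  obtain ⟨c, hc0, hc, hc'⟩ :=
    exists_mulVec_eq_self_of_rank_lt (h.isIdempotentElem_compression hA) hr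
  obtain ⟨i, hi⟩ := Function.ne_iff.1 hc0
  obtain ⟨k, -, hk⟩ := Finset.exists_max_image Finset.univ (fun k => ‖c k‖ₑ) ⟨i, Finset.mem_univ i⟩
  have hk0 : ‖c k‖ₑ ≠ 0 := fun h0 => hi (by simpa [h0] using hk i (Finset.mem_univ i))
  have hsupp := h.linearCombination_compression hA c
  have hvanish := h'.linearCombination_compression hA' c
  rw [hc] at hsupp
  rw [hc', map_zero] at hvanish
  have hterm : ∀ m, ‖Fintype.linearCombination ℂ u c m‖ₑ ≤ ‖c k‖ₑ * ∑ j, ‖u j m - u' j m‖ₑ := by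
    intro m
    by_cases hm : m ∈ A
    · have h0 : Fintype.linearCombination ℂ u' c m = 0 := by
        simpa [hm] using (congrFun hvanish m).symm
      rw [← sub_zero (Fintype.linearCombination ℂ u c m), ← h0]
      simp only [Fintype.linearCombination_apply, Finset.sum_apply, Pi.smul_apply,
        ← Finset.sum_sub_distrib, ← smul_sub, Finset.mul_sum]
      refine (enorm_sum_le _ _).trans (Finset.sum_le_sum fun j hj => ?_)
      rw [enorm_smul]
      gcongr
      exact hk j hj
    · rw [hsupp, Set.indicator_of_notMem hm, enorm_zero]
      exact zero_le
  have hone : 1 ≤ ∑' m, (∑ j, ‖u j m - u' j m‖ₑ) * ‖v k m‖ₑ := by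
    rw [← ENNReal.mul_le_mul_iff_right hk0 enorm_ne_top, mul_one, ← ENNReal.tsum_mul_left]
    refine (h.enorm_le_tsum c k).trans (ENNReal.tsum_le_tsum fun m => ?_)
    rw [← mul_assoc]
    gcongr
    exact hterm m
  refine hone.trans ?_
  simp only [Finset.sum_mul]
  rw [Summable.tsum_finsetSum fun _ _ => ENNReal.summable]
  exact Finset.sum_le_sum fun j _ => Finset.single_le_sum
    (f := fun k => ∑' m, ‖u j m - u' j m‖ₑ * ‖v k m‖ₑ) (fun _ _ => zero_le) (Finset.mem_univ k)

end IsBiorthogonal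

/-! ### Shift-invariant spaces and their fibers -/

lemma isClosed_shiftInvariantSpace (S : Set L2R) : IsClosed (shiftInvariantSpace S : Set L2R) :=
  Submodule.isClosed_topologicalClosure _

lemma l2Translate_int_mem_of_mem {S : Set L2R} {f : L2R} (hf : f ∈ S) (n : ℤ) :
    l2Translate n f ∈ shiftInvariantSpace S :=
  Submodule.le_topologicalClosure _ (Submodule.subset_span ⟨f, hf, n, rfl⟩)

lemma mem_shiftInvariantSpace_of_mem {S : Set L2R} {f : L2R} (hf : f ∈ S) :
    f ∈ shiftInvariantSpace S := by
  simpa [l2Translate_zero] using l2Translate_int_mem_of_mem hf 0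

lemma shiftInvariantSpace_le {S : Set L2R} {W : Submodule ℂ L2R} (hW : IsClosed (W : Set L2R))
    (h : ∀ f ∈ S, ∀ n : ℤ, l2Translate n f ∈ W) : shiftInvariantSpace S ≤ W := by
  refine Submodule.topologicalClosure_minimal _ (Submodule.span_le.2 ?_) hW
  rintro _ ⟨f, hf, n, rfl⟩
  exact h f hf n

lemma l2Translate_mem_of_forall {S : Set L2R} {a : ℝ}
    (h : ∀ f ∈ S, ∀ n : ℤ, l2Translate a (l2Translate n f) ∈ shiftInvariantSpace S) {g : L2R}
    (hg : g ∈ shiftInvariantSpace S) : l2Translate a g ∈ shiftInvariantSpace S := by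
  have hle : shiftInvariantSpace S ≤
      (shiftInvariantSpace S).comap (l2TranslateIso a).toLinearMap :=
    shiftInvariantSpace_le
      ((isClosed_shiftInvariantSpace S).preimage (l2TranslateIso a).continuous) h
  exact hle hg

lemma l2Translate_int_mem {S : Set L2R} {g : L2R} (hg : g ∈ shiftInvariantSpace S) (n : ℤ) :
    l2Translate n g ∈ shiftInvariantSpace S := by
  refine l2Translate_mem_of_forall (fun f hf m => ?_) hg
  rw [l2Translate_l2Translate, ← Int.cast_add]
  exact l2Translate_int_mem_of_mem hf _

/-- The fiber of `f ∈ L²(ℝ)` at `ξ`: the values of its Fourier transform on `ξ + ℤ`. -/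
noncomputable def fourierFiber (f : L2R) (ξ : ℝ) : ℤ → ℂ := fun m => fourierL2 f (ξ + m)

lemma fourierFiber_add_int (f : L2R) (ξ : ℝ) (l m : ℤ) :
    fourierFiber f (ξ + l) m = fourierFiber f ξ (m + l) := by
  rw [fourierFiber, fourierFiber, Int.cast_add, add_assoc, add_comm (l : ℝ)]

lemma ae_fourierFiber_l2Translate (a : ℝ) (f : L2R) : ∀ᵐ ξ : ℝ, ∀ m : ℤ,
    fourierFiber (l2Translate a f) ξ m = 𝐞 (-(a * (ξ + m))) * fourierFiber f ξ m :=
  ae_forall_comp_add_int (fourierL2_l2Translate a f)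

lemma ae_fourierFiber_l2Translate_int (n : ℤ) (f : L2R) : ∀ᵐ ξ : ℝ,
    fourierFiber (l2Translate n f) ξ = (𝐞 (-(n * ξ)) : ℂ) • fourierFiber f ξ := by
  filter_upwards [ae_fourierFiber_l2Translate n f] with ξ hξ
  ext m
  rw [hξ, Pi.smul_apply, smul_eq_mul, ← neg_mul, ← neg_mul, ← Int.cast_neg,
    fourierChar_int_mul_add_int]

lemma ae_fourierFiber_zero : ∀ᵐ ξ : ℝ, fourierFiber 0 ξ = 0 := by
  filter_upwards [ae_forall_comp_add_int (Lp.coeFn_zero ℂ 2 (volume : Measure ℝ))] with ξ hξ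
  ext m
  rw [fourierFiber, map_zero]
  exact hξ m

lemma ae_fourierFiber_add (f g : L2R) :
    ∀ᵐ ξ : ℝ, fourierFiber (f + g) ξ = fourierFiber f ξ + fourierFiber g ξ := by
  filter_upwards [ae_forall_comp_add_int (Lp.coeFn_add (fourierL2 f) (fourierL2 g))] with ξ hξ
  ext m
  rw [fourierFiber, map_add]
  exact hξ m

lemma ae_fourierFiber_smul (c : ℂ) (f : L2R) :
    ∀ᵐ ξ : ℝ, fourierFiber (c • f) ξ = c • fourierFiber f ξ := by
  filter_upwards [ae_forall_comp_add_int (Lp.coeFn_smul c (fourierL2 f))] with ξ hξ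
  ext m
  rw [fourierFiber, map_smul]
  exact hξ m

lemma ae_fourierFiber_mem_span_of_mem_span {κ : Type*} (G : κ → L2R) {f : L2R}
    (hf : f ∈ Submodule.span ℂ {h : L2R | ∃ g ∈ Set.range G, ∃ n : ℤ, h = l2Translate n g}) :
    ∀ᵐ ξ : ℝ, fourierFiber f ξ ∈
      Submodule.span ℂ (Set.range fun i => fourierFiber (G i) ξ) := by
  induction hf using Submodule.span_induction with
  | mem f hf =>
    obtain ⟨_, ⟨i, rfl⟩, n, rfl⟩ := hf
    filter_upwards [ae_fourierFiber_l2Translate_int n (G i)] with ξ hξ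
    rw [hξ]
    exact Submodule.smul_mem _ _ (Submodule.subset_span ⟨i, rfl⟩)
  | zero =>
    filter_upwards [ae_fourierFiber_zero] with ξ hξ
    rw [hξ]
    exact Submodule.zero_mem _
  | add f g _ _ hf hg =>
    filter_upwards [hf, hg, ae_fourierFiber_add f g] with ξ hf hg hξ
    rw [hξ]
    exact Submodule.add_mem _ hf hg
  | smul c f _ hf =>
    filter_upwards [hf, ae_fourierFiber_smul c f] with ξ hf hξ
    rw [hξ]
    exact Submodule.smul_mem _ c hf

lemma ae_fourierFiber_mem_span {κ : Type*} [Finite κ] (G : κ → L2R) {f : L2R}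
    (hf : f ∈ shiftInvariantSpace (Set.range G)) : ∀ᵐ ξ : ℝ,
      fourierFiber f ξ ∈ Submodule.span ℂ (Set.range fun i => fourierFiber (G i) ξ) := by
  obtain ⟨x, hx, hxf⟩ := mem_closure_iff_seq_limit.1 hf
  obtain ⟨φ, -, hlim⟩ := exists_subseq_ae_tendsto ((fourierL2.continuous.tendsto _).comp hxf)
  filter_upwards [ae_forall_comp_add_int hlim,
    ae_all_iff.2 fun n => ae_fourierFiber_mem_span_of_mem_span G (hx n)] with ξ hlim hmem
  have : FiniteDimensional ℂ (Submodule.span ℂ (Set.range fun i => fourierFiber (G i) ξ)) :=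
    FiniteDimensional.span_of_finite ℂ (Set.finite_range _)
  exact (Submodule.closed_of_finiteDimensional
    (Submodule.span ℂ (Set.range fun i => fourierFiber (G i) ξ))).mem_of_tendsto
    (tendsto_pi_nhds.2 hlim) (Eventually.of_forall fun n => hmem (φ n))

/-! ### Biorthogonal translates and the number of generators -/

lemma integral_fourierChar_mul_fourierL2_mul_conj (f h : L2R) (n : ℤ) :
    ∫ ξ, 𝐞 (n * ξ) * (fourierL2 f ξ * conj (fourierL2 h ξ))
      = inner ℂ h (l2Translate (-n : ℤ) f) := by
  rw [← fourierL2.inner_map_map, L2.inner_def]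
  refine integral_congr_ae ?_
  filter_upwards [fourierL2_l2Translate (-n : ℤ) f] with ξ hξ
  rw [hξ, RCLike.inner_apply, Int.cast_neg, neg_mul, neg_neg, mul_assoc]

lemma integrable_fourierL2_mul_conj (f h : L2R) :
    Integrable fun ξ => fourierL2 f ξ * conj (fourierL2 h ξ) := by
  simpa only [RCLike.inner_apply] using L2.integrable_inner (𝕜 := ℂ) (fourierL2 h) (fourierL2 f)

/-- The integer translates of the families `f` and `h` are biorthogonal. -/
def TranslatesBiorthogonal {κ : Type*} [DecidableEq κ] (f h : κ → L2R) : Prop :=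
  ∀ j k, ∀ n : ℤ, inner ℂ (h k) (l2Translate n (f j)) = if j = k ∧ n = 0 then 1 else 0

lemma TranslatesBiorthogonal.ae_isBiorthogonal {κ : Type*} [Finite κ] [DecidableEq κ]
    {f h : κ → L2R} (hfh : TranslatesBiorthogonal f h) : ∀ᵐ ξ : ℝ,
      IsBiorthogonal (fun j => fourierFiber (f j) ξ) fun k => fourierFiber (h k) ξ := by
  refine ae_all_iff.2 fun j => ae_all_iff.2 fun k => ?_
  have hint := integrable_fourierL2_mul_conj (f j) (h k)
  refine (ae_summable_norm_comp_add_int hint).and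
    (ae_tsum_eq_const_of_integral_fourierChar_mul hint _ fun n => ?_)
  rw [integral_fourierChar_mul_fourierL2_mul_conj, hfh j k]
  by_cases h1 : j = k <;> by_cases h2 : n = 0 <;> simp [h1, h2]

lemma exists_translatesBiorthogonal {K : ℕ} {F : Fin K → L2R}
    (hF : IsMinimalSystem (integerTranslates F)) :
    ∃ h : Fin K → shiftInvariantSpace (Set.range F),
      TranslatesBiorthogonal F fun k => (h k : L2R) := by
  have : CompleteSpace (shiftInvariantSpace (Set.range F)) :=
    (isClosed_shiftInvariantSpace _).completeSpace_coe
  choose h hh using fun k : Fin K => hF.exists_dual (k, (0 : ℤ))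
  refine ⟨h, fun j k n => ?_⟩
  have hjn := hh k (j, n)
  rw [Submodule.coe_inner] at hjn
  rw [← inner_conj_symm, show l2Translate n (F j) = (integerTranslates F (j, n) : L2R) from rfl,
    hjn]
  simp only [Prod.mk.injEq]
  split_ifs <;> simp

lemma TranslatesBiorthogonal.card_le {κ : Type*} [Fintype κ] [DecidableEq κ] {f h : κ → L2R}
    (hfh : TranslatesBiorthogonal f h) {S : Finset L2R}
    (hS : shiftInvariantSpace (Set.range f) ≤ shiftInvariantSpace (S : Set L2R)) :
    Fintype.card κ ≤ S.card := by
  have hmem : ∀ᵐ ξ : ℝ, ∀ k, fourierFiber (f k) ξ ∈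
      Submodule.span ℂ (Set.range fun s : S => fourierFiber s ξ) := by
    refine ae_all_iff.2 fun k => ae_fourierFiber_mem_span _ ?_
    rw [Subtype.range_coe]
    exact hS (mem_shiftInvariantSpace_of_mem ⟨k, rfl⟩)
  obtain ⟨ξ, hmem, hbi⟩ := (hmem.and hfh.ae_isBiorthogonal).exists
  have hli : LinearIndependent ℂ fun k => fourierFiber (f k) ξ :=
    linearIndependent_iff_injective_fintypeLinearCombination.2 hbi.linearCombination_injective
  have : FiniteDimensional ℂ (Submodule.span ℂ (Set.range fun s : S => fourierFiber s ξ)) :=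
    FiniteDimensional.span_of_finite ℂ (Set.finite_range _)
  calc Fintype.card κ
      = Module.finrank ℂ (Submodule.span ℂ (Set.range fun k => fourierFiber (f k) ξ)) :=
        (finrank_span_eq_card hli).symm
    _ ≤ Module.finrank ℂ (Submodule.span ℂ (Set.range fun s : S => fourierFiber s ξ)) :=
        Submodule.finrank_mono (Submodule.span_le.2 (Set.range_subset_iff.2 hmem))
    _ ≤ Fintype.card S := finrank_range_le_card _
    _ = S.card := Fintype.card_coe S

lemma TranslatesBiorthogonal.minGenerators_eq {κ : Type*} [Fintype κ] [DecidableEq κ]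
    {f h : κ → L2R} (hfh : TranslatesBiorthogonal f h) :
    minGenerators (shiftInvariantSpace (Set.range f)) = Fintype.card κ := by
  classical
  have hmem : (Finset.univ.image f).card ∈ {n : ℕ | ∃ S : Finset L2R, S.card = n ∧
      shiftInvariantSpace (S : Set L2R) = shiftInvariantSpace (Set.range f)} :=
    ⟨_, rfl, by simp⟩
  refine le_antisymm ((Nat.sInf_le hmem).trans Finset.card_image_le) ?_
  obtain ⟨S, hcard, hS⟩ := Nat.sInf_mem ⟨_, hmem⟩
  exact (hfh.card_le hS.ge).trans hcard.le

/-! ### Translations preserving a shift-invariant space -/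

/-- The translations mapping `V(S)` into itself. -/
def translationSubmonoid (S : Set L2R) : AddSubmonoid ℝ where
  carrier := {a | ∀ g ∈ shiftInvariantSpace S, l2Translate a g ∈ shiftInvariantSpace S}
  zero_mem' := fun g hg => by rwa [l2Translate_zero]
  add_mem' := fun {a b} ha hb g hg => by
    rw [← l2Translate_l2Translate]
    exact ha _ (hb g hg)

lemma isClosed_translationSubmonoid (S : Set L2R) : IsClosed (translationSubmonoid S : Set ℝ) := by
  have hInter : (translationSubmonoid S : Set ℝ) =
      ⋂ g ∈ shiftInvariantSpace S, (fun a => l2Translate a g) ⁻¹' (shiftInvariantSpace S) := by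
    ext a
    simp [translationSubmonoid]
  rw [hInter]
  exact isClosed_biInter fun g _ =>
    (isClosed_shiftInvariantSpace S).preimage (continuous_l2Translate_left g)

/-- By Dirichlet's theorem some `k a - m` is close to `0`, so `(k - 1) a - m` is close to `-a`. -/
lemma neg_mem_of_isClosed_of_int_mem {A : AddSubmonoid ℝ} (hA : IsClosed (A : Set ℝ))
    (hint : ∀ n : ℤ, (n : ℝ) ∈ A) {a : ℝ} (ha : a ∈ A) : -a ∈ A := by
  choose k hk0 _ hk using fun n : ℕ => Real.exists_nat_abs_mul_sub_round_le a (Nat.succ_pos n)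
  have hlim : Tendsto (fun n => k n * a - round (k n * a)) atTop (𝓝 0) := by
    refine squeeze_zero_norm (a := fun n : ℕ => 1 / ((n : ℝ) + 1)) (fun n => ?_)
      tendsto_one_div_add_atTop_nhds_zero_nat
    refine (hk n).trans ?_
    push_cast
    gcongr
    linarith
  have hlim' : Tendsto (fun n => k n * a - round (k n * a) - a) atTop (𝓝 (-a)) := by
    simpa using hlim.sub_const a
  refine hA.mem_of_tendsto hlim' (Eventually.of_forall fun n => ?_)
  have hmem := add_mem (nsmul_mem ha (k n - 1)) (hint (-round (k n * a)))
  have heq : k n * a - round (k n * a) - a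
      = (k n - 1) • a + ((-round (k n * a) : ℤ) : ℝ) := by
    rw [nsmul_eq_mul, Nat.cast_sub (hk0 n)]
    push_cast
    ring
  rwa [← heq] at hmem

/-- The translations preserving `V(S)`. -/
def translationGroup (S : Set L2R) : AddSubgroup ℝ where
  toAddSubmonoid := translationSubmonoid S
  neg_mem' := neg_mem_of_isClosed_of_int_mem (isClosed_translationSubmonoid S)
    fun n _ hg => l2Translate_int_mem hg n

lemma isClosed_translationGroup (S : Set L2R) : IsClosed (translationGroup S : Set ℝ) :=
  isClosed_translationSubmonoid S

lemma one_mem_translationGroup (S : Set L2R) : (1 : ℝ) ∈ translationGroup S := fun g hg => by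
  simpa using l2Translate_int_mem hg 1

lemma mem_of_irrational_mem {A : AddSubgroup ℝ} (hA : IsClosed (A : Set ℝ)) (h1 : (1 : ℝ) ∈ A)
    {γ : ℝ} (hγ : Irrational γ) (hγA : γ ∈ A) (x : ℝ) : x ∈ A := by
  have hdense : Dense (AddSubgroup.closure {γ, 1} : Set ℝ) :=
    dense_addSubgroupClosure_pair_iff.2 (by simpa using hγ)
  have hle : AddSubgroup.closure {γ, 1} ≤ A :=
    (AddSubgroup.closure_le A).2 (Set.insert_subset hγA (Set.singleton_subset_iff.2 h1))
  have huniv := (hdense.mono hle).closure_eq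
  rw [hA.closure_eq] at huniv
  exact Set.eq_univ_iff_forall.1 huniv x

lemma one_div_den_mem_of_ratCast_mem {A : AddSubgroup ℝ} (h1 : (1 : ℝ) ∈ A) {r : ℚ}
    (hr : (r : ℝ) ∈ A) : (1 / r.den : ℝ) ∈ A := by
  have hden : (r.den : ℝ) ≠ 0 := by exact_mod_cast r.den_nz
  have hdiv : (r : ℝ) = r.num / r.den := by exact_mod_cast (Rat.num_div_den r).symm
  have hbezout := Int.gcd_eq_gcd_ab r.num r.den
  rw [show Int.gcd r.num r.den = 1 by simpa [Int.gcd] using r.reduced] at hbezout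
  have heq : (1 / r.den : ℝ) =
      Int.gcdA r.num r.den • (r : ℝ) + Int.gcdB r.num r.den • (1 : ℝ) := by
    rw [hdiv, zsmul_eq_mul, zsmul_eq_mul]
    field_simp
    rw [mul_comm ((Int.gcdA _ _ : ℤ) : ℝ)]
    exact_mod_cast hbezout
  rw [heq]
  exact add_mem (zsmul_mem hr _) (zsmul_mem h1 _)

lemma exists_one_div_mem_of_mul_notMem_range {A : AddSubgroup ℝ} (hA : IsClosed (A : Set ℝ))
    (h1 : (1 : ℝ) ∈ A) {γ : ℝ} (hγ : γ ∈ A) {K : ℕ}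
    (hK : (K : ℝ) * γ ∉ Set.range ((↑) : ℤ → ℝ)) :
    ∃ N : ℕ, 0 < N ∧ ¬ N ∣ K ∧ (1 / N : ℝ) ∈ A := by
  by_cases hirr : Irrational γ
  · have hK0 : 0 < K := Nat.pos_of_ne_zero fun h0 => hK ⟨0, by simp [h0]⟩
    exact ⟨K + 1, K.succ_pos, Nat.not_dvd_of_pos_of_lt hK0 K.lt_succ_self,
      mem_of_irrational_mem hA h1 hirr hγ _⟩
  · obtain ⟨r, rfl⟩ : γ ∈ Set.range ((↑) : ℚ → ℝ) := not_not.1 hirr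
    refine ⟨r.den, r.pos, ?_, one_div_den_mem_of_ratCast_mem h1 hγ⟩
    rintro ⟨m, hm⟩
    have hden : (r.den : ℝ) ≠ 0 := by exact_mod_cast r.den_nz
    have hdiv : (r : ℝ) = r.num / r.den := by exact_mod_cast (Rat.num_div_den r).symm
    refine hK ⟨m * r.num, ?_⟩
    rw [hm, hdiv]
    push_cast
    field_simp

lemma HasNontrivialExtraInvariance.exists_one_div_mem {κ : Type*} [Fintype κ] [DecidableEq κ]
    {f h : κ → L2R} (hf : HasNontrivialExtraInvariance (shiftInvariantSpace (Set.range f)))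
    (hfh : TranslatesBiorthogonal f h) :
    ∃ N : ℕ, 0 < N ∧ ¬ N ∣ Fintype.card κ ∧ (1 / N : ℝ) ∈ translationGroup (Set.range f) := by
  obtain ⟨γ, -, hγ, hJ⟩ := hf
  rw [hfh.minGenerators_eq] at hJ
  exact exists_one_div_mem_of_mul_notMem_range (isClosed_translationGroup _)
    (one_mem_translationGroup _) hγ hJ

/-! ### The rank function of a space invariant under translation by `1 / N` -/

lemma fourierChar_neg_div_eq_one_iff {N : ℕ} (hN : 0 < N) (m : ℤ) :
    (𝐞 (-(m / N)) : ℂ) = 1 ↔ (N : ℤ) ∣ m := by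
  have hN' : (N : ℝ) ≠ 0 := by exact_mod_cast hN.ne'
  constructor
  · intro h
    rw [Real.fourierChar_apply, Complex.exp_eq_one_iff] at h
    obtain ⟨k, hk⟩ := h
    have hpi : (2 * π * Complex.I : ℂ) ≠ 0 := by simp [pi_ne_zero]
    have hdiv : ((-(m / N) : ℝ) : ℂ) = k := by
      apply mul_left_cancel₀ hpi
      rw [mul_comm _ (k : ℂ), ← hk]
      push_cast
      ring
    have hdiv' : (-(m / N) : ℝ) = k := by exact_mod_cast hdiv
    have hm : (m : ℝ) = N * -k := by
      rw [← hdiv']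
      field_simp
    exact ⟨-k, by exact_mod_cast hm⟩
  · rintro ⟨k, rfl⟩
    rw [← fourierChar_intCast (-k)]
    congr 2
    push_cast
    field_simp

lemma sum_fourierChar_neg_mul_div {N : ℕ} (hN : 0 < N) (m : ℤ) :
    ∑ p ∈ Finset.range N, (𝐞 (p * -(m / N)) : ℂ) = if (N : ℤ) ∣ m then (N : ℂ) else 0 := by
  have hN' : (N : ℝ) ≠ 0 := by exact_mod_cast hN.ne'
  simp only [fourierChar_natCast_mul]
  split_ifs with h
  · simp [(fourierChar_neg_div_eq_one_iff hN m).2 h]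
  · have hpow : (𝐞 (-(m / N)) : ℂ) ^ N = 1 := by
      rw [← fourierChar_natCast_mul, ← fourierChar_intCast (-m)]
      congr 2
      push_cast
      field_simp
    rw [geom_sum_eq (mt (fourierChar_neg_div_eq_one_iff hN m).1 h), hpow, sub_self, zero_div]

/-- Averaging the translates by `p / N`, `0 ≤ p < N`, with the phases `𝐞 (p ξ / N)` restricts a
fiber to the multiples of `N`. -/
lemma ae_indicator_fourierFiber_mem_span {κ : Type*} [Finite κ] {f : κ → L2R} {N : ℕ} (hN : 0 < N)
    (hinv : (1 / N : ℝ) ∈ translationGroup (Set.range f)) : ∀ᵐ ξ : ℝ, ∀ j,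
      {m : ℤ | (N : ℤ) ∣ m}.indicator (fourierFiber (f j) ξ) ∈
        Submodule.span ℂ (Set.range fun i => fourierFiber (f i) ξ) := by
  refine ae_all_iff.2 fun j => ?_
  have hmem : ∀ p : ℕ, ∀ᵐ ξ : ℝ, fourierFiber (l2Translate (p • (1 / N : ℝ)) (f j)) ξ ∈
      Submodule.span ℂ (Set.range fun i => fourierFiber (f i) ξ) := fun p =>
    ae_fourierFiber_mem_span f (nsmul_mem hinv p _ (mem_shiftInvariantSpace_of_mem ⟨j, rfl⟩))
  filter_upwards [ae_all_iff.2 hmem,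
    ae_all_iff.2 fun p : ℕ => ae_fourierFiber_l2Translate (p • (1 / N : ℝ)) (f j)] with ξ hmem htr
  have hN' : (N : ℂ) ≠ 0 := by exact_mod_cast hN.ne'
  have hmean : {m : ℤ | (N : ℤ) ∣ m}.indicator (fourierFiber (f j) ξ) =
      (N : ℂ)⁻¹ • ∑ p ∈ Finset.range N, (𝐞 (p • (1 / N : ℝ) * ξ) : ℂ) •
        fourierFiber (l2Translate (p • (1 / N : ℝ)) (f j)) ξ := by
    ext m
    have hphase : ∀ p : ℕ, p • (1 / N : ℝ) * ξ + -(p • (1 / N : ℝ) * (ξ + m)) = p * -(m / N) :=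
      fun p => by
        rw [nsmul_eq_mul]
        ring
    simp only [Pi.smul_apply, Finset.sum_apply, smul_eq_mul, htr, ← mul_assoc, ← fourierChar_add,
      hphase]
    rw [← Finset.sum_mul, sum_fourierChar_neg_mul_div hN]
    simp only [Set.indicator_apply, Set.mem_ofPred_eq]
    split_ifs
    · field_simp
    · simp
  rw [hmean]
  exact Submodule.smul_mem _ _ (Submodule.sum_mem _ fun p _ => Submodule.smul_mem _ _ (hmem p))

/-- The compression, to the span of the fibers of `f` at `ξ`, of the restriction to the multiples
of `N`. -/
noncomputable def fiberProj {κ : Type*} (N : ℕ) (f h : κ → L2R) (ξ : ℝ) : Matrix κ κ ℂ :=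
  compression {m : ℤ | (N : ℤ) ∣ m} (fun j => fourierFiber (f j) ξ) fun k => fourierFiber (h k) ξ

/-- The rank of `fiberProj`: the dimension of the part of the fiber space at `ξ` living on the
multiples of `N`. -/
noncomputable def fiberRank {κ : Type*} [Fintype κ] (N : ℕ) (f h : κ → L2R) (ξ : ℝ) : ℕ :=
  (fiberProj N f h ξ).rank

lemma sum_range_indicator_dvd_sub {N : ℕ} (hN : 0 < N) (w : ℤ → ℂ) (m : ℤ) :
    ∑ l ∈ Finset.range N, {i : ℤ | (N : ℤ) ∣ i - l}.indicator w m = w m := by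
  have hN' : (0 : ℤ) < N := by exact_mod_cast hN
  have h0 := Int.emod_nonneg m hN'.ne'
  have h1 := Int.emod_lt_of_pos m hN'
  rw [Finset.sum_eq_single_of_mem (m % N).toNat (Finset.mem_range.2 (by omega)),
    Set.indicator_of_mem]
  · rw [Set.mem_ofPred_eq, Int.toNat_of_nonneg h0]
    exact Int.dvd_self_sub_emod
  · intro l hl hne
    refine Set.indicator_of_notMem (fun hd => hne ?_) w
    have hmod : (l : ℤ) % N = m % N := Int.modEq_iff_dvd.2 hd
    rw [Finset.mem_range] at hl
    rw [Int.emod_eq_of_lt (Int.natCast_nonneg l) (by exact_mod_cast hl)] at hmod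
    omega

lemma trace_fiberProj_add_natCast {κ : Type*} [Fintype κ] (N : ℕ) (f h : κ → L2R) (ξ : ℝ)
    (l : ℕ) :
    (fiberProj N f h (ξ + l)).trace = ∑ k, ∑' m : ℤ, {i : ℤ | (N : ℤ) ∣ i - l}.indicator
      (fun i => fourierFiber (f k) ξ i * conj (fourierFiber (h k) ξ i)) m := by
  refine Finset.sum_congr rfl fun k _ => ?_
  rw [Matrix.diag_apply, fiberProj, compression, Matrix.of_apply,
    ← (Equiv.subRight (l : ℤ)).tsum_eq]
  refine tsum_congr fun m => ?_
  have hf : ∀ g : L2R, fourierFiber g (ξ + l) (m - l) = fourierFiber g ξ m := fun g => by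
    rw [← Int.cast_natCast l, fourierFiber_add_int, sub_add_cancel]
  simp only [Equiv.subRight_apply, Set.indicator_apply, Set.mem_ofPred_eq, hf, ite_mul, zero_mul]

lemma sum_trace_fiberProj {κ : Type*} [Fintype κ] [DecidableEq κ] {N : ℕ} (hN : 0 < N)
    {f h : κ → L2R} {ξ : ℝ}
    (hξ : IsBiorthogonal (fun j => fourierFiber (f j) ξ) fun k => fourierFiber (h k) ξ) :
    ∑ l ∈ Finset.range N, (fiberProj N f h (ξ + l)).trace = Fintype.card κ := by
  simp only [trace_fiberProj_add_natCast]
  rw [Finset.sum_comm]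
  have hone : ∀ k, ∑ l ∈ Finset.range N, ∑' m : ℤ, {i : ℤ | (N : ℤ) ∣ i - l}.indicator
      (fun i => fourierFiber (f k) ξ i * conj (fourierFiber (h k) ξ i)) m = 1 := by
    intro k
    rw [← Summable.tsum_finsetSum fun l _ => (hξ k k).1.of_norm.indicator _]
    simp only [sum_range_indicator_dvd_sub hN]
    rw [(hξ k k).2, if_pos rfl]
  simp [hone]

lemma aemeasurable_trace_fiberProj {κ : Type*} [Fintype κ] (N : ℕ) (f h : κ → L2R) :
    AEMeasurable fun ξ => (fiberProj N f h ξ).trace := by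
  have hint := fun k => integrable_fourierL2_mul_conj (f k) (h k)
  have htrace : ∀ ξ, (fiberProj N f h ξ).trace = ∑ k, ∑' m : ℤ, {i : ℤ | (N : ℤ) ∣ i}.indicator
      (fun i => fourierFiber (f k) ξ i * conj (fourierFiber (h k) ξ i)) m := fun ξ => by
    simpa using trace_fiberProj_add_natCast N f h ξ 0
  simp only [htrace]
  refine Finset.aemeasurable_fun_sum _ fun k _ => aemeasurable_tsum_of_summable (fun m => ?_) ?_
  · by_cases hm : (N : ℤ) ∣ m
    · simp only [Set.indicator_apply, Set.mem_ofPred_eq, if_pos hm]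
      exact ((hint k).comp_add_right (m : ℝ)).1.aemeasurable
    · simp only [Set.indicator_apply, Set.mem_ofPred_eq, if_neg hm]
      exact aemeasurable_const
  · filter_upwards [ae_summable_norm_comp_add_int (hint k)] with ξ hξ
    exact hξ.of_norm.indicator _

lemma fiberRank_le {κ : Type*} [Fintype κ] (N : ℕ) (f h : κ → L2R) (ξ : ℝ) :
    fiberRank N f h ξ ≤ Fintype.card κ :=
  Matrix.rank_le_card_width _

section FiberRank

variable {κ : Type*} [Fintype κ] [DecidableEq κ] {f h : κ → L2R} {N : ℕ}

lemma TranslatesBiorthogonal.ae_trace_fiberProj (hfh : TranslatesBiorthogonal f h) (hN : 0 < N)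
    (hinv : (1 / N : ℝ) ∈ translationGroup (Set.range f)) :
    ∀ᵐ ξ : ℝ, (fiberProj N f h ξ).trace = fiberRank N f h ξ := by
  filter_upwards [hfh.ae_isBiorthogonal, ae_indicator_fourierFiber_mem_span hN hinv] with ξ h1 h2
  exact trace_eq_rank_of_isIdempotentElem (h1.isIdempotentElem_compression h2)

lemma TranslatesBiorthogonal.ae_sum_fiberRank (hfh : TranslatesBiorthogonal f h) (hN : 0 < N)
    (hinv : (1 / N : ℝ) ∈ translationGroup (Set.range f)) :
    ∀ᵐ ξ : ℝ, ∑ l ∈ Finset.range N, fiberRank N f h (ξ + l) = Fintype.card κ := by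
  filter_upwards [hfh.ae_isBiorthogonal,
    ae_all_iff.2 fun l : ℕ => ae_comp_add (hfh.ae_trace_fiberProj hN hinv) l] with ξ hξ htrace
  have hsum := sum_trace_fiberProj hN hξ
  simp only [htrace] at hsum
  exact_mod_cast hsum

lemma TranslatesBiorthogonal.aemeasurable_fiberRank (hfh : TranslatesBiorthogonal f h)
    (hN : 0 < N) (hinv : (1 / N : ℝ) ∈ translationGroup (Set.range f)) :
    AEMeasurable fun ξ => (fiberRank N f h ξ : ℝ) := by
  refine (Complex.measurable_re.comp_aemeasurable (aemeasurable_trace_fiberProj N f h)).congr ?_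
  filter_upwards [hfh.ae_trace_fiberProj hN hinv] with ξ hξ
  rw [Function.comp_apply, hξ, Complex.natCast_re]

end FiberRank

/-! ### Oscillation of the rank function -/

lemma exists_setIntegral_Ioc_eq {f : ℝ → ℝ} (hf : LocallyIntegrable f) {N : ℕ} (hN : 0 < N) {c : ℝ}
    (hsum : ∀ᵐ x, ∑ l ∈ Finset.range N, f (x + l) = c) {δ : ℝ} (hδ : 0 ≤ δ) :
    ∃ a, ∫ x in Set.Ioc a (a + δ), f x = c / N * δ := by
  have hint : ∀ a b : ℝ, IntervalIntegrable f volume a b := fun a b =>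
    (hf.integrableOn_isCompact isCompact_uIcc).intervalIntegrable
  set F : ℝ → ℝ := fun a => ∫ x in a..a + δ, f x
  have hcont : Continuous F := by
    have hprim := intervalIntegral.continuous_primitive hint 0
    refine ((hprim.comp (continuous_add_const δ)).sub hprim).congr fun a => ?_
    exact intervalIntegral.integral_interval_sub_left (hint _ _) (hint _ _)
  have hFl : ∀ l : ℕ, F l = ∫ x in (0 : ℝ)..δ, f (x + l) := fun l => by
    rw [intervalIntegral.integral_comp_add_right, zero_add, add_comm δ]
  have hFsum : ∑ l ∈ Finset.range N, F l = ∑ _l ∈ Finset.range N, c / N * δ := by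
    have hN' : (N : ℝ) ≠ 0 := by exact_mod_cast hN.ne'
    simp only [hFl]
    rw [← intervalIntegral.integral_finsetSum fun l _ => by
        simpa using (hint (0 + l) (δ + l)).comp_add_right (l : ℝ),
      intervalIntegral.integral_congr_ae (hsum.mono fun x hx _ => hx),
      intervalIntegral.integral_const, Finset.sum_const, Finset.card_range, smul_eq_mul,
      nsmul_eq_mul]
    field_simp
    ring
  have hne : (Finset.range N).Nonempty := ⟨0, Finset.mem_range.2 hN⟩
  obtain ⟨l, -, hl⟩ := Finset.exists_le_of_sum_le hne hFsum.le
  obtain ⟨l', -, hl'⟩ := Finset.exists_le_of_sum_le hne hFsum.ge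
  obtain ⟨a, ha⟩ := mem_range_of_exists_le_of_exists_ge hcont ⟨_, hl⟩ ⟨_, hl'⟩
  exact ⟨a, (intervalIntegral.integral_of_le (le_add_of_nonneg_right hδ)).symm.trans ha⟩

lemma one_div_le_div_sub_natDiv {K N : ℕ} (hN : 0 < N) (hNK : ¬ N ∣ K) :
    (1 / N : ℝ) ≤ K / N - (K / N : ℕ) := by
  have hN' : (0 : ℝ) < N := by exact_mod_cast hN
  have hK : (N : ℝ) * (K / N : ℕ) + (K % N : ℕ) = K := by exact_mod_cast Nat.div_add_mod K N
  have hmod : (1 : ℝ) ≤ (K % N : ℕ) := by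
    exact_mod_cast Nat.pos_of_ne_zero fun h0 => hNK (Nat.dvd_of_mod_eq_zero h0)
  rw [le_sub_iff_add_le, div_add' _ _ _ hN'.ne']
  gcongr
  linarith

lemma one_div_le_natDiv_add_one_sub_div {N : ℕ} (hN : 0 < N) (K : ℕ) :
    (1 / N : ℝ) ≤ (K / N : ℕ) + 1 - K / N := by
  have hN' : (0 : ℝ) < N := by exact_mod_cast hN
  have hK : (N : ℝ) * (K / N : ℕ) + (K % N : ℕ) = K := by exact_mod_cast Nat.div_add_mod K N
  have hmod : ((K % N : ℕ) : ℝ) + 1 ≤ N := by exact_mod_cast Nat.mod_lt K hN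
  rw [le_sub_iff_add_le, ← add_div, div_le_iff₀ hN']
  linarith

lemma ofReal_integral_div_le_measure {X : Type*} [MeasurableSpace X] {μ : Measure X} {f : X → ℝ}
    {C : ℝ} (hC : 0 < C) (hf : ∀ x, f x ≤ C) {s : Set X} (hs : ∀ x ∉ s, f x ≤ 0) :
    ENNReal.ofReal ((∫ x, f x ∂μ) / C) ≤ μ s := by
  rw [← integral_div]
  exact integral_le_measure (fun x _ => div_le_one_of_le₀ (hf x) hC.le)
    fun x hx => div_nonpos_of_nonpos_of_nonneg (hs x hx) hC.le

/-- On a suitable interval the mean of the integer-valued function `D` is `K / N`, which is not an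
integer. -/
lemma exists_interval_oscillation {D : ℝ → ℕ} (hD : AEMeasurable fun x => (D x : ℝ)) {K N : ℕ}
    (hN : 0 < N) (hNK : ¬ N ∣ K) (hDK : ∀ x, D x ≤ K)
    (hsum : ∀ᵐ x, ∑ l ∈ Finset.range N, D (x + l) = K) {δ : ℝ} (hδ : 0 ≤ δ) :
    ∃ (a : ℝ) (r : ℕ),
      ENNReal.ofReal (1 / N * δ / (K + 1)) ≤ volume.restrict (Set.Ioc a (a + δ)) {x | r < D x} ∧
      ENNReal.ofReal (1 / N * δ / (K + 1)) ≤
        volume.restrict (Set.Ioc a (a + δ)) {x | D x ≤ r} := by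
  have hloc : LocallyIntegrable fun x => (D x : ℝ) :=
    (locallyIntegrable_const (K : ℝ)).mono hD.aestronglyMeasurable
      (ae_of_all _ fun x => by simpa using hDK x)
  obtain ⟨a, ha⟩ := exists_setIntegral_Ioc_eq (c := K) hloc hN
    (hsum.mono fun x hx => by exact_mod_cast hx) hδ
  set I := Set.Ioc a (a + δ)
  have hDI : Integrable (fun x => (D x : ℝ)) (volume.restrict I) :=
    (hloc.integrableOn_isCompact isCompact_Icc).mono_set Set.Ioc_subset_Icc_self
  have hcI : ∀ c : ℝ, Integrable (fun _ => c) (volume.restrict I) := fun c =>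
    integrableOn_const measure_Ioc_lt_top.ne
  have hcint : ∀ c : ℝ, ∫ _ in I, c = c * δ := fun c => by simp [I, hδ, mul_comm]
  have hK : (0 : ℝ) < K + 1 := by positivity
  have hr : ((K / N : ℕ) : ℝ) ≤ K := by exact_mod_cast Nat.div_le_self K N
  refine ⟨a, K / N, (ENNReal.ofReal_le_ofReal ?_).trans
    (ofReal_integral_div_le_measure (f := fun x => (D x : ℝ) - (K / N : ℕ)) hK ?_ ?_),
    (ENNReal.ofReal_le_ofReal ?_).trans
    (ofReal_integral_div_le_measure (f := fun x => (K / N : ℕ) + 1 - (D x : ℝ)) hK ?_ ?_)⟩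
  · rw [integral_sub hDI (hcI _), ha, hcint, ← sub_mul]
    gcongr
    exact one_div_le_div_sub_natDiv hN hNK
  · intro x
    have hDx : (D x : ℝ) ≤ K := by exact_mod_cast hDK x
    linarith [Nat.cast_nonneg (α := ℝ) (K / N)]
  · intro x hx
    rw [Set.mem_ofPred_eq, not_lt] at hx
    exact sub_nonpos.2 (by exact_mod_cast hx)
  · rw [integral_sub (hcI _) hDI, ha, hcint, ← sub_mul]
    gcongr
    exact one_div_le_natDiv_add_one_sub_div hN K
  · intro x
    linarith [Nat.cast_nonneg (α := ℝ) (D x)]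
  · intro x hx
    rw [Set.mem_ofPred_eq, not_le] at hx
    exact sub_nonpos.2 (by exact_mod_cast hx)

/-! ### Fiber variation -/

lemma measure_mul_measure_le_lintegral_lintegral {X Y : Type*} [MeasurableSpace X]
    [MeasurableSpace Y] {μ : Measure X} {ν : Measure Y} [SFinite ν] {Φ : X → Y → ℝ≥0∞}
    (hΦ : Measurable (Function.uncurry Φ)) {s : Set X} {t : Set Y}
    (hst : ∀ᵐ x ∂μ, ∀ᵐ y ∂ν, x ∈ s → y ∈ t → 1 ≤ Φ x y) :
    μ s * ν t ≤ ∫⁻ x, ∫⁻ y, Φ x y ∂ν ∂μ := by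
  have hinner : ∀ᵐ x ∂μ, x ∈ s → ν t ≤ ∫⁻ y, Φ x y ∂ν := by
    filter_upwards [hst] with x hx hxs
    calc ν t ≤ ν {y | 1 ≤ Φ x y} := measure_mono_ae (hx.mono fun y hy hyt => hy hxs hyt)
      _ ≤ ∫⁻ y, Φ x y ∂ν := by
        simpa using mul_meas_ge_le_lintegral (μ := ν) hΦ.of_uncurry_left 1
  calc μ s * ν t ≤ ν t * μ {x | ν t ≤ ∫⁻ y, Φ x y ∂ν} := by
        rw [mul_comm]
        gcongr 1
        exact measure_mono_ae hinner
    _ ≤ ∫⁻ x, ∫⁻ y, Φ x y ∂ν ∂μ := mul_meas_ge_le_lintegral hΦ.lintegral_prod_right' _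

lemma lintegral_lintegral_finsetSum {X Y ι : Type*} [MeasurableSpace X] [MeasurableSpace Y]
    {μ : Measure X} {ν : Measure Y} [SFinite ν] (s : Finset ι) {Φ : ι → X → Y → ℝ≥0∞}
    (hΦ : ∀ i, Measurable (Function.uncurry (Φ i))) :
    ∫⁻ x, ∫⁻ y, ∑ i ∈ s, Φ i x y ∂ν ∂μ = ∑ i ∈ s, ∫⁻ x, ∫⁻ y, Φ i x y ∂ν ∂μ := by
  have hinner : ∀ x, ∫⁻ y, ∑ i ∈ s, Φ i x y ∂ν = ∑ i ∈ s, ∫⁻ y, Φ i x y ∂ν := fun x =>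
    lintegral_finsetSum s fun i _ => (hΦ i).of_uncurry_left
  simp only [hinner]
  exact lintegral_finsetSum s fun i _ => (hΦ i).lintegral_prod_right'

/-- The variation, between `x` and `y`, of the fibers of `u`, weighted by the fibers of `w`. -/
noncomputable def fiberVariation (u w : L2R) (x y : ℝ) : ℝ≥0∞ :=
  ∑' m : ℤ, ‖u (x + m) - u (y + m)‖ₑ * ‖w (x + m)‖ₑ

lemma measurable_fiberVariation {X : Type*} [MeasurableSpace X] (u w : L2R) {φ ψ : X → ℝ}
    (hφ : Measurable φ) (hψ : Measurable ψ) :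
    Measurable fun z => fiberVariation u w (φ z) (ψ z) := by
  have hu : Measurable (u : ℝ → ℂ) := (Lp.stronglyMeasurable u).measurable
  have hw : Measurable (w : ℝ → ℂ) := (Lp.stronglyMeasurable w).measurable
  exact Measurable.tsum fun m =>
    ((hu.comp (hφ.add_const m)).sub (hu.comp (hψ.add_const m))).enorm.mul
      (hw.comp (hφ.add_const m)).enorm

/-- The union of the integer translates of the interval `(a, a + δ]`. -/
def periodicInterval (a δ : ℝ) : Set ℝ := ⋃ n : ℤ, Set.Ioc (a + n) (a + n + δ)

lemma tsum_setLIntegral_Ioc {δ : ℝ} (hδ : δ ≤ 1) (a : ℝ) (G : ℝ → ℝ≥0∞) :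
    ∑' n : ℤ, ∫⁻ x in Set.Ioc a (a + δ), G (x + n) = ∫⁻ x in periodicInterval a δ, G x := by
  rw [periodicInterval, lintegral_iUnion (fun _ => measurableSet_Ioc)]
  · refine tsum_congr fun n => ?_
    rw [← (measurePreserving_add_right volume (n : ℝ)).setLIntegral_comp_preimage_emb
      (measurableEmbedding_addRight _) _ (Set.Ioc (a + n) (a + n + δ))]
    congr 2
    simp [add_sub_right_comm]
  · refine (Set.pairwise_disjoint_Ioc_add_intCast a).mono fun m n h => h.mono ?_ ?_ <;>
      exact Set.Ioc_subset_Ioc_right (by linarith)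

lemma enorm_l2Translate_sub_sq (t : ℝ) (u : L2R) :
    ‖l2Translate (-t) u - u‖ₑ ^ 2 = ∫⁻ x, ‖u x - u (x + t)‖ₑ ^ 2 := by
  rw [enorm_sq_eq_lintegral]
  refine lintegral_congr_ae ?_
  filter_upwards [Lp.coeFn_sub (l2Translate (-t) u) u, coeFn_l2Translate (-t) u] with x h1 h2
  rw [h1, Pi.sub_apply, h2, sub_neg_eq_add, enorm_sub_rev]

lemma setLIntegral_fiberVariation_add_le {δ : ℝ} (hδ : δ ≤ 1) (a t : ℝ) (u w : L2R) {W : ℝ≥0∞}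
    (hW : ∫⁻ x in periodicInterval a δ, ‖w x‖ₑ ^ 2 ≤ W ^ 2) :
    ∫⁻ x in Set.Ioc a (a + δ), fiberVariation u w x (x + t) ≤ ‖l2Translate (-t) u - u‖ₑ * W := by
  have hu : Measurable (u : ℝ → ℂ) := (Lp.stronglyMeasurable u).measurable
  have hw : Measurable (w : ℝ → ℂ) := (Lp.stronglyMeasurable w).measurable
  have hsq : ∀ c : ℝ≥0∞, (c ^ 2) ^ (1 / (2 : ℝ)) = c := fun c => by
    rw [← ENNReal.rpow_natCast, ← ENNReal.rpow_mul]
    simp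
  have hdiff : Measurable fun x => ‖u x - u (x + t)‖ₑ := (hu.sub (hu.comp (by fun_prop))).enorm
  simp only [fiberVariation, add_right_comm _ t]
  have hterm : ∀ m : ℤ, Measurable fun x => ‖u (x + m) - u (x + m + t)‖ₑ * ‖w (x + m)‖ₑ :=
    fun m => (hdiff.mul hw.enorm).comp (measurable_add_const (m : ℝ))
  rw [lintegral_tsum fun m => (hterm m).aemeasurable,
    tsum_setLIntegral_Ioc hδ a fun x => ‖u x - u (x + t)‖ₑ * ‖w x‖ₑ]
  refine (ENNReal.lintegral_mul_le_Lp_mul_Lq _ Real.HolderConjugate.two_two hdiff.aemeasurable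
    hw.enorm.aemeasurable).trans ?_
  simp only [ENNReal.rpow_two]
  gcongr
  · rw [← hsq ‖l2Translate (-t) u - u‖ₑ, enorm_l2Translate_sub_sq]
    gcongr
    exact Measure.restrict_le_self
  · rw [← hsq W]
    gcongr

lemma lintegral_lintegral_fiberVariation_le {δ : ℝ} (hδ : δ ≤ 1) (a : ℝ) (u w : L2R)
    {Ω W : ℝ≥0∞} (hΩ : ∀ t, |t| ≤ δ → ‖l2Translate t u - u‖ₑ ≤ Ω)
    (hW : ∫⁻ x in periodicInterval a δ, ‖w x‖ₑ ^ 2 ≤ W ^ 2) :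
    ∫⁻ x in Set.Ioc a (a + δ), ∫⁻ y in Set.Ioc a (a + δ), fiberVariation u w x y ≤
      ENNReal.ofReal (2 * δ) * (Ω * W) := by
  set I := Set.Ioc a (a + δ) with hI
  set J := Set.Icc (-δ) δ
  have hinner : ∀ x ∈ I, ∫⁻ y in I, fiberVariation u w x y ≤
      ∫⁻ t in J, fiberVariation u w x (x + t) := by
    intro x hx
    rw [← (measurePreserving_add_left volume x).setLIntegral_comp_preimage_emb
      (measurableEmbedding_addLeft _) _ I]
    have hsub : (fun t => x + t) ⁻¹' I ⊆ J := fun t ht => by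
      rw [hI, Set.mem_preimage, Set.mem_Ioc] at ht
      rw [hI, Set.mem_Ioc] at hx
      constructor <;> linarith [ht.1, ht.2, hx.1, hx.2]
    exact lintegral_mono_set hsub
  have hmeas : Measurable fun p : ℝ × ℝ => fiberVariation u w p.1 (p.1 + p.2) :=
    measurable_fiberVariation u w measurable_fst (measurable_fst.add measurable_snd)
  calc _ ≤ ∫⁻ x in I, ∫⁻ t in J, fiberVariation u w x (x + t) :=
        setLIntegral_mono' measurableSet_Ioc hinner
    _ = ∫⁻ t in J, ∫⁻ x in I, fiberVariation u w x (x + t) :=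
        lintegral_lintegral_swap hmeas.aemeasurable
    _ ≤ ∫⁻ _ in J, Ω * W := setLIntegral_mono' measurableSet_Icc fun t ht =>
        (setLIntegral_fiberVariation_add_le hδ a t u w hW).trans
          (mul_le_mul_left (hΩ _ (by rw [abs_neg]; exact abs_le.2 ht)) _)
    _ = ENNReal.ofReal (2 * δ) * (Ω * W) := by
        rw [setLIntegral_const, Real.volume_Icc, sub_neg_eq_add, two_mul, mul_comm]

section RankOscillation

variable {κ : Type*} [Fintype κ] [DecidableEq κ] {f h : κ → L2R} {N : ℕ}

lemma TranslatesBiorthogonal.exists_le_sum_lintegral (hfh : TranslatesBiorthogonal f h)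
    (hN : 0 < N) (hNκ : ¬ N ∣ Fintype.card κ)
    (hinv : (1 / N : ℝ) ∈ translationGroup (Set.range f)) {δ : ℝ} (hδ : 0 ≤ δ) :
    ∃ a : ℝ, ENNReal.ofReal (1 / N * δ / (Fintype.card κ + 1)) ^ 2 ≤
      ∑ j, ∑ k, ∫⁻ x in Set.Ioc a (a + δ), ∫⁻ y in Set.Ioc a (a + δ),
        fiberVariation (fourierL2 (f j)) (fourierL2 (h k)) x y := by
  obtain ⟨a, r, hlt, hle⟩ := exists_interval_oscillation (hfh.aemeasurable_fiberRank hN hinv) hN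
    hNκ (fiberRank_le N f h) (hfh.ae_sum_fiberRank hN hinv) hδ
  refine ⟨a, ?_⟩
  have hmeas : ∀ j k, Measurable (Function.uncurry
      (fiberVariation (fourierL2 (f j)) (fourierL2 (h k)))) := fun j k =>
    measurable_fiberVariation _ _ measurable_fst measurable_snd
  simp only [sq, ← Fintype.sum_prod_type']
  rw [← lintegral_lintegral_finsetSum _ fun p : κ × κ => hmeas p.1 p.2]
  refine (mul_le_mul' hlt hle).trans (measure_mul_measure_le_lintegral_lintegral ?_ ?_)
  · exact Finset.measurable_fun_sum _ fun p _ => hmeas p.1 p.2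
  · have hreg := hfh.ae_isBiorthogonal.and (ae_indicator_fourierFiber_mem_span hN hinv)
    filter_upwards [ae_restrict_of_ae hreg] with x hx
    filter_upwards [ae_restrict_of_ae hreg] with y hy hxr hyr
    rw [Fintype.sum_prod_type' fun j k => fiberVariation (fourierL2 (f j)) (fourierL2 (h k)) x y]
    exact hx.1.one_le_sum_of_rank_lt hx.2 hy.1 hy.2 (hyr.trans_lt hxr)

/-- Bounds at scale `δ` in the frequency domain: `Ω` for the modulus of continuity of the family `f`
and `W` for the norm of the family `h` on the integer translates of an interval of length `δ`. -/
structure IsFrequencyBound {κ : Type*} (f h : κ → L2R) (δ Ω W : ℝ) : Prop where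
  modulus_nonneg : 0 ≤ Ω
  enorm_l2Translate_sub_le : ∀ j t, |t| ≤ δ →
    ‖l2Translate t (fourierL2 (f j)) - fourierL2 (f j)‖ₑ ≤ ENNReal.ofReal Ω
  setLIntegral_le : ∀ k a,
    ∫⁻ x in periodicInterval a δ, ‖fourierL2 (h k) x‖ₑ ^ 2 ≤ ENNReal.ofReal W ^ 2

/-- An uncertainty principle: when the space is invariant under translation by `1 / N`, the
generators cannot be smooth in frequency while their duals are spread out. -/
lemma TranslatesBiorthogonal.exists_mul_le (hfh : TranslatesBiorthogonal f h)
    (hN : 0 < N) (hNκ : ¬ N ∣ Fintype.card κ)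
    (hinv : (1 / N : ℝ) ∈ translationGroup (Set.range f)) :
    ∃ c : ℝ, 0 < c ∧ ∀ δ Ω W : ℝ, 0 < δ → δ ≤ 1 → IsFrequencyBound f h δ Ω W →
      c * δ ≤ Ω * W := by
  set K := Fintype.card κ with hK
  have hK0 : (0 : ℝ) < K := by
    exact_mod_cast Nat.pos_of_ne_zero fun (h0 : K = 0) => hNκ (by simp [h0])
  refine ⟨(1 / N / (K + 1)) ^ 2 / (2 * K ^ 2), by positivity,
    fun δ Ω W hδ hδ1 hΩW => ?_⟩
  obtain ⟨a, ha⟩ := hfh.exists_le_sum_lintegral hN hNκ hinv hδ.le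
  have hle : ENNReal.ofReal (1 / N * δ / (K + 1)) ^ 2 ≤
      ENNReal.ofReal (K ^ 2 * (2 * δ * (Ω * W))) := by
    refine ha.trans ?_
    calc _ ≤ ∑ _j : κ, ∑ _k : κ, ENNReal.ofReal (2 * δ * (Ω * W)) := by
          refine Finset.sum_le_sum fun j _ => Finset.sum_le_sum fun k _ => ?_
          rw [ENNReal.ofReal_mul (by positivity), ENNReal.ofReal_mul hΩW.modulus_nonneg]
          exact lintegral_lintegral_fiberVariation_le hδ1 a _ _
            (hΩW.enorm_l2Translate_sub_le j) (hΩW.setLIntegral_le k a)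
      _ = _ := by
          rw [Finset.sum_const, Finset.sum_const, Finset.card_univ, ← hK, smul_smul, nsmul_eq_mul,
            ENNReal.ofReal_mul (p := (K : ℝ) ^ 2) (by positivity),
            ENNReal.ofReal_pow (by positivity), ENNReal.ofReal_natCast, sq, Nat.cast_mul]
  rw [← ENNReal.ofReal_pow (by positivity)] at hle
  have hpos : 0 < (1 / N * δ / (K + 1)) ^ 2 := by positivity
  replace hle := (ENNReal.ofReal_le_ofReal_iff'.1 hle).resolve_right hpos.not_ge
  refine le_of_mul_le_mul_left ?_ (by positivity : 0 < K ^ 2 * (2 * δ))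
  calc (K ^ 2 * (2 * δ)) * ((1 / N / (K + 1)) ^ 2 / (2 * K ^ 2) * δ)
      = (1 / N * δ / (K + 1)) ^ 2 := by field_simp
    _ ≤ K ^ 2 * (2 * δ) * (Ω * W) := by linarith

end RankOscillation

/-! ### Concentration of the dual generators -/

lemma card_div_two_le_norm_sum_fourierChar {s : Finset ℤ} {M : ℝ} (hs : ∀ p ∈ s, |(p : ℝ)| ≤ M)
    {t : ℝ} {n : ℤ} (ht : M * |t - n| ≤ 1 / 6) :
    (s.card : ℝ) / 2 ≤ ‖∑ p ∈ s, (𝐞 (p * t) : ℂ)‖ := by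
  have hterm : ∀ p ∈ s, (1 / 2 : ℝ) ≤ (𝐞 (p * t) : ℂ).re := fun p hp => by
    have hred : (𝐞 (p * t) : ℂ) = 𝐞 (p * (t - n)) := by
      rw [show (p * t : ℝ) = p * (t - n) + ((p * n : ℤ) : ℝ) by push_cast; ring, fourierChar_add,
        fourierChar_intCast, mul_one]
    have hangle : |2 * π * (p * (t - n))| ≤ π / 3 := by
      rw [abs_mul, abs_of_pos two_pi_pos, abs_mul]
      calc 2 * π * (|(p : ℝ)| * |t - n|) ≤ 2 * π * (M * |t - n|) := by gcongr; exact hs p hp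
        _ ≤ 2 * π * (1 / 6) := by gcongr
        _ = π / 3 := by ring
    rw [hred, Real.fourierChar_apply, Complex.exp_ofReal_mul_I_re, ← Real.cos_abs,
      ← Real.cos_pi_div_three]
    exact Real.cos_le_cos_of_nonneg_of_le_pi (abs_nonneg _) (by linarith [pi_pos]) hangle
  calc (s.card : ℝ) / 2 = ∑ _p ∈ s, (1 / 2 : ℝ) := by
        rw [Finset.sum_const, nsmul_eq_mul, mul_one_div]
    _ ≤ ∑ p ∈ s, (𝐞 (p * t) : ℂ).re := Finset.sum_le_sum hterm
    _ = (∑ p ∈ s, (𝐞 (p * t) : ℂ)).re := (Complex.re_sum _ _).symm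
    _ ≤ _ := Complex.re_le_norm _

lemma div_two_le_norm_sum_fourierChar_of_mem_periodicInterval {M : ℕ} (hM : 0 < M) {a ξ : ℝ}
    (hξ : ξ ∈ periodicInterval a (1 / (3 * M))) :
    (M : ℝ) / 2 ≤ ‖∑ p ∈ Finset.Ico (0 : ℤ) M, (𝐞 (p * (a + 1 / (6 * M) - ξ)) : ℂ)‖ := by
  obtain ⟨n, hn1, hn2⟩ := Set.mem_iUnion.1 hξ
  refine (le_of_eq (by simp)).trans
    (card_div_two_le_norm_sum_fourierChar (M := M) (n := -n) (fun p hp => ?_) ?_)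
  · obtain ⟨hp0, hpM⟩ := Finset.mem_Ico.1 hp
    rw [abs_of_nonneg (by exact_mod_cast hp0)]
    exact_mod_cast hpM.le
  · have hwidth : 1 / (3 * M : ℝ) = 1 / (6 * M) + 1 / (6 * M) := by field_simp; norm_num
    calc (M : ℝ) * |a + 1 / (6 * M) - ξ - (-n : ℤ)| ≤ M * (1 / (6 * M)) := by
          gcongr
          rw [abs_le]
          constructor <;> push_cast <;> linarith
      _ = 1 / 6 := by field_simp

lemma coeFn_fourierL2_sum_smul_l2Translate (s : Finset ℤ) (c : ℤ → ℂ) (g : L2R) :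
    fourierL2 (∑ p ∈ s, c p • l2Translate p g) =ᵐ[volume]
      fun ξ => (∑ p ∈ s, c p * 𝐞 (-(p * ξ))) * fourierL2 g ξ := by
  rw [map_sum]
  filter_upwards [Lp.coeFn_finsetSum s fun p => fourierL2 (c p • l2Translate p g),
    ae_all_iff.2 fun p : ℤ => Lp.coeFn_smul (c p) (fourierL2 (l2Translate p g)),
    ae_all_iff.2 fun p : ℤ => fourierL2_l2Translate p g] with ξ hsum hsmul htrans
  rw [hsum, Finset.sum_apply, Finset.sum_mul]
  refine Finset.sum_congr rfl fun p _ => ?_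
  rw [map_smul, hsmul, Pi.smul_apply, htrans, smul_eq_mul, mul_assoc]

lemma TranslatesBiorthogonal.inner_l2Translate {κ : Type*} [DecidableEq κ] {f h : κ → L2R}
    (hfh : TranslatesBiorthogonal f h) (j k : κ) (n p : ℤ) :
    inner ℂ (l2Translate n (f j)) (l2Translate p (h k)) = if j = k ∧ n = p then 1 else 0 := by
  have hn : l2Translate n (f j) = l2Translate p (l2Translate (n - p : ℤ) (f j)) := by
    rw [l2Translate_l2Translate, Int.cast_sub, add_sub_cancel]
  rw [hn, ← l2TranslateIso_apply, ← l2TranslateIso_apply p (h k), LinearIsometry.inner_map_map,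
    ← inner_conj_symm, hfh j k]
  simp only [sub_eq_zero]
  split_ifs <;> simp

section Dual

variable {q q' : ℝ≥0∞} {K : ℕ} {F : Fin K → L2R} {C : ℝ}
  {h : Fin K → shiftInvariantSpace (Set.range F)}

lemma IsCqSystemWith.norm_sum_smul_l2Translate_le (hCq : IsCqSystemWith q C (integerTranslates F))
    (hqq' : ENNReal.HolderConjugate q q') (hC : 0 ≤ C)
    (hfh : TranslatesBiorthogonal F fun k => (h k : L2R)) (k : Fin K) (s : Finset ℤ) {c : ℤ → ℂ}
    (hc : ∀ p, ‖c p‖ ≤ 1) :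
    ‖∑ p ∈ s, c p • l2Translate p (h k : L2R)‖ ≤ C * (s.card : ℝ) ^ (1 / q'.toReal) := by
  set g : shiftInvariantSpace (Set.range F) :=
    ⟨∑ p ∈ s, c p • l2Translate p (h k : L2R), Submodule.sum_mem _ fun p _ =>
      Submodule.smul_mem _ _ (l2Translate_int_mem (h k).2 p)⟩
  have hinner : ∀ i : Fin K × ℤ, inner ℂ (integerTranslates F i) g =
      ∑ p ∈ s, c p * if i.1 = k ∧ i.2 = p then 1 else 0 := fun i => by
    change inner ℂ (l2Translate (i.2 : ℝ) (F i.1)) (∑ p ∈ s, c p • l2Translate p (h k : L2R)) = _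
    rw [inner_sum]
    refine Finset.sum_congr rfl fun p _ => ?_
    rw [inner_smul_right, hfh.inner_l2Translate]
  have hle := hCq.norm_le hqq' hC (h := g) (s := {k} ×ˢ s) zero_le_one (fun i hi => ?_)
    fun i hi => ?_
  · simpa using hle
  · rw [hinner]
    refine Finset.sum_eq_zero fun p hp => ?_
    rw [if_neg, mul_zero]
    rintro ⟨h1, rfl⟩
    exact hi (Finset.mem_product.2 ⟨Finset.mem_singleton.2 h1, hp⟩)
  · obtain ⟨h1, h2⟩ := Finset.mem_product.1 hi
    rw [hinner, Finset.sum_eq_single_of_mem i.2 h2 fun p _ hp => by simp [hp.symm],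
      if_pos ⟨Finset.mem_singleton.1 h1, rfl⟩, mul_one]
    exact hc i.2

lemma measurableSet_periodicInterval (a δ : ℝ) : MeasurableSet (periodicInterval a δ) :=
  MeasurableSet.iUnion fun _ => measurableSet_Ioc

/-- Multiplying by a trigonometric sum of length `M` that peaks on the periodic interval turns the
`(C_q)` property into a bound for the dual generators. -/
lemma IsCqSystemWith.setLIntegral_periodicInterval_le
    (hCq : IsCqSystemWith q C (integerTranslates F)) (hqq' : ENNReal.HolderConjugate q q')
    (hC : 0 ≤ C) (hfh : TranslatesBiorthogonal F fun k => (h k : L2R)) {M : ℕ} (hM : 0 < M)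
    (k : Fin K) (a : ℝ) :
    ∫⁻ x in periodicInterval a (1 / (3 * M)), ‖fourierL2 (h k : L2R) x‖ₑ ^ 2 ≤
      ENNReal.ofReal (2 / M * (C * (M : ℝ) ^ (1 / q'.toReal))) ^ 2 := by
  have hM' : (0 : ℝ) < M := by exact_mod_cast hM
  set c : ℤ → ℂ := fun p => 𝐞 (p * (a + 1 / (6 * M)))
  set g : L2R := ∑ p ∈ Finset.Ico (0 : ℤ) M, c p • l2Translate p (h k : L2R)
  have hg : ‖g‖ ≤ C * (M : ℝ) ^ (1 / q'.toReal) := by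
    simpa using hCq.norm_sum_smul_l2Translate_le hqq' hC hfh k (Finset.Ico (0 : ℤ) M) (c := c)
      fun p => (Circle.norm_coe _).le
  have hpt : ∀ᵐ x, x ∈ periodicInterval a (1 / (3 * M)) →
      ‖fourierL2 (h k : L2R) x‖ₑ ^ 2 ≤ ENNReal.ofReal (2 / M) ^ 2 * ‖fourierL2 g x‖ₑ ^ 2 := by
    filter_upwards [coeFn_fourierL2_sum_smul_l2Translate (Finset.Ico (0 : ℤ) M) c (h k : L2R)]
      with x hx hxA
    have hsum : ∑ p ∈ Finset.Ico (0 : ℤ) M, c p * (𝐞 (-(p * x)) : ℂ) =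
        ∑ p ∈ Finset.Ico (0 : ℤ) M, (𝐞 (p * (a + 1 / (6 * M) - x)) : ℂ) :=
      Finset.sum_congr rfl fun p _ => by rw [← fourierChar_add, mul_sub, sub_eq_add_neg]
    rw [← mul_pow, ← ofReal_norm, ← ofReal_norm, ← ENNReal.ofReal_mul (by positivity), hx, hsum,
      norm_mul, ← mul_assoc]
    gcongr
    refine le_mul_of_one_le_left (norm_nonneg _) ?_
    rw [div_mul_eq_mul_div, one_le_div hM']
    linarith [div_two_le_norm_sum_fourierChar_of_mem_periodicInterval hM hxA]
  calc _ ≤ ∫⁻ x in periodicInterval a (1 / (3 * M)),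
          ENNReal.ofReal (2 / M) ^ 2 * ‖fourierL2 g x‖ₑ ^ 2 :=
        setLIntegral_mono_ae' (measurableSet_periodicInterval _ _) hpt
    _ ≤ ∫⁻ x, ENNReal.ofReal (2 / M) ^ 2 * ‖fourierL2 g x‖ₑ ^ 2 := setLIntegral_le_lintegral _ _
    _ = (ENNReal.ofReal (2 / M) * ENNReal.ofReal ‖g‖) ^ 2 := by
        rw [lintegral_const_mul' _ _ (ENNReal.pow_ne_top ENNReal.ofReal_ne_top),
          ← enorm_sq_eq_lintegral, fourierL2.enorm_map, mul_pow, ofReal_norm]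
    _ ≤ _ := by
        rw [← ENNReal.ofReal_mul (by positivity)]
        gcongr

end Dual

lemma setLIntegral_Ioc_tsum_enorm_sq {δ : ℝ} (hδ : δ ≤ 1) (a : ℝ) (w : L2R) :
    ∫⁻ x in Set.Ioc a (a + δ), ∑' n : ℤ, ‖w (x + n)‖ₑ ^ 2 =
      ∫⁻ x in periodicInterval a δ, ‖w x‖ₑ ^ 2 := by
  rw [← tsum_setLIntegral_Ioc hδ a fun x => ‖w x‖ₑ ^ 2]
  exact lintegral_tsum fun n => (((Lp.stronglyMeasurable w).measurable.comp
    (measurable_add_const _)).enorm.pow_const 2).aemeasurable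

lemma periodicInterval_fract (a δ : ℝ) :
    periodicInterval (Int.fract a) δ = periodicInterval a δ := by
  rw [periodicInterval, ← (Equiv.addLeft ⌊a⌋).surjective.iUnion_comp]
  refine Set.iUnion_congr fun n => ?_
  rw [Equiv.coe_addLeft, Int.cast_add, ← add_assoc, Int.fract_add_floor]

lemma eventually_setLIntegral_periodicInterval_le (w : L2R) {η : ℝ} (hη : 0 < η) :
    ∀ᶠ δ in 𝓝[>] (0 : ℝ), ∀ a,
      ∫⁻ x in periodicInterval a δ, ‖w x‖ₑ ^ 2 ≤ ENNReal.ofReal η ^ 2 := by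
  have hunit : ∀ a : ℝ, ∫⁻ x in Set.Ioc a (a + 1), ∑' n : ℤ, ‖w (x + n)‖ₑ ^ 2 ≠ ∞ := fun a => by
    rw [setLIntegral_Ioc_tsum_enorm_sq le_rfl]
    refine ne_top_of_le_ne_top ?_ (setLIntegral_le_lintegral _ _)
    rw [← enorm_sq_eq_lintegral]
    exact ENNReal.pow_ne_top enorm_ne_top
  have hfin : ∫⁻ x in Set.Ioc (0 : ℝ) 2, ∑' n : ℤ, ‖w (x + n)‖ₑ ^ 2 ≠ ∞ := by
    have h01 := hunit 0
    have h12 := hunit 1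
    rw [zero_add] at h01
    rw [one_add_one_eq_two] at h12
    rw [← Set.Ioc_union_Ioc_eq_Ioc zero_le_one one_le_two]
    exact ne_top_of_le_ne_top (ENNReal.add_ne_top.2 ⟨h01, h12⟩) (lintegral_union_le _ _ _)
  obtain ⟨d, hd, hsmall⟩ := exists_pos_setLIntegral_lt_of_measure_lt hfin
    (ε := ENNReal.ofReal η ^ 2) (pow_ne_zero _ (ENNReal.ofReal_pos.2 hη).ne')
  have hlim : Tendsto ENNReal.ofReal (𝓝[>] (0 : ℝ)) (𝓝 0) := by
    simpa using (ENNReal.continuous_ofReal.tendsto 0).mono_left nhdsWithin_le_nhds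
  filter_upwards [hlim.eventually_lt_const hd, Ioc_mem_nhdsGT one_pos] with δ hδd hδ a
  have hfract : Set.Ioc (Int.fract a) (Int.fract a + δ) ⊆ Set.Ioc 0 2 :=
    Set.Ioc_subset_Ioc (Int.fract_nonneg a) (by linarith [Int.fract_lt_one a, hδ.2])
  rw [← periodicInterval_fract, ← setLIntegral_Ioc_tsum_enorm_sq hδ.2]
  refine (le_of_eq ?_).trans (hsmall (Set.Ioc (Int.fract a) (Int.fract a + δ)) ?_).le
  · rw [Measure.restrict_restrict_of_subset hfract]
  · refine (Measure.restrict_apply_le _ _).trans_lt ?_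
    simpa using hδd

/-! ### Modulus of continuity from moments -/

lemma moment_eq (t : ℝ) (f : L2R) :
    moment t f = ∫⁻ x, ENNReal.ofReal (|x| ^ t) * ‖f x‖ₑ ^ 2 := by
  refine lintegral_congr fun x => ?_
  rw [ENNReal.ofReal_mul (by positivity), ENNReal.ofReal_pow (norm_nonneg _), ofReal_norm]

lemma moment_le_add_moment {s t : ℝ} (hs : 0 ≤ s) (hst : s ≤ t) (f : L2R) :
    moment s f ≤ ‖f‖ₑ ^ 2 + moment t f := by
  rw [moment_eq, moment_eq, enorm_sq_eq_lintegral,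
    ← lintegral_add_left' ((Lp.aestronglyMeasurable f).enorm.pow_const 2)]
  refine lintegral_mono fun x => ?_
  have hrpow : |x| ^ s ≤ 1 + |x| ^ t := by
    rcases le_total |x| 1 with hx | hx
    · linarith [Real.rpow_le_one (abs_nonneg x) hx hs, Real.rpow_nonneg (abs_nonneg x) t]
    · linarith [Real.rpow_le_rpow_of_exponent_le hx hst]
  calc _ ≤ ENNReal.ofReal (1 + |x| ^ t) * ‖f x‖ₑ ^ 2 := by gcongr
    _ = _ := by
        rw [ENNReal.ofReal_add zero_le_one (by positivity), ENNReal.ofReal_one, one_add_mul]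

lemma moment_eq_top_mono {s t : ℝ} (hs : 0 ≤ s) (hst : s ≤ t) {f : L2R} (h : moment s f = ∞) :
    moment t f = ∞ := by
  have hle := moment_le_add_moment hs hst f
  rw [h, top_le_iff, ENNReal.add_eq_top] at hle
  exact hle.resolve_left (ENNReal.pow_ne_top enorm_ne_top)

lemma enorm_l2Translate_fourierL2_sub_le_of_moment_two {f : L2R} (hf : moment 2 f ≠ ∞) (t : ℝ) :
    ‖l2Translate t (fourierL2 f) - fourierL2 f‖ₑ ≤
      ENNReal.ofReal (2 * π * √(moment 2 f).toReal * |t|) := by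
  rw [← ENNReal.pow_le_pow_left_iff two_ne_zero, enorm_sq_l2Translate_fourierL2_sub]
  calc ∫⁻ x, ‖(𝐞 (t * x) : ℂ) - 1‖ₑ ^ 2 * ‖f x‖ₑ ^ 2
      ≤ ∫⁻ x, ENNReal.ofReal ((2 * π * |t|) ^ 2) *
          (ENNReal.ofReal (|x| ^ (2 : ℝ)) * ‖f x‖ₑ ^ 2) := by
        refine lintegral_mono fun x => ?_
        rw [← mul_assoc, ← ENNReal.ofReal_mul (by positivity), Real.rpow_two,
          ← mul_pow (2 * π * |t|), ← ofReal_norm ((𝐞 (t * x) : ℂ) - 1),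
          ← ENNReal.ofReal_pow (norm_nonneg _)]
        gcongr
        refine (norm_fourierChar_sub_one_le _).trans_eq ?_
        rw [abs_mul, mul_assoc (2 * π)]
    _ = ENNReal.ofReal ((2 * π * |t|) ^ 2) * moment 2 f := by
        rw [lintegral_const_mul' _ _ ENNReal.ofReal_ne_top, moment_eq]
    _ = _ := by
        rw [← ENNReal.ofReal_toReal hf, ← ENNReal.ofReal_mul (by positivity),
          ← ENNReal.ofReal_pow (by positivity), ENNReal.toReal_ofReal ENNReal.toReal_nonneg,
          mul_right_comm (2 * π) (√_), mul_pow (2 * π * |t|) (√_),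
          Real.sq_sqrt ENNReal.toReal_nonneg]

lemma norm_fourierChar_sub_one_sq_le_rpow {s : ℝ} (hs0 : 0 ≤ s) (hs1 : s ≤ 1) (y : ℝ) :
    ‖(𝐞 y : ℂ) - 1‖ ^ 2 ≤ (2 * π) ^ 2 * |y| ^ (2 * s) := by
  rcases le_total |y| 1 with hy | hy
  · calc ‖(𝐞 y : ℂ) - 1‖ ^ 2 ≤ (2 * π * |y|) ^ 2 := by gcongr; exact norm_fourierChar_sub_one_le _
      _ = (2 * π) ^ 2 * |y| ^ (2 : ℝ) := by rw [mul_pow, Real.rpow_two]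
      _ ≤ _ := by
        refine mul_le_mul_of_nonneg_left ?_ (by positivity)
        exact Real.rpow_le_rpow_of_exponent_ge' (abs_nonneg y) hy (by positivity) (by linarith)
  · calc ‖(𝐞 y : ℂ) - 1‖ ^ 2 ≤ 2 ^ 2 := by gcongr; exact norm_fourierChar_sub_one_le_two _
      _ ≤ (2 * π) ^ 2 * 1 := by nlinarith [pi_gt_three]
      _ ≤ _ := by
        gcongr
        exact Real.one_le_rpow hy (by positivity)

lemma tendsto_norm_fourierChar_sub_one_sq_div_rpow {s : ℝ} (hs1 : s < 1) (x : ℝ) :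
    Tendsto (fun t : ℝ => ‖(𝐞 (t * x) : ℂ) - 1‖ ^ 2 / |t| ^ (2 * s)) (𝓝[≠] 0) (𝓝 0) := by
  have hlim : Tendsto (fun t : ℝ => (2 * π * |x|) ^ 2 * |t| ^ (2 - 2 * s)) (𝓝[≠] 0) (𝓝 0) := by
    have hcont : Continuous fun t : ℝ => (2 * π * |x|) ^ 2 * |t| ^ (2 - 2 * s) :=
      continuous_const.mul (continuous_abs.rpow_const fun t => Or.inr (by linarith))
    have h0 := hcont.tendsto 0
    rw [abs_zero, Real.zero_rpow (by linarith), mul_zero] at h0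
    exact h0.mono_left nhdsWithin_le_nhds
  refine squeeze_zero' (Eventually.of_forall fun t => by positivity) ?_ hlim
  filter_upwards [self_mem_nhdsWithin] with t ht
  rw [Real.rpow_sub (abs_pos.2 ht), Real.rpow_two, ← mul_div_assoc, ← mul_pow]
  gcongr
  refine (norm_fourierChar_sub_one_le _).trans_eq ?_
  rw [abs_mul]
  ring

lemma tendsto_lintegral_fourierChar_sub_one_div_rpow {s : ℝ} (hs0 : 0 ≤ s) (hs1 : s < 1) {f : L2R}
    (hf : moment (2 * s) f ≠ ∞) :
    Tendsto (fun t : ℝ => ∫⁻ x,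
      ENNReal.ofReal (‖(𝐞 (t * x) : ℂ) - 1‖ ^ 2 / |t| ^ (2 * s)) * ‖f x‖ₑ ^ 2) (𝓝[≠] 0) (𝓝 0) := by
  have hlim : Tendsto (fun t : ℝ => ∫⁻ x,
      ENNReal.ofReal (‖(𝐞 (t * x) : ℂ) - 1‖ ^ 2 / |t| ^ (2 * s)) * ‖f x‖ₑ ^ 2) (𝓝[≠] 0)
      (𝓝 (∫⁻ _x : ℝ, 0)) := by
    refine tendsto_lintegral_filter_of_dominated_convergence
      (fun x => ENNReal.ofReal ((2 * π) ^ 2) * (ENNReal.ofReal (|x| ^ (2 * s)) * ‖f x‖ₑ ^ 2))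
      (Eventually.of_forall fun t => ?_) ?_ ?_ (Eventually.of_forall fun x => ?_)
    · have : Measurable fun x : ℝ => (𝐞 (t * x) : ℂ) := by fun_prop
      exact ((((this.sub_const 1).norm.pow_const 2).div_const _).ennreal_ofReal).mul
        ((Lp.stronglyMeasurable f).measurable.enorm.pow_const 2)
    · filter_upwards [self_mem_nhdsWithin] with t ht
      have ht0 : 0 < |t| := abs_pos.2 ht
      refine Eventually.of_forall fun x => ?_
      rw [← mul_assoc, ← ENNReal.ofReal_mul (by positivity)]
      gcongr
      rw [div_le_iff₀ (by positivity), mul_assoc, ← Real.mul_rpow (abs_nonneg _) (abs_nonneg _),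
        ← abs_mul, mul_comm x t]
      exact norm_fourierChar_sub_one_sq_le_rpow hs0 hs1.le _
    · rw [lintegral_const_mul' _ _ ENNReal.ofReal_ne_top, ← moment_eq]
      exact ENNReal.mul_ne_top ENNReal.ofReal_ne_top hf
    · have hpt := ENNReal.tendsto_ofReal (tendsto_norm_fourierChar_sub_one_sq_div_rpow hs1 x)
      simpa using ENNReal.Tendsto.mul_const hpt (b := ‖f x‖ₑ ^ 2)
        (Or.inr (ENNReal.pow_ne_top enorm_ne_top))
  rwa [lintegral_zero] at hlim

lemma eventually_enorm_l2Translate_fourierL2_sub_le {s : ℝ} (hs0 : 0 ≤ s) (hs1 : s < 1) {f : L2R}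
    (hf : moment (2 * s) f ≠ ∞) {η : ℝ} (hη : 0 < η) : ∀ᶠ t in 𝓝 (0 : ℝ),
      ‖l2Translate t (fourierL2 f) - fourierL2 f‖ₑ ≤ ENNReal.ofReal (η * |t| ^ s) := by
  have hev := (tendsto_lintegral_fourierChar_sub_one_div_rpow hs0 hs1 hf).eventually_le_const
    (ENNReal.ofReal_pos.2 (by positivity : 0 < η ^ 2))
  filter_upwards [eventually_nhdsWithin_iff.1 hev] with t ht
  rcases eq_or_ne t 0 with rfl | ht0
  · simp [l2Translate_zero]
  have ht1 : 0 < |t| := abs_pos.2 ht0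
  have hscale : ∀ x, ‖(𝐞 (t * x) : ℂ) - 1‖ₑ ^ 2 * ‖f x‖ₑ ^ 2 = ENNReal.ofReal (|t| ^ (2 * s)) *
      (ENNReal.ofReal (‖(𝐞 (t * x) : ℂ) - 1‖ ^ 2 / |t| ^ (2 * s)) * ‖f x‖ₑ ^ 2) := fun x => by
    rw [← mul_assoc, ← ENNReal.ofReal_mul (by positivity), mul_div_cancel₀ _ (by positivity),
      ENNReal.ofReal_pow (norm_nonneg _), ofReal_norm]
  rw [← ENNReal.pow_le_pow_left_iff two_ne_zero, enorm_sq_l2Translate_fourierL2_sub]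
  calc ∫⁻ x, ‖(𝐞 (t * x) : ℂ) - 1‖ₑ ^ 2 * ‖f x‖ₑ ^ 2
      ≤ ENNReal.ofReal (|t| ^ (2 * s)) * ENNReal.ofReal (η ^ 2) := by
        simp only [hscale]
        rw [lintegral_const_mul' _ _ ENNReal.ofReal_ne_top]
        gcongr
        exact ht ht0
    _ = _ := by
        rw [← ENNReal.ofReal_mul (by positivity), ← ENNReal.ofReal_pow (by positivity), mul_pow,
          ← Real.rpow_mul_natCast ht1.le, Nat.cast_two, mul_comm s, mul_comm]

/-! ### The uncertainty principle -/

lemma exists_isFrequencyBound_of_moment_two {κ : Type*} [Finite κ] {f : κ → L2R}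
    (hf : ∀ k, moment 2 (f k) ≠ ∞) (h : κ → L2R) {ε : ℝ} (hε : 0 < ε) :
    ∃ δ Ω W : ℝ, 0 < δ ∧ δ ≤ 1 ∧ IsFrequencyBound f h δ Ω W ∧ Ω * W ≤ ε * δ := by
  obtain ⟨b, hb⟩ := Finite.exists_le fun k => 2 * π * √(moment 2 (f k)).toReal
  set B := max b 1
  have hB : 0 < B := zero_lt_one.trans_le (le_max_right _ _)
  have hW := eventually_all.2 fun k =>
    eventually_setLIntegral_periodicInterval_le (fourierL2 (h k)) (div_pos hε hB)
  obtain ⟨δ, hδW, hδ0, hδ1⟩ := (hW.and (Ioc_mem_nhdsGT one_pos)).exists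
  refine ⟨δ, B * δ, ε / B, hδ0, hδ1, ⟨by positivity, fun k t ht => ?_, hδW⟩,
    le_of_eq (by field_simp)⟩
  refine (enorm_l2Translate_fourierL2_sub_le_of_moment_two (hf k) t).trans ?_
  gcongr
  exact (hb k).trans (le_max_left _ _)

lemma tendsto_one_div_three_mul_nhdsGT_zero :
    Tendsto (fun M : ℕ => 1 / (3 * M : ℝ)) atTop (𝓝[>] 0) := by
  refine tendsto_nhdsWithin_iff.2 ⟨?_, ?_⟩
  · exact (tendsto_natCast_atTop_atTop.const_mul_atTop three_pos).const_div_atTop 1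
  · filter_upwards [eventually_gt_atTop 0] with M hM
    have : (0 : ℝ) < M := by exact_mod_cast hM
    exact Set.mem_Ioi.2 (by positivity)

lemma eventually_forall_abs_le {p : ℝ → Prop} (h : ∀ᶠ t in 𝓝 (0 : ℝ), p t) :
    ∀ᶠ δ in 𝓝[>] (0 : ℝ), ∀ t, |t| ≤ δ → p t := by
  obtain ⟨d, hd, hp⟩ := Metric.eventually_nhds_iff.1 h
  filter_upwards [Ioo_mem_nhdsGT hd] with δ hδ t ht
  exact hp (by simpa using ht.trans_lt hδ.2)

lemma IsCqSystemWith.exists_isFrequencyBound {q q' : ℝ≥0∞} (hqq' : ENNReal.HolderConjugate q q')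
    (hq' : 1 / q'.toReal < 1) {K : ℕ} {F : Fin K → L2R} {C : ℝ} (hC : 0 < C)
    (hCq : IsCqSystemWith q C (integerTranslates F)) {h : Fin K → shiftInvariantSpace (Set.range F)}
    (hfh : TranslatesBiorthogonal F fun k => (h k : L2R))
    (hF : ∀ k, moment (2 * (1 / q'.toReal)) (F k) ≠ ∞) {ε : ℝ} (hε : 0 < ε) :
    ∃ δ Ω W : ℝ, 0 < δ ∧ δ ≤ 1 ∧ IsFrequencyBound F (fun k => (h k : L2R)) δ Ω W ∧
      Ω * W ≤ ε * δ := by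
  set s := 1 / q'.toReal
  have hs0 : 0 ≤ s := one_div_nonneg.2 ENNReal.toReal_nonneg
  set η := ε / (6 * C) with hη
  have hη0 : 0 < η := by positivity
  have hΩ := eventually_all.2 fun k => eventually_forall_abs_le
    (eventually_enorm_l2Translate_fourierL2_sub_le hs0 hq' (hF k) hη0)
  obtain ⟨M, hMΩ, hM⟩ :=
    ((tendsto_one_div_three_mul_nhdsGT_zero.eventually hΩ).and (eventually_gt_atTop 0)).exists
  have hM' : (1 : ℝ) ≤ M := by exact_mod_cast hM
  have hrpow : (1 / (3 * M) : ℝ) ^ s * (M : ℝ) ^ s ≤ 1 := by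
    rw [← Real.mul_rpow (by positivity) (by positivity)]
    refine Real.rpow_le_one (by positivity) ?_ hs0
    rw [one_div_mul_eq_div, div_le_one (by positivity)]
    linarith
  refine ⟨1 / (3 * M), η * (1 / (3 * M)) ^ s, 2 / M * (C * (M : ℝ) ^ s), by positivity, ?_,
    ⟨by positivity, fun k t ht => (hMΩ k t ht).trans (by gcongr),
      hCq.setLIntegral_periodicInterval_le hqq' hC.le hfh hM⟩, ?_⟩
  · rw [div_le_one (by positivity)]
    linarith
  · calc η * (1 / (3 * M)) ^ s * (2 / M * (C * (M : ℝ) ^ s))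
        = 2 * η * C * (1 / M) * ((1 / (3 * M) : ℝ) ^ s * (M : ℝ) ^ s) := by ring
      _ ≤ 2 * η * C * (1 / M) * 1 := by gcongr
      _ = ε * (1 / (3 * M)) := by rw [hη]; field_simp; norm_num

theorem exists_moment_eq_top {q q' : ℝ≥0∞} (hqq' : ENNReal.HolderConjugate q q')
    {K : ℕ} {F : Fin K → L2R}
    (hV : HasNontrivialExtraInvariance (shiftInvariantSpace (Set.range F)))
    (hF : IsExactCqSystem q (integerTranslates F)) :
    ∃ k : Fin K, moment (2 / q'.toReal) (F k) = ∞ := by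
  by_contra! hcon
  obtain ⟨⟨-, hmin⟩, C, hC, hCq⟩ := hF
  obtain ⟨h, hfh⟩ := exists_translatesBiorthogonal hmin
  obtain ⟨N, hN, hNK, hinv⟩ := hV.exists_one_div_mem hfh
  obtain ⟨c, hc, huncertainty⟩ := hfh.exists_mul_le hN hNK hinv
  have hs := one_div_toReal_of_holderConjugate hqq'
  obtain ⟨δ, Ω, W, hδ0, hδ1, hbound, hle⟩ : ∃ δ Ω W : ℝ, 0 < δ ∧ δ ≤ 1 ∧
      IsFrequencyBound F (fun k => (h k : L2R)) δ Ω W ∧ Ω * W ≤ c / 2 * δ := by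
    rw [← mul_one_div] at hcon
    rcases eq_or_ne q ∞ with rfl | hq
    · rw [hs] at hcon
      exact exists_isFrequencyBound_of_moment_two (by simpa using hcon) _ (half_pos hc)
    · have hq0 : 0 < q.toReal := ENNReal.toReal_pos (ENNReal.HolderConjugate.ne_zero q q') hq
      exact IsCqSystemWith.exists_isFrequencyBound hqq'
        (by rw [hs]; linarith [one_div_pos.2 hq0]) hC hCq hfh hcon (half_pos hc)
  have := huncertainty δ Ω W hδ0 hδ1 hbound
  linarith [mul_pos hc hδ0]

/-! ### The `ℓ^q` norm of Fourier coefficients -/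

section LqNorm

variable {ι : Type*}

lemma lqNorm_zero (q : ℝ≥0∞) : lqNorm q (0 : ι →₀ ℂ) = 0 :=
  lp.norm_zero (E := fun _ : ι => ℂ) (p := q)

lemma lqNorm_add_le {q : ℝ≥0∞} (hq : 1 ≤ q) (a b : ι →₀ ℂ) :
    lqNorm q (a + b) ≤ lqNorm q a + lqNorm q b := by
  have : Fact (1 ≤ q) := ⟨hq⟩
  exact norm_add_le (E := lp (fun _ : ι => ℂ) q) ⟨_, _⟩ ⟨_, _⟩

lemma lqNorm_sum_le {q : ℝ≥0∞} (hq : 1 ≤ q) {κ : Type*} (s : Finset κ) (a : κ → ι →₀ ℂ) :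
    lqNorm q (∑ i ∈ s, a i) ≤ ∑ i ∈ s, lqNorm q (a i) :=
  Finset.le_sum_of_subadditive _ (lqNorm_zero q).le (lqNorm_add_le hq) s a

lemma lqNorm_le_of_norm_le_of_sum_sq_le {q : ℝ≥0∞} (hq : 2 ≤ q) (a : ι →₀ ℂ) {b c : ℝ}
    (hb : 0 ≤ b) (hc : 0 ≤ c) (hab : ∀ i, ‖a i‖ ≤ b)
    (hac : ∀ s : Finset ι, ∑ i ∈ s, ‖a i‖ ^ 2 ≤ c ^ 2) :
    lqNorm q a ≤ b ^ (1 - 2 / q.toReal) * c ^ (2 / q.toReal) := by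
  rcases eq_or_ne q ∞ with rfl | hqt
  · rw [ENNReal.toReal_top, div_zero, sub_zero, Real.rpow_one, Real.rpow_zero, mul_one]
    exact lp.norm_le_of_forall_le hb hab
  have hq2 : 2 ≤ q.toReal := by simpa using ENNReal.toReal_mono hqt hq
  have hq0 : 0 < q.toReal := by linarith
  refine lp.norm_le_of_forall_sum_le hq0 (by positivity) fun s => ?_
  have hsplit : ∀ y : ℝ, 0 ≤ y → y ^ q.toReal = y ^ (q.toReal - 2) * y ^ 2 := fun y hy => by
    rw [← Real.rpow_natCast, ← Real.rpow_add_of_nonneg hy (by linarith) (by norm_num)]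
    congr 1
    push_cast
    ring
  calc ∑ i ∈ s, ‖a i‖ ^ q.toReal ≤ ∑ i ∈ s, b ^ (q.toReal - 2) * ‖a i‖ ^ 2 := by
        refine Finset.sum_le_sum fun i _ => ?_
        rw [hsplit _ (norm_nonneg _)]
        exact mul_le_mul_of_nonneg_right
          (Real.rpow_le_rpow (norm_nonneg _) (hab i) (by linarith)) (by positivity)
    _ = b ^ (q.toReal - 2) * ∑ i ∈ s, ‖a i‖ ^ 2 := by rw [Finset.mul_sum]
    _ ≤ b ^ (q.toReal - 2) * c ^ 2 := by gcongr; exact hac s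
    _ = _ := by
        rw [Real.mul_rpow (by positivity) (by positivity), ← Real.rpow_mul hb, ← Real.rpow_mul hc,
          sub_mul, one_mul, div_mul_cancel₀ _ hq0.ne', Real.rpow_two]

end LqNorm

section AddCircle

open AddCircle

variable {T : ℝ} [Fact (0 < T)]

lemma sum_sq_norm_fourierCoeff_le (U : Lp ℂ 2 (haarAddCircle (T := T))) (s : Finset ℤ) :
    ∑ n ∈ s, ‖fourierCoeff U n‖ ^ 2 ≤ ‖U‖ ^ 2 := by
  refine le_trans (Finset.sum_le_sum fun n _ => ?_)
    ((orthonormal_fourier (T := T)).sum_inner_products_le U)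
  rw [← fourierBasis_repr, HilbertBasis.repr_apply_apply, coe_fourierBasis]

lemma norm_fourierCoeff_le {U : AddCircle T → ℂ} (hU : MemLp U 1 haarAddCircle) (n : ℤ) :
    ‖fourierCoeff U n‖ ≤ (eLpNorm U 1 haarAddCircle).toReal := by
  rw [← toReal_enorm, eLpNorm_one_eq_lintegral_enorm]
  refine ENNReal.toReal_mono (eLpNorm_one_eq_lintegral_enorm (f := U) ▸ hU.2.ne)
    ((enorm_integral_le_lintegral_enorm _).trans (lintegral_mono fun x => ?_))
  rw [enorm_smul, ← ofReal_norm (fourier (-n) x), fourier_apply, Circle.norm_coe,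
    ENNReal.ofReal_one, one_mul]

lemma lqNorm_le_of_norm_le_norm_fourierCoeff {ι : Type*} {q : ℝ≥0∞} (hq : 2 ≤ q)
    (U : Lp ℂ 2 (haarAddCircle (T := T))) {a : ι →₀ ℂ} {σ : ι → ℤ} (hσ : Function.Injective σ)
    (ha : ∀ i, ‖a i‖ ≤ ‖fourierCoeff U (σ i)‖) :
    lqNorm q a ≤
      (eLpNorm U 1 haarAddCircle).toReal ^ (1 - 2 / q.toReal) * ‖U‖ ^ (2 / q.toReal) := by
  refine lqNorm_le_of_norm_le_of_sum_sq_le hq a ENNReal.toReal_nonneg (norm_nonneg _)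
    (fun i => (ha i).trans
      (norm_fourierCoeff_le ((Lp.memLp U).mono_exponent one_le_two) _)) fun s => ?_
  calc ∑ i ∈ s, ‖a i‖ ^ 2 ≤ ∑ i ∈ s, ‖fourierCoeff U (σ i)‖ ^ 2 := by
        gcongr with i
        exact ha i
    _ = ∑ n ∈ s.map ⟨σ, hσ⟩, ‖fourierCoeff U n‖ ^ 2 := by
        rw [Finset.sum_map, Function.Embedding.coeFn_mk]
    _ ≤ _ := sum_sq_norm_fourierCoeff_le U _

end AddCircle

lemma measurePreserving_addCircle_mk : MeasurePreserving ((↑) : ℝ → AddCircle (1 : ℝ))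
    (volume.restrict (Set.Ioc 0 1)) AddCircle.haarAddCircle := by
  have h := AddCircle.measurePreserving_mk (1 : ℝ) 0
  rwa [zero_add, AddCircle.volume_eq_smul_haarAddCircle, ENNReal.ofReal_one, one_smul] at h

lemma exists_addCircle_ae_eq {m : ℝ → ℂ} (hm : MemLp m 2 (volume.restrict (Set.Ioc 0 1))) :
    ∃ U : Lp ℂ 2 (AddCircle.haarAddCircle (T := 1)),
      (fun x : ℝ => U (x : AddCircle (1 : ℝ))) =ᵐ[volume.restrict (Set.Ioc 0 1)] m := by
  have hlift : MemLp (AddCircle.liftIoc 1 0 m) 2 (AddCircle.haarAddCircle (T := 1)) := by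
    rw [memLp_haarAddCircle_iff]
    refine MemLp.memLp_liftIoc ?_
    rwa [zero_add]
  refine ⟨hlift.toLp _, ?_⟩
  filter_upwards [measurePreserving_addCircle_mk.quasiMeasurePreserving.ae hlift.coeFn_toLp,
    ae_restrict_mem measurableSet_Ioc] with x hx hmem
  rw [hx, AddCircle.liftIoc_coe_apply (by rwa [zero_add])]

lemma eLpNorm_comp_addCircle_mk (p : ℝ≥0∞) {U : AddCircle (1 : ℝ) → ℂ}
    (hU : AEStronglyMeasurable U AddCircle.haarAddCircle) :
    eLpNorm (fun x : ℝ => U x) p (volume.restrict (Set.Ioc 0 1)) =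
      eLpNorm U p AddCircle.haarAddCircle :=
  eLpNorm_comp_measurePreserving hU measurePreserving_addCircle_mk

lemma exists_addCircle_ae_eq_eLpNorm_le {m : ℝ → ℂ} (hm : MemLp m 2 volume) {B : Set ℝ}
    (hB : B ⊆ Set.Ioc 0 1) (hmB : ∀ x ∉ B, m x = 0) :
    ∃ U : Lp ℂ 2 (AddCircle.haarAddCircle (T := 1)),
      (fun x : ℝ => U (x : AddCircle (1 : ℝ))) =ᵐ[volume.restrict (Set.Ioc 0 1)] m ∧
      ‖U‖ ≤ (eLpNorm m 2 volume).toReal ∧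
      (eLpNorm U 1 AddCircle.haarAddCircle).toReal ≤
        volume.real B ^ (1 / 2 : ℝ) * (eLpNorm m 2 volume).toReal := by
  obtain ⟨U, hU⟩ := exists_addCircle_ae_eq (hm.restrict _)
  have hnorm : ∀ p, eLpNorm U p AddCircle.haarAddCircle = eLpNorm m p volume := fun p => by
    rw [← eLpNorm_comp_addCircle_mk p (Lp.aestronglyMeasurable U), eLpNorm_congr_ae hU]
    exact eLpNorm_restrict_eq_of_support_subset fun x hx => hB (not_imp_comm.1 (hmB x) hx)
  refine ⟨U, hU, by rw [Lp.norm_def, hnorm], ?_⟩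
  have hvol : volume B ≠ ∞ := ((measure_mono hB).trans_lt measure_Ioc_lt_top).ne
  have hholder := eLpNorm_le_eLpNorm_mul_rpow_measure_univ (μ := volume.restrict B) (p := 1)
    (q := 2) one_le_two hm.1.restrict
  have hsupp : Function.support m ⊆ B := fun x hx => not_imp_comm.1 (hmB x) hx
  rw [eLpNorm_restrict_eq_of_support_subset hsupp, eLpNorm_restrict_eq_of_support_subset hsupp,
    Measure.restrict_apply_univ, ENNReal.toReal_one, ENNReal.toReal_ofNat,
    show (1 / 1 - 1 / 2 : ℝ) = 1 / 2 by norm_num] at hholder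
  rw [hnorm, mul_comm, measureReal_def, ENNReal.toReal_rpow, ← ENNReal.toReal_mul]
  exact ENNReal.toReal_mono (by finiteness) hholder

/-! ### Approximation by integer translates of a band-limited function -/

/-- The finitely supported coefficient sequence `∑_{n ∈ s} c(n) δ_(0, n)` for the translates of a
family consisting of a single function. -/
noncomputable def singleCoeff (s : Finset ℤ) (c : ℤ → ℂ) : Fin 1 × ℤ →₀ ℂ :=
  ∑ n ∈ s, Finsupp.single (0, n) (c n)

lemma singleCoeff_apply (s : Finset ℤ) (c : ℤ → ℂ) (i : Fin 1 × ℤ) :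
    singleCoeff s c i = if i.2 ∈ s then c i.2 else 0 := by
  obtain ⟨k, n⟩ := i
  obtain rfl : k = 0 := Subsingleton.elim _ _
  simp only [singleCoeff, Finsupp.finsetSum_apply, Finsupp.single_apply, Prod.mk.injEq, true_and,
    Finset.sum_ite_eq']

lemma linearCombination_singleCoeff (f : L2R) (s : Finset ℤ) (c : ℤ → ℂ) :
    Finsupp.linearCombination ℂ (fun i : Fin 1 × ℤ => l2Translate i.2 f) (singleCoeff s c) =
      ∑ n ∈ s, c n • l2Translate n f := by
  simp only [singleCoeff, map_sum, Finsupp.linearCombination_single]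

lemma coeFn_sum_smul_fourierLp (s : Finset ℤ) (c : ℤ → ℂ) :
    (fun x : ℝ => (∑ n ∈ s, c n • fourierLp (T := 1) 2 (-n) : Lp ℂ 2 _) (x : AddCircle (1 : ℝ)))
      =ᵐ[volume.restrict (Set.Ioc 0 1)] fun x => ∑ n ∈ s, c n * 𝐞 (-(n * x)) := by
  have hmk := measurePreserving_addCircle_mk.quasiMeasurePreserving
  filter_upwards [hmk.ae (Lp.coeFn_finsetSum s fun n => c n • fourierLp (T := 1) 2 (-n)),
    hmk.ae (ae_all_iff.2 fun n => Lp.coeFn_smul (c n) (fourierLp (T := 1) 2 (-n))),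
    hmk.ae (ae_all_iff.2 fun n => coeFn_fourierLp (T := 1) 2 (-n))] with x hsum hsmul hfourier
  rw [hsum, Finset.sum_apply]
  refine Finset.sum_congr rfl fun n _ => ?_
  rw [hsmul, Pi.smul_apply, hfourier, smul_eq_mul, fourier_coe_eq_fourierChar, Int.cast_neg,
    neg_mul]

section BandLimited

variable {f : L2R}

lemma enorm_le_eLpNorm_of_fourierL2_eq_mul
    (hf : ∀ᵐ x, ‖fourierL2 f x‖ ≤ (Set.Ioc (0 : ℝ) 1).indicator 1 x) {G : L2R} {m : ℝ → ℂ}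
    (hG : fourierL2 G =ᵐ[volume] fun x => m x * fourierL2 f x) :
    ‖G‖ₑ ≤ eLpNorm m 2 (volume.restrict (Set.Ioc 0 1)) := by
  rw [← fourierL2.enorm_map, Lp.enorm_def,
    ← eLpNorm_indicator_eq_eLpNorm_restrict measurableSet_Ioc]
  refine eLpNorm_mono_ae ?_
  filter_upwards [hf, hG] with x hfx hGx
  rw [hGx, norm_mul, Set.indicator_apply]
  by_cases hx : x ∈ Set.Ioc (0 : ℝ) 1
  · rw [Set.indicator_of_mem hx] at hfx
    rw [if_pos hx]
    exact mul_le_of_le_one_right (norm_nonneg _) hfx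
  · rw [Set.indicator_of_notMem hx] at hfx
    rw [if_neg hx, norm_le_zero_iff.1 hfx, norm_zero, mul_zero]

lemma exists_norm_sub_linearCombination_lt
    (hf : ∀ᵐ x, ‖fourierL2 f x‖ ≤ (Set.Ioc (0 : ℝ) 1).indicator 1 x) {q : ℝ≥0∞} (hq : 2 ≤ q)
    {U : Lp ℂ 2 (AddCircle.haarAddCircle (T := 1))} {m : ℝ → ℂ}
    (hU : (fun x : ℝ => U (x : AddCircle (1 : ℝ))) =ᵐ[volume.restrict (Set.Ioc 0 1)] m) {H : L2R}
    (hH : fourierL2 H =ᵐ[volume] fun x => m x * fourierL2 f x) {ε : ℝ} (hε : 0 < ε) :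
    ∃ a : Fin 1 × ℤ →₀ ℂ,
      lqNorm q a ≤ (eLpNorm U 1 AddCircle.haarAddCircle).toReal ^ (1 - 2 / q.toReal) *
        ‖U‖ ^ (2 / q.toReal) ∧
      ‖H - Finsupp.linearCombination ℂ (fun i : Fin 1 × ℤ => l2Translate i.2 f) a‖ < ε := by
  have hseries := (Equiv.neg ℤ).hasSum_iff.2 (hasSum_fourier_series_L2 U)
  obtain ⟨s, hs⟩ := (Metric.tendsto_atTop.1 hseries) ε hε
  set c : ℤ → ℂ := fun n => fourierCoeff U (-n)
  set P : Lp ℂ 2 (AddCircle.haarAddCircle (T := 1)) := ∑ n ∈ s, c n • fourierLp 2 (-n)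
  have hUP : ‖U - P‖ < ε := by
    rw [← dist_eq_norm, dist_comm]
    exact hs s le_rfl
  refine ⟨singleCoeff s c, lqNorm_le_of_norm_le_norm_fourierCoeff hq U (σ := fun i => -i.2)
    (fun i j hij => Prod.ext (Subsingleton.elim _ _) (neg_injective hij)) fun i => ?_, ?_⟩
  · rw [singleCoeff_apply]
    split_ifs
    · exact le_rfl
    · exact norm_zero.trans_le (norm_nonneg _)
  rw [linearCombination_singleCoeff, ← ENNReal.ofReal_lt_ofReal_iff hε, ofReal_norm]
  rw [← ENNReal.ofReal_lt_ofReal_iff hε, ofReal_norm] at hUP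
  refine lt_of_le_of_lt ?_ hUP
  calc _ ≤ eLpNorm (fun x => m x - ∑ n ∈ s, c n * 𝐞 (-(n * x))) 2
        (volume.restrict (Set.Ioc 0 1)) := by
        refine enorm_le_eLpNorm_of_fourierL2_eq_mul hf ?_
        rw [map_sub]
        filter_upwards [hH, coeFn_fourierL2_sum_smul_l2Translate s c f,
          Lp.coeFn_sub (fourierL2 H) (fourierL2 (∑ n ∈ s, c n • l2Translate n f))]
          with x hHx hsum hsub
        rw [hsub, Pi.sub_apply, hHx, hsum, sub_mul]
    _ = eLpNorm (fun x : ℝ => (U - P) (x : AddCircle (1 : ℝ))) 2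
        (volume.restrict (Set.Ioc 0 1)) := by
        refine eLpNorm_congr_ae ?_
        filter_upwards [hU, coeFn_sum_smul_fourierLp s c,
          measurePreserving_addCircle_mk.quasiMeasurePreserving.ae (Lp.coeFn_sub U P)]
          with x hUx hPx hsub
        rw [hsub, Pi.sub_apply, hUx, hPx]
    _ = ‖U - P‖ₑ := by
        rw [eLpNorm_comp_addCircle_mk 2 (Lp.aestronglyMeasurable _), Lp.enorm_def]

end BandLimited

/-! ### A criterion for `(C_q)`-systems of integer translates -/

lemma two_div_toReal_le_one {q : ℝ≥0∞} (hq : 2 ≤ q) : 2 / q.toReal ≤ 1 := by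
  rcases eq_or_ne q ∞ with rfl | hqt
  · rw [ENNReal.toReal_top, div_zero]
    exact zero_le_one
  · exact div_le_one_of_le₀ (by simpa using ENNReal.toReal_mono hqt hq) ENNReal.toReal_nonneg

section Indicator

variable {X κ : Type*} [MeasurableSpace X] {μ : Measure X} (h : Lp ℂ 2 μ) {B : κ → Set X}

lemma enorm_sq_sum_toLp_indicator_sub (hB : ∀ i, MeasurableSet (B i))
    (hd : Pairwise (Function.onFun Disjoint B)) (s : Finset κ) :
    ‖∑ i ∈ s, ((Lp.memLp h).indicator (hB i)).toLp _ - h‖ₑ ^ 2 =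
      ∫⁻ x, (⋃ i ∈ s, B i)ᶜ.indicator (fun x => ‖h x‖ₑ ^ 2) x ∂μ := by
  rw [enorm_sq_eq_lintegral]
  refine lintegral_congr_ae ?_
  have hind := (ae_ball_iff s.countable_toSet).2 fun i _ =>
    ((Lp.memLp h).indicator (hB i)).coeFn_toLp
  filter_upwards [Lp.coeFn_sub (∑ i ∈ s, ((Lp.memLp h).indicator (hB i)).toLp _) h,
    Lp.coeFn_finsetSum s fun i => ((Lp.memLp h).indicator (hB i)).toLp _, hind]
    with x hsub hsum hind
  have hunion : ∑ i ∈ s, (B i).indicator h x = (⋃ i ∈ s, B i).indicator h x :=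
    (Finset.indicator_biUnion_apply s B (fun i _ j _ hij => hd hij) x).symm
  rw [hsub, Pi.sub_apply, hsum, Finset.sum_apply, Finset.sum_congr rfl hind, hunion]
  by_cases hx : x ∈ ⋃ i ∈ s, B i
  · rw [Set.indicator_of_mem hx, Set.indicator_of_notMem (Set.notMem_compl_iff.2 hx), sub_self,
      enorm_zero, zero_pow two_ne_zero]
  · rw [Set.indicator_of_notMem hx, Set.indicator_of_mem (Set.mem_compl hx), zero_sub, enorm_neg]

lemma hasSum_toLp_indicator [Countable κ] (hB : ∀ i, MeasurableSet (B i))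
    (hd : Pairwise (Function.onFun Disjoint B)) (hcov : ∀ᵐ x ∂μ, h x ≠ 0 → ∃ i, x ∈ B i) :
    HasSum (fun i => ((Lp.memLp h).indicator (hB i)).toLp _) h := by
  have hmeas : AEMeasurable (fun x => ‖h x‖ₑ ^ 2) μ :=
    (Lp.aestronglyMeasurable h).enorm.pow_const 2
  have hlim : Tendsto (fun s : Finset κ => ∫⁻ x, (⋃ i ∈ s, B i)ᶜ.indicator
      (fun x => ‖h x‖ₑ ^ 2) x ∂μ) atTop (𝓝 (∫⁻ _, 0 ∂μ)) := by
    refine tendsto_lintegral_filter_of_dominated_convergence' (fun x => ‖h x‖ₑ ^ 2)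
      (Eventually.of_forall fun s =>
        hmeas.indicator (s.measurableSet_biUnion fun i _ => hB i).compl)
      (Eventually.of_forall fun s => Eventually.of_forall fun x =>
        Set.indicator_le_self _ _ x) ?_ ?_
    · rw [← enorm_sq_eq_lintegral]
      finiteness
    · filter_upwards [hcov] with x hx
      refine tendsto_const_nhds.congr' ?_
      rcases eq_or_ne (h x) 0 with h0 | h0
      · refine Eventually.of_forall fun s => (Set.indicator_apply_eq_zero.2 fun _ => ?_).symm
        rw [h0, enorm_zero, zero_pow two_ne_zero]
      · obtain ⟨i, hi⟩ := hx h0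
        filter_upwards [eventually_ge_atTop {i}] with s hs
        refine (Set.indicator_of_notMem (Set.notMem_compl_iff.2 ?_) _).symm
        exact Set.mem_biUnion (hs (Finset.mem_singleton_self i)) hi
  rw [lintegral_zero] at hlim
  rw [HasSum, tendsto_iff_edist_tendsto_0, ENNReal.tendsto_nhds_zero]
  intro ε hε
  filter_upwards [ENNReal.tendsto_nhds_zero.1 hlim (ε ^ 2) (ENNReal.pow_pos hε 2)] with s hs
  rw [← enorm_sq_sum_toLp_indicator_sub h hB hd] at hs
  rw [edist_eq_enorm_sub]
  exact (ENNReal.pow_right_strictMono two_ne_zero).le_iff_le.1 hs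

end Indicator

lemma ae_eq_zero_of_mem_shiftInvariantSpace {f H : L2R}
    (hH : H ∈ shiftInvariantSpace (Set.range fun _ : Fin 1 => f)) :
    ∀ᵐ x, fourierL2 f x = 0 → fourierL2 H x = 0 := by
  filter_upwards [ae_fourierFiber_mem_span (fun _ : Fin 1 => f) hH] with x hx h0
  rw [Set.range_const, Submodule.mem_span_singleton] at hx
  obtain ⟨c, hc⟩ := hx
  have hc0 := congrFun hc 0
  simp only [fourierFiber, Pi.smul_apply, Int.cast_zero, add_zero, smul_eq_mul, h0,
    mul_zero] at hc0
  exact hc0.symm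

lemma coe_linearCombination_integerTranslates {K : ℕ} (F : Fin K → L2R) (a : Fin K × ℤ →₀ ℂ) :
    (Finsupp.linearCombination ℂ (integerTranslates F) a : L2R)
      = Finsupp.linearCombination ℂ (fun i : Fin K × ℤ => l2Translate i.2 (F i.1)) a :=
  Finsupp.apply_linearCombination ℂ (shiftInvariantSpace (Set.range F)).subtype
    (integerTranslates F) a

lemma linearCombination_mem_shiftInvariantSpace {K : ℕ} (F : Fin K → L2R) (a : Fin K × ℤ →₀ ℂ) :
    Finsupp.linearCombination ℂ (fun i : Fin K × ℤ => l2Translate i.2 (F i.1)) a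
      ∈ shiftInvariantSpace (Set.range F) :=
  coe_linearCombination_integerTranslates F a ▸ Subtype.coe_prop _

section BandLimited

variable {f : L2R}

lemma exists_memLp_multiplier {B : Set ℝ} (hB : MeasurableSet B) {c : ℝ} (hc0 : 0 ≤ c)
    (hc : ∀ᵐ x, x ∈ B → 1 ≤ c * ‖fourierL2 f x‖) {H P : L2R}
    (hP : fourierL2 P =ᵐ[volume] B.indicator (fourierL2 H)) :
    ∃ m : ℝ → ℂ, MemLp m 2 volume ∧ (∀ x ∉ B, m x = 0) ∧
      (eLpNorm m 2 volume).toReal ≤ c * ‖H‖ ∧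
      fourierL2 P =ᵐ[volume] fun x => m x * fourierL2 f x := by
  have hzero : ∀ x ∉ B, B.indicator (fun x => fourierL2 H x * (fourierL2 f x)⁻¹) x = 0 :=
    fun x hx => Set.indicator_of_notMem hx _
  have hne : ∀ᵐ x, x ∈ B → 0 < ‖fourierL2 f x‖ := by
    filter_upwards [hc] with x hx hxB
    exact pos_of_mul_pos_right (one_pos.trans_le (hx hxB)) hc0
  have hle : ∀ᵐ x, ‖B.indicator (fun x => fourierL2 H x * (fourierL2 f x)⁻¹) x‖
      ≤ c * ‖fourierL2 H x‖ := by
    filter_upwards [hc, hne] with x hx hpos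
    by_cases hxB : x ∈ B
    · rw [Set.indicator_of_mem hxB, norm_mul, norm_inv, mul_comm c]
      exact mul_le_mul_of_nonneg_left ((inv_le_iff_one_le_mul₀ (hpos hxB)).2 (hx hxB))
        (norm_nonneg _)
    · rw [hzero x hxB, norm_zero]
      positivity
  refine ⟨B.indicator fun x => fourierL2 H x * (fourierL2 f x)⁻¹,
    (Lp.memLp (fourierL2 H)).of_le_mul (((Lp.aestronglyMeasurable _).mul
    (Lp.aestronglyMeasurable _).inv₀).indicator hB) hle, hzero, ?_, ?_⟩
  · have hmul := ENNReal.toReal_mono (by finiteness) (eLpNorm_le_mul_eLpNorm_of_ae_le_mul hle 2)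
    rwa [ENNReal.toReal_mul, ENNReal.toReal_ofReal hc0, ← Lp.norm_def, fourierL2.norm_map] at hmul
  · filter_upwards [hP, hne] with x hx hpos
    rw [hx]
    by_cases hxB : x ∈ B
    · rw [Set.indicator_of_mem hxB, Set.indicator_of_mem hxB,
        inv_mul_cancel_right₀ (norm_pos_iff.1 (hpos hxB))]
    · rw [hzero x hxB, Set.indicator_of_notMem hxB, zero_mul]

/-- The multiplier `Ĥ / f̂` on `B` has `L²`-norm at most `c ‖H‖`, hence `L¹`-norm at most
`|B|^(1/2) c ‖H‖`; the `ℓ^q`-norm of its Fourier coefficients interpolates between the two. -/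
lemma exists_linearCombination_near_piece
    (hf : ∀ᵐ x, ‖fourierL2 f x‖ ≤ (Set.Ioc (0 : ℝ) 1).indicator 1 x) {q : ℝ≥0∞} (hq : 2 ≤ q)
    {B : Set ℝ} (hB : MeasurableSet B) (hBsub : B ⊆ Set.Ioc 0 1) {c : ℝ} (hc0 : 0 ≤ c)
    (hc : ∀ᵐ x, x ∈ B → 1 ≤ c * ‖fourierL2 f x‖) {H P : L2R}
    (hP : fourierL2 P =ᵐ[volume] B.indicator (fourierL2 H)) {ε : ℝ} (hε : 0 < ε) :
    ∃ a : Fin 1 × ℤ →₀ ℂ,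
      lqNorm q a ≤ volume.real B ^ (1 / 2 - 1 / q.toReal) * c * ‖H‖ ∧
      ‖P - Finsupp.linearCombination ℂ (fun i : Fin 1 × ℤ => l2Translate i.2 f) a‖ < ε := by
  obtain ⟨m, hm, hmB, hN, hPm⟩ := exists_memLp_multiplier hB hc0 hc hP
  obtain ⟨U, hU, hU2, hU1⟩ := exists_addCircle_ae_eq_eLpNorm_le hm hBsub hmB
  obtain ⟨a, ha, haε⟩ := exists_norm_sub_linearCombination_lt hf hq hU hPm hε
  refine ⟨a, ha.trans ?_, haε⟩
  set N : ℝ := (eLpNorm m 2 volume).toReal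
  have hN0 : 0 ≤ N := ENNReal.toReal_nonneg
  have hv : 0 ≤ volume.real B := measureReal_nonneg
  have hq1 := two_div_toReal_le_one hq
  calc _ ≤ (volume.real B ^ (1 / 2 : ℝ) * N) ^ (1 - 2 / q.toReal) * N ^ (2 / q.toReal) :=
        mul_le_mul (Real.rpow_le_rpow ENNReal.toReal_nonneg hU1 (by linarith))
          (Real.rpow_le_rpow (norm_nonneg _) hU2 (by positivity)) (by positivity) (by positivity)
    _ = volume.real B ^ (1 / 2 - 1 / q.toReal) * N := by
        rw [Real.mul_rpow (by positivity) hN0, ← Real.rpow_mul hv, mul_assoc,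
          ← Real.rpow_add_of_nonneg hN0 (by linarith) (by positivity), sub_add_cancel,
          Real.rpow_one]
        ring_nf
    _ ≤ _ := by rw [mul_assoc]; gcongr

lemma exists_hasSum_fourierL2_eq_indicator {κ : Type*} [Countable κ] {B : κ → Set ℝ}
    (hB : ∀ i, MeasurableSet (B i)) (hd : Pairwise (Function.onFun Disjoint B)) {H : L2R}
    (hcov : ∀ᵐ x, fourierL2 H x ≠ 0 → ∃ i, x ∈ B i) :
    ∃ P : κ → L2R, HasSum P H ∧
      ∀ i, fourierL2 (P i) =ᵐ[volume] (B i).indicator (fourierL2 H) := by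
  have hsum := hasSum_toLp_indicator (fourierL2 H) hB hd hcov
  refine ⟨fun i => fourierL2.symm (((Lp.memLp (fourierL2 H)).indicator (hB i)).toLp _), ?_,
    fun i => ?_⟩
  · have hmap := fourierL2.symm.toContinuousLinearEquiv.hasSum'.2 hsum
    rwa [LinearIsometryEquiv.coe_toContinuousLinearEquiv,
      LinearIsometryEquiv.symm_apply_apply] at hmap
  · rw [LinearIsometryEquiv.apply_symm_apply]
    exact MemLp.coeFn_toLp _

lemma exists_linearCombination_near_finset
    (hf : ∀ᵐ x, ‖fourierL2 f x‖ ≤ (Set.Ioc (0 : ℝ) 1).indicator 1 x) {q : ℝ≥0∞} (hq : 2 ≤ q)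
    {κ : Type*} {B : κ → Set ℝ} (hB : ∀ i, MeasurableSet (B i)) (hBsub : ∀ i, B i ⊆ Set.Ioc 0 1)
    {c : κ → ℝ} (hc0 : ∀ i, 0 ≤ c i) (hc : ∀ i, ∀ᵐ x, x ∈ B i → 1 ≤ c i * ‖fourierL2 f x‖)
    {H : L2R} {P : κ → L2R} (hP : ∀ i, fourierL2 (P i) =ᵐ[volume] (B i).indicator (fourierL2 H))
    (s : Finset κ) {ε : ℝ} (hε : 0 < ε) :
    ∃ a : Fin 1 × ℤ →₀ ℂ,
      lqNorm q a ≤ (∑ i ∈ s, volume.real (B i) ^ (1 / 2 - 1 / q.toReal) * c i) * ‖H‖ ∧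
      ‖∑ i ∈ s, P i - Finsupp.linearCombination ℂ (fun i : Fin 1 × ℤ => l2Translate i.2 f) a‖
        < ε := by
  have hδ : 0 < ε / (s.card + 1) := by positivity
  choose a ha haδ using fun i =>
    exists_linearCombination_near_piece hf hq (hB i) (hBsub i) (hc0 i) (hc i) (hP i) hδ
  refine ⟨∑ i ∈ s, a i, ?_, ?_⟩
  · rw [Finset.sum_mul]
    exact (lqNorm_sum_le (one_le_two.trans hq) _ _).trans (Finset.sum_le_sum fun i _ => ha i)
  · rw [map_sum, ← Finset.sum_sub_distrib]
    calc _ ≤ ∑ _i ∈ s, ε / (s.card + 1) := norm_sum_le_of_le s fun i _ => (haδ i).le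
      _ = s.card / (s.card + 1) * ε := by
          rw [Finset.sum_const, nsmul_eq_mul]
          ring
      _ < ε := mul_lt_of_lt_one_left hε ((div_lt_one (by positivity)).2 (lt_add_one _))

lemma isCqSystem_integerTranslates_of_pieces
    (hf : ∀ᵐ x, ‖fourierL2 f x‖ ≤ (Set.Ioc (0 : ℝ) 1).indicator 1 x) {q : ℝ≥0∞} (hq : 2 ≤ q)
    {κ : Type*} [Countable κ] {B : κ → Set ℝ} (hB : ∀ i, MeasurableSet (B i))
    (hBsub : ∀ i, B i ⊆ Set.Ioc 0 1) (hd : Pairwise (Function.onFun Disjoint B))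
    (hcov : ∀ᵐ x, fourierL2 f x ≠ 0 → ∃ i, x ∈ B i) {c : κ → ℝ} (hc0 : ∀ i, 0 ≤ c i)
    (hc : ∀ i, ∀ᵐ x, x ∈ B i → 1 ≤ c i * ‖fourierL2 f x‖)
    (hsum : Summable fun i => volume.real (B i) ^ (1 / 2 - 1 / q.toReal) * c i) :
    IsCqSystem q (integerTranslates fun _ : Fin 1 => f) := by
  have hw0 : ∀ i, 0 ≤ volume.real (B i) ^ (1 / 2 - 1 / q.toReal) * c i := fun i =>
    mul_nonneg (Real.rpow_nonneg measureReal_nonneg _) (hc0 i)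
  refine ⟨∑' i, volume.real (B i) ^ (1 / 2 - 1 / q.toReal) * c i + 1,
    add_pos_of_nonneg_of_pos (tsum_nonneg hw0) one_pos, fun H ε hε => ?_⟩
  have hcovH : ∀ᵐ x, fourierL2 (H : L2R) x ≠ 0 → ∃ i, x ∈ B i := by
    filter_upwards [ae_eq_zero_of_mem_shiftInvariantSpace H.2, hcov] with x hx hxcov hne
    exact hxcov fun h0 => hne (hx h0)
  obtain ⟨P, hPsum, hP⟩ := exists_hasSum_fourierL2_eq_indicator hB hd hcovH
  obtain ⟨s, htail⟩ := (hPsum.eventually (Metric.ball_mem_nhds (H : L2R) (half_pos hε))).exists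
  rw [dist_comm, dist_eq_norm] at htail
  obtain ⟨a, ha, haε⟩ := exists_linearCombination_near_finset hf hq hB hBsub hc0 hc hP s
    (half_pos hε)
  refine ⟨a, ha.trans (mul_le_mul_of_nonneg_right ?_ (norm_nonneg _)), ?_⟩
  · linarith [hsum.sum_le_tsum s fun i _ => hw0 i]
  · rw [Submodule.coe_norm, Submodule.coe_sub, coe_linearCombination_integerTranslates,
      ← sub_add_sub_cancel (H : L2R) (∑ i ∈ s, P i)]
    exact (norm_add_le _ _).trans_lt (by linarith)

lemma l2Translate_mem_of_bandLimited
    (hf : ∀ᵐ x, ‖fourierL2 f x‖ ≤ (Set.Ioc (0 : ℝ) 1).indicator 1 x) (γ : ℝ) {H : L2R}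
    (hH : H ∈ shiftInvariantSpace (Set.range fun _ : Fin 1 => f)) :
    l2Translate γ H ∈ shiftInvariantSpace (Set.range fun _ : Fin 1 => f) := by
  refine l2Translate_mem_of_forall ?_ hH
  rintro _ ⟨-, rfl⟩ n
  rw [l2Translate_comm]
  refine l2Translate_int_mem ?_ n
  have hcl := isClosed_shiftInvariantSpace (Set.range fun _ : Fin 1 => f)
  refine hcl.closure_subset (Metric.mem_closure_iff.2 fun ε hε => ?_)
  have hm : MemLp (fun x => (𝐞 (-(γ * x)) : ℂ)) 2 (volume.restrict (Set.Ioc 0 1)) :=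
    MemLp.of_bound (by fun_prop) 1 (Eventually.of_forall fun x => (Circle.norm_coe _).le)
  obtain ⟨U, hU⟩ := exists_addCircle_ae_eq hm
  obtain ⟨a, -, ha⟩ := exists_norm_sub_linearCombination_lt hf le_rfl hU
    (fourierL2_l2Translate γ f) hε
  exact ⟨_, linearCombination_mem_shiftInvariantSpace (fun _ : Fin 1 => f) a,
    by rwa [dist_eq_norm]⟩

end BandLimited

section Systems

variable {ι H : Type*} [NormedAddCommGroup H] [InnerProductSpace ℂ H] {g : ι → H}

lemma IsCqSystem.isCompleteSystem {q : ℝ≥0∞} (hg : IsCqSystem q g) : IsCompleteSystem g := by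
  obtain ⟨C, -, h⟩ := hg
  refine eq_top_iff.2 fun f _ => Metric.mem_closure_iff.2 fun ε hε => ?_
  obtain ⟨a, -, ha⟩ := h f ε hε
  refine ⟨_, ?_, by rwa [dist_eq_norm]⟩
  rw [← Finsupp.range_linearCombination]
  exact LinearMap.mem_range_self _ a

lemma isMinimalSystem_of_dual (φ : ι → H →L[ℂ] ℂ) (hφ : ∀ i j, φ i (g j) = 0 ↔ j ≠ i) :
    IsMinimalSystem g := by
  intro i hmem
  have hle : (Submodule.span ℂ (g '' {i}ᶜ)).topologicalClosure ≤ LinearMap.ker (φ i).toLinearMap :=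
    Submodule.topologicalClosure_minimal _ (Submodule.span_le.2 (Set.image_subset_iff.2
      fun j hj => (hφ i j).2 hj)) (φ i).isClosed_ker
  exact (hφ i i).1 (hle hmem) rfl

end Systems

lemma TranslatesBiorthogonal.isMinimalSystem {K : ℕ} {F h : Fin K → L2R}
    (hFh : TranslatesBiorthogonal F h) : IsMinimalSystem (integerTranslates F) := by
  refine isMinimalSystem_of_dual (fun i => (innerSL ℂ (l2Translate i.2 (h i.1))).comp
    (shiftInvariantSpace (Set.range F)).subtypeL) fun i j => ?_
  change inner ℂ (l2Translate i.2 (h i.1)) (l2Translate j.2 (F j.1)) = 0 ↔ _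
  rw [← inner_conj_symm, hFh.inner_l2Translate, ne_eq, Prod.ext_iff]
  split_ifs with hij <;> simp [hij]

/-! ### Powers of the distance to the boundary of the unit interval -/

/-- The distance from a point of `(0, 1)` to the boundary of the unit interval; it is non-positive
at all other points. -/
noncomputable def edgeDist (x : ℝ) : ℝ := min x (1 - x)

/-- The power `d ^ r` of the distance `d` to the boundary of the unit interval, extended by zero
outside `(0, 1)`. -/
noncomputable def edgePow (r x : ℝ) : ℝ := if 0 < edgeDist x then edgeDist x ^ r else 0

lemma edgeDist_pos_iff {x : ℝ} : 0 < edgeDist x ↔ x ∈ Set.Ioo (0 : ℝ) 1 := by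
  rw [edgeDist, lt_min_iff, sub_pos, Set.mem_Ioo]

lemma edgeDist_le_one (x : ℝ) : edgeDist x ≤ 1 :=
  min_le_iff.2 ((le_total x 1).imp id fun h => by linarith)

lemma continuous_edgeDist : Continuous edgeDist := by
  unfold edgeDist
  fun_prop

lemma edgeDist_sub_le (x y : ℝ) : edgeDist x - edgeDist y ≤ |x - y| := by
  rw [sub_le_iff_le_add, edgeDist, edgeDist, ← min_add_add_left]
  exact min_le_min (by linarith [le_abs_self (x - y)]) (by linarith [neg_le_abs (x - y)])

lemma edgePow_nonneg (r x : ℝ) : 0 ≤ edgePow r x := by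
  unfold edgePow
  split_ifs with h
  · positivity
  · exact le_rfl

lemma edgePow_of_mem {r x : ℝ} (hx : x ∈ Set.Ioo (0 : ℝ) 1) : edgePow r x = edgeDist x ^ r :=
  if_pos (edgeDist_pos_iff.2 hx)

lemma edgePow_of_notMem {r x : ℝ} (hx : x ∉ Set.Ioo (0 : ℝ) 1) : edgePow r x = 0 :=
  if_neg fun h => hx (edgeDist_pos_iff.1 h)

lemma edgePow_le_one {r : ℝ} (hr : 0 ≤ r) (x : ℝ) : edgePow r x ≤ 1 := by
  unfold edgePow
  split_ifs with h
  · exact Real.rpow_le_one h.le (edgeDist_le_one x) hr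
  · exact zero_le_one

lemma edgePow_mul_edgePow (r s x : ℝ) : edgePow r x * edgePow s x = edgePow (r + s) x := by
  unfold edgePow
  split_ifs with h
  · rw [Real.rpow_add h]
  · rw [zero_mul]

lemma measurable_edgePow (r : ℝ) : Measurable (edgePow r) :=
  Measurable.ite (measurableSet_lt measurable_const continuous_edgeDist.measurable)
    (continuous_edgeDist.measurable.pow_const r) measurable_const

lemma integrable_edgePow {r : ℝ} (hr : -1 < r) : Integrable (edgePow r) := by
  have hleft : IntegrableOn (fun x : ℝ => x ^ r) (Set.Ioo 0 1) :=
    (intervalIntegrable_iff_integrableOn_Ioo_of_le zero_le_one).1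
      (intervalIntegral.intervalIntegrable_rpow' hr)
  have hright : IntegrableOn (fun x : ℝ => (1 - x) ^ r) (Set.Ioo 0 1) := by
    have hint := (intervalIntegral.intervalIntegrable_rpow' (a := 0) (b := 1) hr).comp_sub_left 1
    rw [sub_zero, sub_self] at hint
    exact (intervalIntegrable_iff_integrableOn_Ioo_of_le zero_le_one).1 hint.symm
  have hsum : Integrable ((Set.Ioo (0 : ℝ) 1).indicator fun x => x ^ r + (1 - x) ^ r) :=
    (integrable_indicator_iff measurableSet_Ioo).2 (hleft.add hright)
  refine hsum.mono' (measurable_edgePow r).aestronglyMeasurable (Eventually.of_forall fun x => ?_)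
  rw [Real.norm_of_nonneg (edgePow_nonneg r x)]
  by_cases hx : x ∈ Set.Ioo (0 : ℝ) 1
  · have hxr : 0 ≤ x ^ r := Real.rpow_nonneg hx.1.le r
    have hxr' : 0 ≤ (1 - x) ^ r := Real.rpow_nonneg (sub_nonneg.2 hx.2.le) r
    rw [Set.indicator_of_mem hx, edgePow_of_mem hx]
    rcases min_choice x (1 - x) with h | h <;> rw [edgeDist, h] <;> linarith
  · rw [Set.indicator_of_notMem hx, edgePow_of_notMem hx]

lemma memLp_edgePow {r : ℝ} (hr : -1 < 2 * r) : MemLp (fun x => (edgePow r x : ℂ)) 2 volume := by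
  have hmeas : Measurable fun x => (edgePow r x : ℂ) :=
    Complex.measurable_ofReal.comp (measurable_edgePow r)
  refine (memLp_two_iff_integrable_sq_norm hmeas.aestronglyMeasurable).2
    ((integrable_edgePow hr).congr (Eventually.of_forall fun x => ?_))
  beta_reduce
  rw [Complex.norm_of_nonneg (edgePow_nonneg r x), sq, edgePow_mul_edgePow, two_mul]

lemma rpow_eq_rpow_mul_rpow_sub {a : ℝ} (ha : 0 < a) (α β : ℝ) : a ^ α = a ^ β * a ^ (α - β) := by
  rw [← Real.rpow_add ha, add_sub_cancel]

lemma rpow_sub_rpow_le {a b α β : ℝ} (hb : 0 < b) (hab : b ≤ a) (hβ0 : 0 ≤ β) (hαβ : α ≤ β)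
    (hβ1 : β ≤ 1) : a ^ α - b ^ α ≤ (a - b) ^ β * b ^ (α - β) := by
  have ha : 0 < a := hb.trans_le hab
  have hsub : a ^ β ≤ (a - b) ^ β + b ^ β := by
    simpa only [sub_add_cancel] using Real.rpow_add_le_add_rpow (sub_nonneg.2 hab) hb.le hβ0 hβ1
  have hanti : a ^ (α - β) ≤ b ^ (α - β) :=
    Real.rpow_le_rpow_of_nonpos hb hab (sub_nonpos.2 hαβ)
  calc a ^ α - b ^ α = a ^ β * a ^ (α - β) - b ^ β * b ^ (α - β) := by
        rw [← rpow_eq_rpow_mul_rpow_sub ha, ← rpow_eq_rpow_mul_rpow_sub hb]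
    _ ≤ a ^ β * b ^ (α - β) - b ^ β * b ^ (α - β) :=
        sub_le_sub_right (mul_le_mul_of_nonneg_left hanti (by positivity)) _
    _ = (a ^ β - b ^ β) * b ^ (α - β) := (sub_mul _ _ _).symm
    _ ≤ (a - b) ^ β * b ^ (α - β) :=
        mul_le_mul_of_nonneg_right (sub_le_iff_le_add.2 hsub) (by positivity)

lemma edgePow_sub_le {α β : ℝ} (hα : 0 ≤ α) (hαβ : α ≤ β) (hβ : β ≤ 1) (x y : ℝ) :
    edgePow α x - edgePow α y ≤
      |x - y| ^ β * (edgePow (α - β) x + edgePow (α - β) y) := by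
  have hβ0 : 0 ≤ β := hα.trans hαβ
  have hdist := edgeDist_sub_le x y
  have hx0 := edgePow_nonneg (α - β) x
  have hy0 := edgePow_nonneg (α - β) y
  have hxy0 : 0 ≤ |x - y| ^ β := by positivity
  rcases le_or_gt (edgeDist x) 0 with hx | hx
  · have hxα : edgePow α x = 0 := if_neg hx.not_gt
    linarith [edgePow_nonneg α y, mul_nonneg hxy0 (add_nonneg hx0 hy0)]
  rcases le_or_gt (edgeDist y) 0 with hy | hy
  · have hdx : edgeDist x ^ β ≤ |x - y| ^ β := Real.rpow_le_rpow hx.le (by linarith) hβ0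
    calc edgePow α x - edgePow α y = edgeDist x ^ β * edgePow (α - β) x := by
          rw [edgePow, edgePow, edgePow, if_pos hx, if_neg hy.not_gt, if_pos hx, sub_zero,
            ← rpow_eq_rpow_mul_rpow_sub hx]
      _ ≤ _ := mul_le_mul hdx (le_add_of_nonneg_right hy0) hx0 hxy0
  rcases le_total (edgeDist x) (edgeDist y) with hxy | hxy
  · have hmono : edgePow α x ≤ edgePow α y := by
      rw [edgePow, edgePow, if_pos hx, if_pos hy]
      exact Real.rpow_le_rpow hx.le hxy hα
    linarith [mul_nonneg hxy0 (add_nonneg hx0 hy0)]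
  · calc edgePow α x - edgePow α y
        ≤ (edgeDist x - edgeDist y) ^ β * edgePow (α - β) y := by
          rw [edgePow, edgePow, edgePow, if_pos hx, if_pos hy, if_pos hy]
          exact rpow_sub_rpow_le hy hxy hβ0 hαβ hβ
      _ ≤ _ := mul_le_mul (Real.rpow_le_rpow (sub_nonneg.2 hxy) hdist hβ0)
          (le_add_of_nonneg_left hx0) hy0 hxy0

lemma abs_edgePow_sub_le {α β : ℝ} (hα : 0 ≤ α) (hαβ : α ≤ β) (hβ : β ≤ 1) (x y : ℝ) :
    |edgePow α x - edgePow α y| ≤ |x - y| ^ β * (edgePow (α - β) x + edgePow (α - β) y) := by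
  refine abs_sub_le_iff.2 ⟨edgePow_sub_le hα hαβ hβ x y, ?_⟩
  rw [abs_sub_comm, add_comm]
  exact edgePow_sub_le hα hαβ hβ y x

/-! ### Moments from the modulus of continuity -/

lemma four_mul_abs_le_norm_fourierChar_sub_one {u : ℝ} (hu : |u| ≤ 1 / 2) :
    4 * |u| ≤ ‖(𝐞 u : ℂ) - 1‖ := by
  have hsin := mul_abs_le_abs_sin (x := π * u) (by
    rw [abs_mul, abs_of_pos pi_pos]
    linarith [mul_le_mul_of_nonneg_left hu pi_pos.le])
  rw [abs_mul, abs_of_pos pi_pos, ← mul_assoc, div_mul_cancel₀ _ pi_ne_zero] at hsin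
  rw [norm_fourierChar_sub_one]
  linarith

lemma ofReal_rpow_abs_le_tsum {t : ℝ} (ht : 0 ≤ t) (x : ℝ) :
    ENNReal.ofReal (|x| ^ t) ≤ 1 + ∑' n : ℕ, ENNReal.ofReal ((2 ^ (n + 1) : ℝ) ^ t) *
      ‖(𝐞 ((2 ^ (n + 2) : ℝ)⁻¹ * x) : ℂ) - 1‖ₑ ^ 2 := by
  rcases le_total |x| 1 with hx | hx
  · exact (ENNReal.ofReal_le_one.2 (Real.rpow_le_one (abs_nonneg _) hx ht)).trans le_self_add
  · obtain ⟨n, hn, hn'⟩ := exists_nat_pow_near hx one_lt_two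
    have habs : |(2 ^ (n + 2) : ℝ)⁻¹ * x| = |x| / 2 ^ (n + 2) := by
      rw [abs_mul, abs_of_pos (by positivity), inv_mul_eq_div]
    have hlower : 1 / 4 ≤ |(2 ^ (n + 2) : ℝ)⁻¹ * x| := by
      rw [habs, le_div_iff₀ (by positivity), pow_add]
      linarith
    have hupper : |(2 ^ (n + 2) : ℝ)⁻¹ * x| ≤ 1 / 2 := by
      rw [habs, div_le_iff₀ (by positivity), pow_succ]
      linarith
    have hone : 1 ≤ ‖(𝐞 ((2 ^ (n + 2) : ℝ)⁻¹ * x) : ℂ) - 1‖ₑ := by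
      rw [← ofReal_norm, ENNReal.one_le_ofReal]
      linarith [four_mul_abs_le_norm_fourierChar_sub_one hupper]
    calc ENNReal.ofReal (|x| ^ t) ≤ ENNReal.ofReal ((2 ^ (n + 1) : ℝ) ^ t) * 1 := by
          rw [mul_one]
          exact ENNReal.ofReal_le_ofReal (Real.rpow_le_rpow (abs_nonneg _) hn'.le ht)
      _ ≤ ENNReal.ofReal ((2 ^ (n + 1) : ℝ) ^ t) *
          ‖(𝐞 ((2 ^ (n + 2) : ℝ)⁻¹ * x) : ℂ) - 1‖ₑ ^ 2 := by
          gcongr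
          exact one_le_pow₀ hone
      _ ≤ _ := (ENNReal.le_tsum n).trans le_add_self

lemma moment_le_tsum {t : ℝ} (ht : 0 ≤ t) (f : L2R) :
    moment t f ≤ ‖f‖ₑ ^ 2 + ∑' n : ℕ, ENNReal.ofReal ((2 ^ (n + 1) : ℝ) ^ t) *
      ‖l2Translate (2 ^ (n + 2) : ℝ)⁻¹ (fourierL2 f) - fourierL2 f‖ₑ ^ 2 := by
  have hmeas : AEMeasurable (fun x => ‖f x‖ₑ ^ 2) volume :=
    (Lp.aestronglyMeasurable f).enorm.pow_const 2
  have hchar : ∀ n : ℕ, AEMeasurable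
      (fun x => ‖(𝐞 ((2 ^ (n + 2) : ℝ)⁻¹ * x) : ℂ) - 1‖ₑ ^ 2 * ‖f x‖ₑ ^ 2) := fun n =>
    AEMeasurable.mul (Measurable.aemeasurable (by fun_prop)) hmeas
  calc moment t f
      ≤ ∫⁻ x, (‖f x‖ₑ ^ 2 + ∑' n : ℕ, ENNReal.ofReal ((2 ^ (n + 1) : ℝ) ^ t) *
          (‖(𝐞 ((2 ^ (n + 2) : ℝ)⁻¹ * x) : ℂ) - 1‖ₑ ^ 2 * ‖f x‖ₑ ^ 2)) := by
        rw [moment_eq]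
        refine lintegral_mono fun x =>
          (mul_le_mul_left (ofReal_rpow_abs_le_tsum ht x) _).trans_eq ?_
        simp only [add_mul, one_mul, ← ENNReal.tsum_mul_right, mul_assoc]
    _ = _ := by
        rw [lintegral_add_left' hmeas, ← enorm_sq_eq_lintegral,
          lintegral_tsum fun n => (hchar n).const_mul _]
        simp only [lintegral_const_mul' _ _ ENNReal.ofReal_ne_top,
          enorm_sq_l2Translate_fourierL2_sub]

lemma moment_lt_top_of_modulus {t β : ℝ} (ht : 0 ≤ t) (htβ : t < 2 * β) {f : L2R} {C : ℝ}
    (h : ∀ a : ℝ, 0 < a →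
      ‖l2Translate a (fourierL2 f) - fourierL2 f‖ₑ ^ 2 ≤ ENNReal.ofReal (C * a ^ (2 * β))) :
    moment t f < ∞ := by
  have hscale : ∀ n : ℕ, (2 ^ (n + 1) : ℝ) ^ t * ((2 ^ (n + 2) : ℝ)⁻¹) ^ (2 * β) =
      2 ^ (t - 4 * β) * (2 ^ (t - 2 * β)) ^ n := fun n => by
    simp only [← Real.rpow_natCast, ← Real.rpow_neg two_pos.le, ← Real.rpow_mul two_pos.le,
      ← Real.rpow_add two_pos]
    push_cast
    ring_nf
  have hterm : ∀ n : ℕ, ENNReal.ofReal ((2 ^ (n + 1) : ℝ) ^ t) *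
      ‖l2Translate (2 ^ (n + 2) : ℝ)⁻¹ (fourierL2 f) - fourierL2 f‖ₑ ^ 2 ≤
      ENNReal.ofReal (C * 2 ^ (t - 4 * β) * (2 ^ (t - 2 * β)) ^ n) := fun n => by
    calc _ ≤ ENNReal.ofReal ((2 ^ (n + 1) : ℝ) ^ t) *
          ENNReal.ofReal (C * ((2 ^ (n + 2) : ℝ)⁻¹) ^ (2 * β)) :=
          mul_le_mul_right (h _ (by positivity)) _
      _ = _ := by
          rw [← ENNReal.ofReal_mul (by positivity), mul_left_comm, hscale, mul_assoc C]
  have hratio : (2 : ℝ) ^ (t - 2 * β) < 1 :=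
    Real.rpow_lt_one_of_one_lt_of_neg one_lt_two (by linarith)
  have hsummable := (summable_geometric_of_lt_one (by positivity) hratio).mul_left
    (C * 2 ^ (t - 4 * β))
  exact (moment_le_tsum ht f).trans_lt (ENNReal.add_lt_top.2
    ⟨by finiteness, (ENNReal.tsum_le_tsum hterm).trans_lt hsummable.tsum_ofReal_lt_top⟩)

lemma sq_edgePow_sub_le {α β : ℝ} (hα : 0 ≤ α) (hαβ : α ≤ β) (hβ : β ≤ 1) (x y : ℝ) :
    (edgePow α x - edgePow α y) ^ 2 ≤ 2 * |x - y| ^ (2 * β) *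
      (edgePow (2 * (α - β)) x + edgePow (2 * (α - β)) y) := by
  have hsq : ∀ z, edgePow (2 * (α - β)) z = edgePow (α - β) z ^ 2 := fun z => by
    rw [sq, edgePow_mul_edgePow, two_mul]
  have hpow : |x - y| ^ (2 * β) = (|x - y| ^ β) ^ 2 := by
    rw [mul_comm, Real.rpow_mul (abs_nonneg _), Real.rpow_two]
  calc (edgePow α x - edgePow α y) ^ 2 = |edgePow α x - edgePow α y| ^ 2 := (sq_abs _).symm
    _ ≤ (|x - y| ^ β * (edgePow (α - β) x + edgePow (α - β) y)) ^ 2 :=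
        pow_le_pow_left₀ (abs_nonneg _) (abs_edgePow_sub_le hα hαβ hβ x y) 2
    _ = |x - y| ^ (2 * β) * (edgePow (α - β) x + edgePow (α - β) y) ^ 2 := by rw [mul_pow, hpow]
    _ ≤ |x - y| ^ (2 * β) * (2 * (edgePow (α - β) x ^ 2 + edgePow (α - β) y ^ 2)) :=
        mul_le_mul_of_nonneg_left add_sq_le (by positivity)
    _ = _ := by rw [hsq, hsq]; ring

lemma enorm_sq_l2Translate_sub_le_of_edgePow {α β : ℝ} (hα : 0 ≤ α) (hαβ : α ≤ β) (hβ : β ≤ 1)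
    (hβα : -1 < 2 * (α - β)) {G : L2R} (hG : G =ᵐ[volume] fun x => (edgePow α x : ℂ)) {a : ℝ}
    (ha : 0 < a) :
    ‖l2Translate a G - G‖ₑ ^ 2 ≤
      ENNReal.ofReal (4 * (∫ x, edgePow (2 * (α - β)) x) * a ^ (2 * β)) := by
  have hint := integrable_edgePow hβα
  have hadd : Integrable fun x => 2 * a ^ (2 * β) *
      (edgePow (2 * (α - β)) (x - a) + edgePow (2 * (α - β)) x) :=
    ((hint.comp_sub_right a).add hint).const_mul _
  have hnorm : ∀ᵐ x, ‖(l2Translate a G - G) x‖ₑ ^ 2 =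
      ENNReal.ofReal ((edgePow α (x - a) - edgePow α x) ^ 2) := by
    filter_upwards [Lp.coeFn_sub (l2Translate a G) G, coeFn_l2Translate a G, hG,
      ae_comp_sub hG a] with x hsub htr hx hxa
    rw [hsub, Pi.sub_apply, htr, hxa, hx, ← Complex.ofReal_sub, ← ofReal_norm, Complex.norm_real,
      Real.norm_eq_abs, ← ENNReal.ofReal_pow (abs_nonneg _), sq_abs]
  rw [enorm_sq_eq_lintegral, lintegral_congr_ae hnorm]
  calc _ ≤ ∫⁻ x, ENNReal.ofReal (2 * a ^ (2 * β) *
          (edgePow (2 * (α - β)) (x - a) + edgePow (2 * (α - β)) x)) := by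
        refine lintegral_mono fun x => ENNReal.ofReal_le_ofReal ?_
        simpa only [sub_sub_cancel_left, abs_neg, abs_of_pos ha]
          using sq_edgePow_sub_le hα hαβ hβ (x - a) x
    _ = ENNReal.ofReal (∫ x, 2 * a ^ (2 * β) *
          (edgePow (2 * (α - β)) (x - a) + edgePow (2 * (α - β)) x)) :=
        (ofReal_integral_eq_lintegral_ofReal hadd (Eventually.of_forall fun x => mul_nonneg
          (by positivity) (add_nonneg (edgePow_nonneg _ _) (edgePow_nonneg _ _)))).symm
    _ = _ := by
        rw [integral_const_mul, integral_add (hint.comp_sub_right a) hint,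
          integral_sub_right_eq_self]
        ring_nf

/-! ### Generators with a power singularity in frequency -/

/-- The function whose Fourier transform is the power `d ^ α` of the distance `d` to the boundary
of the unit interval, extended by zero outside `(0, 1)`. -/
noncomputable def edgeGenerator {α : ℝ} (hα : -1 < 2 * α) : L2R :=
  fourierL2.symm ((memLp_edgePow hα).toLp _)

lemma coeFn_fourierL2_edgeGenerator {α : ℝ} (hα : -1 < 2 * α) :
    fourierL2 (edgeGenerator hα) =ᵐ[volume] fun x => (edgePow α x : ℂ) := by
  rw [edgeGenerator, LinearIsometryEquiv.apply_symm_apply]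
  exact (memLp_edgePow hα).coeFn_toLp

lemma norm_fourierL2_edgeGenerator {α : ℝ} (hα : -1 < 2 * α) :
    ∀ᵐ x, ‖fourierL2 (edgeGenerator hα) x‖ = edgePow α x := by
  filter_upwards [coeFn_fourierL2_edgeGenerator hα] with x hx
  rw [hx, Complex.norm_of_nonneg (edgePow_nonneg α x)]

lemma mem_Ioo_of_fourierL2_edgeGenerator_ne_zero {α : ℝ} (hα : -1 < 2 * α) :
    ∀ᵐ x, fourierL2 (edgeGenerator hα) x ≠ 0 → x ∈ Set.Ioo (0 : ℝ) 1 := by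
  filter_upwards [coeFn_fourierL2_edgeGenerator hα] with x hx hne
  by_contra hmem
  rw [hx, edgePow_of_notMem hmem, Complex.ofReal_zero] at hne
  exact hne rfl

lemma norm_fourierL2_edgeGenerator_le {α : ℝ} (hα : -1 < 2 * α) (hα0 : 0 ≤ α) :
    ∀ᵐ x, ‖fourierL2 (edgeGenerator hα) x‖ ≤ (Set.Ioc (0 : ℝ) 1).indicator 1 x := by
  filter_upwards [norm_fourierL2_edgeGenerator hα] with x hx
  rw [hx]
  by_cases hmem : x ∈ Set.Ioc (0 : ℝ) 1
  · rw [Set.indicator_of_mem hmem]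
    exact edgePow_le_one hα0 x
  · rw [Set.indicator_of_notMem hmem, edgePow_of_notMem fun h => hmem (Set.Ioo_subset_Ioc_self h)]

lemma translatesBiorthogonal_edgeGenerator {α : ℝ} (hα : -1 < 2 * α) (hα' : -1 < 2 * -α) :
    TranslatesBiorthogonal (fun _ : Fin 1 => edgeGenerator hα)
      fun _ : Fin 1 => edgeGenerator hα' := by
  have hprod : ∀ᵐ x, fourierL2 (edgeGenerator hα) x * conj (fourierL2 (edgeGenerator hα') x)
      = (Set.Ioc (0 : ℝ) 1).indicator 1 x := by
    filter_upwards [coeFn_fourierL2_edgeGenerator hα, coeFn_fourierL2_edgeGenerator hα',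
      indicator_ae_eq_of_ae_eq_set (f := (1 : ℝ → ℂ)) Ioo_ae_eq_Ioc] with x hx hx' hind
    rw [hx, hx', Complex.conj_ofReal, ← Complex.ofReal_mul, edgePow_mul_edgePow, add_neg_cancel,
      ← hind]
    by_cases hmem : x ∈ Set.Ioo (0 : ℝ) 1
    · rw [edgePow_of_mem hmem, Real.rpow_zero, Complex.ofReal_one, Set.indicator_of_mem hmem,
        Pi.one_apply]
    · rw [edgePow_of_notMem hmem, Complex.ofReal_zero, Set.indicator_of_notMem hmem]
  intro j k n
  have hinner := integral_fourierChar_mul_fourierL2_mul_conj (edgeGenerator hα)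
    (edgeGenerator hα') (-n)
  rw [neg_neg] at hinner
  calc _ = ∫ x in Set.Ioc (0 : ℝ) 1, (𝐞 ((-n : ℤ) * x) : ℂ) := by
        rw [← hinner, ← integral_indicator measurableSet_Ioc]
        refine integral_congr_ae ?_
        filter_upwards [hprod] with x hx
        rw [hx]
        simp only [Set.indicator_apply, Pi.one_apply, mul_ite, mul_one, mul_zero]
    _ = _ := by
        rw [setIntegral_fourierChar_int_mul]
        simp only [neg_eq_zero, Subsingleton.elim j k, true_and]

lemma hasNontrivialExtraInvariance_edgeGenerator {α : ℝ} (hα : -1 < 2 * α) (hα' : -1 < 2 * -α)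
    (hα0 : 0 ≤ α) : HasNontrivialExtraInvariance
      (shiftInvariantSpace (Set.range fun _ : Fin 1 => edgeGenerator hα)) := by
  have hhalf : (1 / 2 : ℝ) ∉ Set.range ((↑) : ℤ → ℝ) := by
    rintro ⟨n, hn⟩
    have htwo : (2 * n : ℝ) = 1 := by
      rw [hn]
      norm_num
    norm_cast at htwo
    omega
  refine ⟨1 / 2, hhalf, fun h hh =>
    l2Translate_mem_of_bandLimited (norm_fourierL2_edgeGenerator_le hα hα0) _ hh, ?_⟩
  rw [(translatesBiorthogonal_edgeGenerator hα hα').minGenerators_eq, Fintype.card_fin,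
    Nat.cast_one, one_mul]
  exact hhalf

lemma moment_edgeGenerator_lt_top {t α β : ℝ} (ht : 0 ≤ t) (hα : -1 < 2 * α) (hα0 : 0 ≤ α)
    (hαβ : α ≤ β) (hβ : β ≤ 1) (hβα : -1 < 2 * (α - β)) (htβ : t < 2 * β) :
    moment t (edgeGenerator hα) < ∞ :=
  moment_lt_top_of_modulus ht htβ fun _ ha =>
    enorm_sq_l2Translate_sub_le_of_edgePow hα0 hαβ hβ hβα (coeFn_fourierL2_edgeGenerator hα) ha

/-- The points of `(0, 1)` whose distance to the boundary of the unit interval lies in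
`(2⁻¹⁻ⁱ, 2⁻ⁱ]`. -/
def dyadicEdge (i : ℕ) : Set ℝ := edgeDist ⁻¹' Set.Ioc ((1 / 2) ^ (i + 1)) ((1 / 2) ^ i)

lemma measurableSet_dyadicEdge (i : ℕ) : MeasurableSet (dyadicEdge i) :=
  continuous_edgeDist.measurable measurableSet_Ioc

lemma pairwise_disjoint_dyadicEdge : Pairwise (Function.onFun Disjoint dyadicEdge) :=
  (pow_right_anti₀ (by norm_num) (by norm_num)).pairwise_disjoint_on_Ioc_succ.mono
    fun _ _ h => h.preimage _

lemma dyadicEdge_subset_Ioo (i : ℕ) : dyadicEdge i ⊆ Set.Ioo 0 1 := fun _ hx =>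
  edgeDist_pos_iff.1 ((by positivity : (0 : ℝ) < (1 / 2) ^ (i + 1)).trans hx.1)

lemma exists_mem_dyadicEdge {x : ℝ} (hx : x ∈ Set.Ioo (0 : ℝ) 1) : ∃ i, x ∈ dyadicEdge i :=
  exists_nat_pow_near_of_lt_one (edgeDist_pos_iff.2 hx) (edgeDist_le_one x) one_half_pos
    one_half_lt_one

lemma volume_real_dyadicEdge_le (i : ℕ) : volume.real (dyadicEdge i) ≤ 2 * (1 / 2) ^ i := by
  have hsub : dyadicEdge i ⊆ Set.Icc 0 ((1 / 2) ^ i) ∪ Set.Icc (1 - (1 / 2) ^ i) 1 := by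
    intro x hx
    have hx01 := dyadicEdge_subset_Ioo i hx
    rcases min_le_iff.1 hx.2 with h | h
    · exact Or.inl ⟨hx01.1.le, h⟩
    · exact Or.inr ⟨by linarith, hx01.2.le⟩
  calc _ ≤ _ := measureReal_mono hsub (isCompact_Icc.union isCompact_Icc).measure_lt_top.ne
    _ ≤ _ := measureReal_union_le _ _
    _ = _ := by
        rw [Real.volume_real_Icc_of_le (by positivity),
          Real.volume_real_Icc_of_le (sub_le_self _ (by positivity))]
        ring

lemma one_le_rpow_mul_edgePow {α : ℝ} (hα : 0 ≤ α) {i : ℕ} {x : ℝ} (hx : x ∈ dyadicEdge i) :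
    1 ≤ (2 ^ (i + 1) : ℝ) ^ α * edgePow α x := by
  have hmem := dyadicEdge_subset_Ioo i hx
  rw [edgePow_of_mem hmem, ← Real.mul_rpow (by positivity) (edgeDist_pos_iff.2 hmem).le]
  refine Real.one_le_rpow ?_ hα
  calc (1 : ℝ) = 2 ^ (i + 1) * (1 / 2) ^ (i + 1) := by rw [← mul_pow]; norm_num
    _ ≤ _ := mul_le_mul_of_nonneg_left hx.1.le (by positivity)

lemma summable_volume_dyadicEdge_rpow_mul {α s : ℝ} (hs : 0 ≤ s) (hαs : α < s) :
    Summable fun i => volume.real (dyadicEdge i) ^ s * (2 ^ (i + 1) : ℝ) ^ α := by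
  have hratio : (2 : ℝ) ^ (α - s) < 1 := Real.rpow_lt_one_of_one_lt_of_neg one_lt_two (by linarith)
  refine Summable.of_nonneg_of_le (fun i => by positivity) (fun i => ?_)
    ((summable_geometric_of_lt_one (by positivity) hratio).mul_left (2 ^ (s + α)))
  calc _ ≤ (2 * (1 / 2) ^ i) ^ s * (2 ^ (i + 1) : ℝ) ^ α :=
        mul_le_mul_of_nonneg_right
          (Real.rpow_le_rpow measureReal_nonneg (volume_real_dyadicEdge_le i) hs) (by positivity)
    _ = 2 ^ (s + α) * ((2 : ℝ) ^ (α - s)) ^ i := by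
        have hpow : (2 * (1 / 2) ^ i : ℝ) = 2 ^ (1 - i : ℝ) := by
          rw [Real.rpow_sub two_pos, Real.rpow_one, Real.rpow_natCast, one_div_pow, mul_one_div]
        rw [hpow]
        simp only [← Real.rpow_natCast, ← Real.rpow_mul two_pos.le, ← Real.rpow_add two_pos]
        push_cast
        ring_nf

lemma isCqSystem_edgeGenerator {q : ℝ≥0∞} (hq : 2 ≤ q) {α : ℝ} (hα : -1 < 2 * α) (hα0 : 0 ≤ α)
    (hαq : α < 1 / 2 - 1 / q.toReal) :
    IsCqSystem q (integerTranslates fun _ : Fin 1 => edgeGenerator hα) := by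
  refine isCqSystem_integerTranslates_of_pieces (norm_fourierL2_edgeGenerator_le hα hα0) hq
    measurableSet_dyadicEdge (fun i => (dyadicEdge_subset_Ioo i).trans Set.Ioo_subset_Ioc_self)
    pairwise_disjoint_dyadicEdge ?_ (fun i => by positivity) (fun i => ?_)
    (summable_volume_dyadicEdge_rpow_mul (hα0.trans hαq.le) hαq)
  · filter_upwards [mem_Ioo_of_fourierL2_edgeGenerator_ne_zero hα] with x hx hne
    exact exists_mem_dyadicEdge (hx hne)
  · filter_upwards [norm_fourierL2_edgeGenerator hα] with x hx hmem
    rw [hx]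
    exact one_le_rpow_mul_edgePow hα0 hmem

lemma isCqSystem_edgeGenerator_zero {q : ℝ≥0∞} (hq : 2 ≤ q) (h0 : (-1 : ℝ) < 2 * 0) :
    IsCqSystem q (integerTranslates fun _ : Fin 1 => edgeGenerator h0) := by
  refine isCqSystem_integerTranslates_of_pieces (norm_fourierL2_edgeGenerator_le h0 le_rfl) hq
    (B := fun _ : Unit => Set.Ioo 0 1) (c := 1) (fun _ => measurableSet_Ioo)
    (fun _ => Set.Ioo_subset_Ioc_self) Subsingleton.pairwise ?_ (fun _ => zero_le_one)
    (fun _ => ?_) (hasSum_fintype _).summable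
  · filter_upwards [mem_Ioo_of_fourierL2_edgeGenerator_ne_zero h0] with x hx hne
    exact ⟨(), hx hne⟩
  · filter_upwards [norm_fourierL2_edgeGenerator h0] with x hx hmem
    rw [hx, edgePow_of_mem hmem, Real.rpow_zero, Pi.one_apply, one_mul]

lemma exists_edgeGenerator {q q' : ℝ≥0∞} (hq : 2 ≤ q) (hqq' : ENNReal.HolderConjugate q q') {t : ℝ}
    (ht : 0 ≤ t) (htq : t < 2 / q'.toReal) :
    ∃ (α : ℝ) (hα : -1 < 2 * α), -1 < 2 * -α ∧ 0 ≤ α ∧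
      IsCqSystem q (integerTranslates fun _ : Fin 1 => edgeGenerator hα) ∧
      moment t (edgeGenerator hα) < ∞ := by
  have hq0 : 0 ≤ 1 / q.toReal := by positivity
  have htq2 : t < 2 * (1 - 1 / q.toReal) := by
    rw [← one_div_toReal_of_holderConjugate hqq', mul_one_div]
    exact htq
  rcases lt_or_ge t 1 with ht1 | ht1
  · have h0 : (-1 : ℝ) < 2 * 0 := by norm_num
    exact ⟨0, h0, by norm_num, le_rfl, isCqSystem_edgeGenerator_zero hq h0,
      moment_edgeGenerator_lt_top (β := (t + 1) / 4) ht h0 le_rfl (by linarith) (by linarith)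
        (by linarith) (by linarith)⟩
  · -- `α` is the midpoint of the interval `((t - 1) / 2, 1 / 2 - 1 / q)` of admissible exponents
    obtain ⟨α, hα⟩ : ∃ α : ℝ, α = ((t - 1) / 2 + (1 / 2 - 1 / q.toReal)) / 2 := ⟨_, rfl⟩
    have hα1 : -1 < 2 * α := by linarith
    exact ⟨α, hα1, by linarith, by linarith,
      isCqSystem_edgeGenerator hq hα1 (by linarith) (by linarith),
      moment_edgeGenerator_lt_top (β := (t + (1 + 2 * α)) / 4) ht hα1 (by linarith) (by linarith)
        (by linarith) (by linarith) (by linarith)⟩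

theorem theorem1p7 (q q' : ℝ≥0∞) (hq : 2 ≤ q) (hqq' : ENNReal.HolderConjugate q q') :
    (∀ (K : ℕ) (F : Fin K → L2R),
      HasNontrivialExtraInvariance (shiftInvariantSpace (Set.range F)) →
      IsExactCqSystem q (integerTranslates F) →
      ∃ k : Fin K, ∀ t : ℝ, 2 / q'.toReal ≤ t → moment t (F k) = ∞) ∧
    (∀ t : ℝ, 0 ≤ t → t < 2 / q'.toReal →
      ∃ F : Fin 1 → L2R,
        HasNontrivialExtraInvariance (shiftInvariantSpace (Set.range F)) ∧
        IsExactCqSystem q (integerTranslates F) ∧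
        ∀ k : Fin 1, moment t (F k) < ∞) := by
  refine ⟨fun K F hV hF => ?_, fun t ht htq => ?_⟩
  · obtain ⟨k, hk⟩ := exists_moment_eq_top hqq' hV hF
    exact ⟨k, fun t ht => moment_eq_top_mono (by positivity) ht hk⟩
  · obtain ⟨α, hα, hα', hα0, hC, hm⟩ := exists_edgeGenerator hq hqq' ht htq
    exact ⟨fun _ => edgeGenerator hα, hasNontrivialExtraInvariance_edgeGenerator hα hα' hα0,
      ⟨⟨hC.isCompleteSystem, (translatesBiorthogonal_edgeGenerator hα hα').isMinimalSystem⟩, hC⟩,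
      fun _ => hm⟩
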